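/- **Setting.** Let $\mathcal Q$ be a natural join: a finite family of finite relations, where each relation $R$ is a set of tuples $u:\mathrm{schema}(R)\to\mathbf{dom}$ over a finite attribute set $\mathrm{schema}(R)$, and $\mathbf{dom}$ is a countably infinite set of values. Put $\mathcal V=\mathrm{schema}(\mathcal Q)=\bigcup_{R\in\mathcal Q}\mathrm{schema}(R)$, and let $\mathrm{join}(\mathcal Q)$ be the set of tuples $u$ over $\mathcal V$ such that $u[\mathrm{schema}(R)]\in R$ for every $R\in\mathcal Q$. Put $\mathrm{IN}=\sum_{R\in\mathcal Q}|R|$ and $\mathrm{OUT}=|\mathrm{join}(\mathcal Q)|$. A *degree constraint* is a triple $(X,Y,N)$ with $X\subsetneq Y\subseteq\mathcal V$ and an integer $N\ge 1$. A relation $R$ *guards* it if $Y\subseteq\mathrm{schema}(R)$ and, for each tuple $t$ over $X$, the tuples $v\in R$ with $v[X]=t$ have at most $N$ distinct projections $v[Y]$. The join is *consistent* with a finite set $\mathsf{DC}$ of degree constraints if each of them is guarded by some relation of $\mathcal Q$. The set $\mathsf{DC}$ is *acyclic* if the directed graph on $\mathcal V$ with an edge $(A,B)$ whenever $A\in X$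 and $B\in Y\setminus X$ for some $(X,Y,N)\in\mathsf{DC}$ has no directed cycle; the join itself may be cyclic. The cardinality constraint $(\emptyset,\mathrm{schema}(R),\max\{1,|R|\})$ of each relation $R\in\mathcal Q$ is always understood to belong to $\mathsf{DC}$. The *polymatroid bound* is $$\mathrm{polymat}(\mathsf{DC})=2^{\max_h h(\mathcal V)},$$ where $h$ ranges over the functions $h:2^{\mathcal V}\to\mathbb R_{\ge0}$ with $h(\emptyset)=0$ that are monotone and submodular and satisfy $h(Y)-h(X)\le\log_2 N$ for all $(X,Y,N)\in\mathsf{DC}$. The machine is a randomized word RAM with words of $w\ge b\log_2(\mathrm{IN}+2)$ bits for a suitable constant $b$, in which each value of the input fits into one word. Memory is initially zero apart from the input, and reading or writing a memory cell, integer arithmetic on words, comparing two words, and drawing a uniformly random integer from $\{0,\dots,x-1\}$ for a given word $x\geq 1$ take one step each. Data complexity is used: the attributes, the schemas of the relations, and the pairs $(X,Y)$ of the constraints $(X,Y,N)\in\mathsf{DC}$ are fixed, and the programs and all constants may depend on these only. **Theorem.** For every join $\mathcal Q$ consistent with an acyclic set $\mathsf{DC}$ of degree constraints there is a data structure that can be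 built in $O(\max\{1,\mathrm{IN}\})$ expected time and that supports an arbitrary sequence of join sampling operations, as follows. Each operation returns a tuple drawn uniformly at random from $\mathrm{join}(\mathcal Q)$ if $\mathrm{join}(\mathcal Q)\ne\emptyset$, and reports that $\mathrm{join}(\mathcal Q)=\emptyset$ otherwise; the answers of the operations are mutually independent; and each operation takes $O\big(\mathrm{polymat}(\mathsf{DC})/\max\{1,\mathrm{OUT}\}\big)$ expected time. -/

import Mathlib

open scoped ENNReal

namespace JoinSampling

/-! ### Joins, degree constraints and the polymatroid bound

The attributes of the join are `0, …, k - 1`, values are natural numbers, and a tuple over a set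
`X` of attributes is a function `X → ℕ`. Projection of a tuple is `Finset.restrict₂`
(`Finset.restrict` for a tuple over all attributes). -/

/-- A natural join: a family of relations, where relation `r` is a finite set of tuples over
`schema r`. -/
abbrev Join {k m : ℕ} (schema : Fin m → Finset (Fin k)) : Type :=
  ∀ r : Fin m, Finset (schema r → ℕ)

/-- The join result: all tuples over all attributes whose projection on each `schema r` belongs
to relation `r`. -/
def joinResult {k m : ℕ} {schema : Fin m → Finset (Fin k)} (Q : Join schema) :
    Set (Fin k → ℕ) :=
  {u | ∀ r, (schema r).restrict u ∈ Q r}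

/-- The join result is finite as soon as every attribute belongs to some schema, so that counting
it with `Set.ncard` is meaningful. -/
theorem joinResult_finite {k m : ℕ} {schema : Fin m → Finset (Fin k)} (Q : Join schema)
    (hcover : ∀ a, ∃ r, a ∈ schema r) : (joinResult Q).Finite := by
  choose f hf using hcover
  refine (Set.Finite.pi' (t := fun a => {x | ∃ t ∈ Q (f a), t ⟨a, hf a⟩ = x})
    (fun a => ?_)).subset ?_
  · exact ((Q (f a)).finite_toSet.image (fun t => t ⟨a, hf a⟩)).subset
      (fun x ⟨t, ht, hx⟩ => ⟨t, ht, hx⟩)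
  · intro u hu a
    exact ⟨_, hu (f a), rfl⟩

/-- The input size: the total number of tuples. -/
def inputSize {k m : ℕ} {schema : Fin m → Finset (Fin k)} (Q : Join schema) : ℕ :=
  ∑ r, (Q r).card

/-- The output size: the number of tuples in the join result. -/
noncomputable def outputSize {k m : ℕ} {schema : Fin m → Finset (Fin k)} (Q : Join schema) : ℕ :=
  (joinResult Q).ncard

/-- The maximum, over the tuples `u` over `X`, of the number of distinct `Y`-projections of the
tuples of `R` that agree with `u` on `X`. Only the tuples `u` that occur in `R` matter: all others
contribute `0`. -/
def degree {k : ℕ} {S X Y : Finset (Fin k)} (hX : X ⊆ S) (hY : Y ⊆ S) (R : Finset (S → ℕ)) : ℕ :=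
  (R.image (Finset.restrict₂ (π := fun _ => ℕ) hX)).sup fun u =>
    ((R.filter fun v => Finset.restrict₂ (π := fun _ => ℕ) hX v = u).image
      (Finset.restrict₂ (π := fun _ => ℕ) hY)).card

/-- A degree constraint `(X, Y, N)`. -/
structure DegreeConstraint (k : ℕ) where
  lhs : Finset (Fin k)
  rhs : Finset (Fin k)
  bound : ℕ
  deriving DecidableEq

/-- The pair `(X, Y)` of a degree constraint `(X, Y, N)`. -/
def DegreeConstraint.pair {k : ℕ} (c : DegreeConstraint k) : Finset (Fin k) × Finset (Fin k) :=
  (c.lhs, c.rhs)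

/-- `X` is a proper subset of `Y`, and `N ≥ 1`. -/
def DegreeConstraint.WellFormed {k : ℕ} (c : DegreeConstraint k) : Prop :=
  c.lhs ⊂ c.rhs ∧ 1 ≤ c.bound

/-- The relation `R` with schema `S` guards `c`: the set `Y` (hence `X`) is contained in the
schema, and the degree of `R` is at most `N`. -/
def DegreeConstraint.GuardedBy {k : ℕ} (c : DegreeConstraint k) {S : Finset (Fin k)}
    (R : Finset (S → ℕ)) : Prop :=
  ∃ (hX : c.lhs ⊆ S) (hY : c.rhs ⊆ S), degree hX hY R ≤ c.bound

/-- The join is consistent with `DC`: every constraint is guarded by some relation. -/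
def Consistent {k m : ℕ} {schema : Fin m → Finset (Fin k)} (Q : Join schema)
    (DC : Finset (DegreeConstraint k)) : Prop :=
  ∀ c ∈ DC, ∃ r, c.GuardedBy (Q r)

/-- The edges of the constraint dependency graph. -/
def DependencyEdge {k : ℕ} (DC : Finset (DegreeConstraint k)) (A B : Fin k) : Prop :=
  ∃ c ∈ DC, A ∈ c.lhs ∧ B ∈ c.rhs \ c.lhs

/-- The constraint dependency graph has no directed cycle. -/
def Acyclic {k : ℕ} (DC : Finset (DegreeConstraint k)) : Prop :=
  ∀ A, ¬ Relation.TransGen (DependencyEdge DC) A A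

/-- The cardinality constraints `(∅, schema R, |R|)` that the relations of a join always carry.
Bounds have to be at least `1`, so an empty relation gets the bound `1`. -/
def cardinalityConstraints {k m : ℕ} {schema : Fin m → Finset (Fin k)} (Q : Join schema) :
    Finset (DegreeConstraint k) :=
  Finset.univ.image fun r => ⟨∅, schema r, max 1 (Q r).card⟩

/-- Non-negative, zero-grounded, monotone, submodular set functions. -/
structure IsPolymatroid {k : ℕ} (h : Finset (Fin k) → ℝ) : Prop where
  nonneg : ∀ X, 0 ≤ h X
  zero_grounded : h ∅ = 0
  monotone : ∀ X Y, X ⊆ Y → h X ≤ h Y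
  submodular : ∀ X Y, h (X ∪ Y) + h (X ∩ Y) ≤ h X + h Y

/-- `h Y - h X ≤ log₂ N` for each rule `(X, Y, N)`. -/
def Respects {k : ℕ} (h : Finset (Fin k) → ℝ) (DC : Finset (DegreeConstraint k)) : Prop :=
  ∀ c ∈ DC, h c.rhs - h c.lhs ≤ Real.logb 2 c.bound

/-- The polymatroid bound: the largest `2 ^ h(all attributes)` over the polymatroids `h` that
respect the rules (`∞` if these values are unbounded). -/
noncomputable def polymat {k : ℕ} (DC : Finset (DegreeConstraint k)) : ℝ≥0∞ :=
  ⨆ (h : Finset (Fin k) → ℝ) (_ : IsPolymatroid h) (_ : Respects h DC),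
    ENNReal.ofReal ((2 : ℝ) ^ h Finset.univ)

/-! ### A randomized word RAM

Words are the natural numbers below `2 ^ w`. A program uses scalar registers, each holding a word,
and arrays (the random access memory), indexed by words and holding words. Every elementary
operation costs one step. -/

/-- Arithmetic instructions. -/
inductive ArithOp where
  | add
  | sub
  | mul
  | div
  | mod

/-- Arithmetic on `w`-bit words: sums and products modulo `2 ^ w`, truncated subtraction, integer
division and remainder. -/
def ArithOp.eval (w : ℕ) : ArithOp → ℕ → ℕ → ℕ
  | .add, x, y => (x + y) % 2 ^ w
  | .sub, x, y => x - y
  | .mul, x, y => (x * y) % 2 ^ w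
  | .div, x, y => x / y
  | .mod, x, y => x % y

/-- Programs. Registers and arrays are named by numerals that are part of the program text. -/
inductive Prog where
  /-- do nothing -/
  | skip
  /-- `reg d := n` -/
  | const (d n : ℕ)
  /-- `reg d := reg x ∘ reg y` -/
  | arith (op : ArithOp) (d x y : ℕ)
  /-- `reg d := arr A [reg i]` -/
  | load (d A i : ℕ)
  /-- `arr A [reg i] := reg x` -/
  | store (A i x : ℕ)
  /-- `reg d :=` a fresh uniformly random element of `{0, …, reg x - 1}` (`0` if `reg x = 0`) -/
  | rand (d x : ℕ)
  /-- sequential composition -/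
  | seq (p q : Prog)
  /-- `if reg x < reg y then p else q` -/
  | ifLt (x y : ℕ) (p q : Prog)
  /-- `while reg x < reg y do p` -/
  | whileLt (x y : ℕ) (p : Prog)

/-- Memory contents. -/
@[ext]
structure State where
  reg : ℕ → ℕ
  arr : ℕ → ℕ → ℕ

def State.setReg (s : State) (d v : ℕ) : State :=
  { s with reg := Function.update s.reg d v }

def State.setArr (s : State) (A i v : ℕ) : State :=
  { s with arr := Function.update s.arr A (Function.update (s.arr A) i v) }

/-- A configuration: the stack of the program parts still to be executed, and the memory. The
computation has halted when the stack is empty. -/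
abbrev Config : Type := List Prog × State

/-- A uniformly random element of `{0, …, n - 1}`, or `0` if `n = 0`. -/
noncomputable def uniformBelow (n : ℕ) : PMF ℕ :=
  if h : 0 < n then PMF.uniformOfFinset (Finset.range n) (Finset.nonempty_range_iff.2 h.ne')
  else PMF.pure 0

/-- One step of the machine with word length `w`. -/
noncomputable def step (w : ℕ) : Config → PMF Config
  | ([], s) => PMF.pure ([], s)
  | (.skip :: K, s) => PMF.pure (K, s)
  | (.const d n :: K, s) => PMF.pure (K, s.setReg d (n % 2 ^ w))
  | (.arith op d x y :: K, s) => PMF.pure (K, s.setReg d (op.eval w (s.reg x) (s.reg y)))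
  | (.load d A i :: K, s) => PMF.pure (K, s.setReg d (s.arr A (s.reg i)))
  | (.store A i x :: K, s) => PMF.pure (K, s.setArr A (s.reg i) (s.reg x))
  | (.rand d x :: K, s) => (uniformBelow (s.reg x)).map fun v => (K, s.setReg d v)
  | (.seq p q :: K, s) => PMF.pure (p :: q :: K, s)
  | (.ifLt x y p q :: K, s) => PMF.pure (if s.reg x < s.reg y then p :: K else q :: K, s)
  | (.whileLt x y p :: K, s) =>
      PMF.pure (if s.reg x < s.reg y then p :: .whileLt x y p :: K else K, s)

/-- The distribution of the configuration after `t` steps. -/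
noncomputable def stepN (w : ℕ) : ℕ → Config → PMF Config
  | 0, c => PMF.pure c
  | t + 1, c => (step w c).bind (stepN w t)

/-- The probability that `p`, started on the memory contents `s`, eventually halts with memory
contents `s'` (the probabilities below are non-decreasing in `t`). -/
noncomputable def haltProb (w : ℕ) (p : Prog) (s s' : State) : ℝ≥0∞ :=
  ⨆ t, stepN w t ([p], s) ([], s')

/-- The expected number `E[T] = ∑ₜ Pr[T > t]` of steps until `p`, started on the memory contents
`s`, halts. -/
noncomputable def expectedTime (w : ℕ) (p : Prog) (s : State) : ℝ≥0∞ :=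
  ∑' t, (stepN w t ([p], s)).toOuterMeasure {c | c.1 ≠ []}

/-! ### Data structures for join sampling -/

/-- `L` lists the tuples of each relation, without repetitions, in an arbitrary order. -/
def IsListing {k m : ℕ} {schema : Fin m → Finset (Fin k)} (Q : Join schema)
    (L : ∀ r : Fin m, List (schema r → ℕ)) : Prop :=
  ∀ r, (L r).Nodup ∧ (L r).toFinset = Q r

/-- The initial memory: register `r` holds the number of tuples of relation `r`; for each
attribute `a` of relation `r`, array `r * k + a` holds at index `j` the value on `a` of the `j`-th
tuple of relation `r`. Everything else is `0`. -/
def initialState {k m : ℕ} {schema : Fin m → Finset (Fin k)}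
    (L : ∀ r : Fin m, List (schema r → ℕ)) : State where
  reg i := if h : i < m then (L ⟨i, h⟩).length else 0
  arr A j :=
    if h : 0 < k ∧ A / k < m then
      if h' : (⟨A % k, Nat.mod_lt A h.1⟩ : Fin k) ∈ schema ⟨A / k, h.2⟩ then
        if h'' : j < (L ⟨A / k, h.2⟩).length then (L ⟨A / k, h.2⟩)[j] ⟨_, h'⟩ else 0
      else 0
    else 0

/-- The answer of a sampling operation: the result is reported to be empty if register `0`
holds `0`; otherwise register `a + 1` holds the value of the returned tuple on attribute `a`. -/
def answer (k : ℕ) (s : State) : Option (Fin k → ℕ) :=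
  if s.reg 0 = 0 then none else some fun a => s.reg (a + 1)

/-- The probability that successive executions of `samp`, the first of them started on the memory
contents `s` and each other one on the memory left by its predecessor, give exactly the answers in
the list. -/
noncomputable def answersProbFrom (k w : ℕ) (samp : Prog) :
    List (Option (Fin k → ℕ)) → State → ℝ≥0∞
  | [], _ => 1
  | o :: os, s =>
      ∑' s', haltProb w samp s s' * if answer k s' = o then answersProbFrom k w samp os s' else 0

/-- The probability that `pre` halts on the memory contents `s₀` and that the executions of `samp`
after it give exactly the answers in the list. -/
noncomputable def answersProb (k w : ℕ) (pre samp : Prog) (s₀ : State)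
    (os : List (Option (Fin k → ℕ))) : ℝ≥0∞ :=
  ∑' s, haltProb w pre s₀ s * answersProbFrom k w samp os s

/-- The distribution of the memory contents after `pre` and `i` executions of `samp`. -/
noncomputable def stateLaw (w : ℕ) (pre samp : Prog) (s₀ : State) : ℕ → State → ℝ≥0∞
  | 0, s => haltProb w pre s₀ s
  | i + 1, s => ∑' s', stateLaw w pre samp s₀ i s' * haltProb w samp s' s

/-- The expected number of steps of execution number `i` (counted from `0`) of `samp` after
`pre`. -/
noncomputable def expectedOpTime (w : ℕ) (pre samp : Prog) (s₀ : State) (i : ℕ) : ℝ≥0∞ :=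
  ∑' s, stateLaw w pre samp s₀ i s * expectedTime w samp s

open Classical in
/-- The required distribution of one answer: uniform on the join result if that is non-empty, and
the report of emptiness otherwise. -/
noncomputable def sampleLaw {k m : ℕ} {schema : Fin m → Finset (Fin k)} (Q : Join schema) :
    Option (Fin k → ℕ) → ℝ≥0∞
  | none => if joinResult Q = ∅ then 1 else 0
  | some u => if u ∈ joinResult Q then (outputSize Q : ℝ≥0∞)⁻¹ else 0

end JoinSampling

open JoinSampling

/-!
# Join sampling under acyclic degree constraints

The sampler is a rejection sampler on codes of tuples. The join tuples are given codes, which are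
numbers below a bound `size ≤ (2 n) ^ k * polymat`, where `n` is the number of constraints (counting
each constraint once for each relation whose schema contains it) and `k` that of attributes. Every
join tuple has exactly one code, and a code can be decoded, or recognized as the code of no tuple,
in constant time. To sample, draw numbers below `size` until a code of a tuple turns up: the result
is uniform, and about `size / OUT` rounds are needed. To stop if the join is empty, each failed
round also examines one more code in increasing order; after `size + 1` rounds without success it is
known whether there is a code of a tuple at all.

*Codes.* The attributes are handled in an order that lists `X` before `Y \ X` for every constraint
`(X, Y)`; it exists because the constraints are acyclic (`Acyclic.exists_compatible`). When the
first `i` entries of a tuple `u` are fixed, the degree of a constraint is the number of `Y`-tuples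
of its relation that are compatible with them, or the maximum degree as long as `X` is not complete.
The potential is the maximum of `2 ^ ∑ h a` over the natural weights `h` with `∑ a ∈ Y \ X, h a ≤
log₂ (degree)` for all constraints. At level `0` such a weight is a modular polymatroid that
respects the degree constraints, so that the potential is at most the polymatroid bound
(`potential_le_polymat`). No duality is needed: if fixing `u i` lowers the rounded logarithms of the
degrees of all constraints on attribute `i` by at least `d`, an optimal weight after that step can
be increased by `d` at attribute `i`, so that the potential drops by a factor of at least `2 ^ d`
(`Inst.potential_mul_le`). Hence, among the constraints on attribute `i`, there is one whose degree
drops by a factor at most twice as large as that of the potential (`Inst.exists_isFirst`). The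
factor `(2 n) ^ (k - i)` in `Inst.weight` pays for the factor `2` and for a choice among `n`
constraints at each level: the codes of level `i` are divided among the constraints, the codes of a
constraint are divided evenly among its compatible `Y`-tuples, and the first constraint that offers
enough codes for the value `u i` provides the codes for level `i + 1` (`Inst.slot_mem`). The
potential at the last level is `1`, so that a tuple has one code (`Inst.weight_k`), and the encoding
is injective and inverted by decoding (`Inst.decode_back`, `Inst.back_decode`).

*Data structure.* For each constraint a trie over the ordered attributes is stored, in which the
leaves below a node are contiguous, so that the tuples compatible with a prefix can be indexed. As
the memory is initially zero, dictionaries and children of nodes are arrays that are addressed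
directly by values and pairs of a node and a value; no hashing is needed, and the preprocessing is
deterministic. The potential depends only on the rounded logarithms of the degrees. All its values
are computed by brute force; their number and the time are polylogarithmic in the input size
(`pow_le_mul_two_pow`).

*Machine.* Programs are written in a small language with named arrays, whose semantics computes with
unbounded numbers, and compiled to the machine. All numbers that occur are polynomial in the input
size (`Inst.bounds`), so that there are no overflows (`Cmd.compile_spec`). A round of the sampler is
a deterministic run, one draw, and another deterministic run (`Inst.round_machine`). The
expectations of the running time and of functions of the answer are estimated by comparing the
supremum, or infimum, over all states before a round with the same quantity one round later
(`le_of_restart`, `ge_of_restart`). The data structure is not changed by sampling, so the answers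
are independent (`Inst.answersProbFrom_samp`).
-/

open scoped ENNReal

namespace JoinSampling

/-! ### Expectations over discrete distributions -/

/-- The expectation of a non-negative function under a discrete distribution. -/
noncomputable def expect {α : Type*} (p : PMF α) (f : α → ℝ≥0∞) : ℝ≥0∞ := ∑' a, p a * f a

theorem expect_pure {α : Type*} (a : α) (f : α → ℝ≥0∞) : expect (PMF.pure a) f = f a := by
  rw [expect, tsum_eq_single a]
  · simp
  · intro b hb
    simp [PMF.pure_apply, hb]

theorem expect_bind {α β : Type*} (p : PMF α) (q : α → PMF β) (f : β → ℝ≥0∞) :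
    expect (p.bind q) f = expect p fun a => expect (q a) f := by
  simp only [expect, PMF.bind_apply, ← ENNReal.tsum_mul_right, ← ENNReal.tsum_mul_left]
  rw [ENNReal.tsum_comm]
  simp only [mul_assoc]

theorem expect_map {α β : Type*} (p : PMF α) (h : α → β) (f : β → ℝ≥0∞) :
    expect (p.map h) f = expect p (f ∘ h) := by
  rw [PMF.map, expect_bind]
  simp only [Function.comp_def, expect_pure]

theorem expect_mono {α : Type*} (p : PMF α) {f g : α → ℝ≥0∞} (h : ∀ a, f a ≤ g a) :
    expect p f ≤ expect p g :=
  ENNReal.tsum_le_tsum fun a => mul_le_mul_right (h a) _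

theorem expect_const {α : Type*} (p : PMF α) (v : ℝ≥0∞) : expect p (fun _ => v) = v := by
  rw [expect, ENNReal.tsum_mul_right, p.tsum_coe, one_mul]

theorem expect_add {α : Type*} (p : PMF α) (f g : α → ℝ≥0∞) :
    expect p (fun a => f a + g a) = expect p f + expect p g := by
  simp only [expect, mul_add, ENNReal.tsum_add]

theorem expect_iSup {α : Type*} (p : PMF α) (f : ℕ → α → ℝ≥0∞) (hf : Monotone f) :
    expect p (fun a => ⨆ t, f t a) = ⨆ t, expect p (f t) := by
  let _ : MeasurableSpace α := ⊤
  simp only [expect, ← MeasureTheory.lintegral_count, ENNReal.mul_iSup]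
  rw [MeasureTheory.lintegral_iSup (fun n => measurable_from_top)]
  intro s t hst a
  exact mul_le_mul_right (hf hst a) _

theorem expect_uniformBelow {n : ℕ} (hn : 0 < n) (f : ℕ → ℝ≥0∞) :
    expect (uniformBelow n) f = (n : ℝ≥0∞)⁻¹ * ∑ x ∈ Finset.range n, f x := by
  rw [expect, tsum_eq_sum (s := Finset.range n), Finset.mul_sum]
  · refine Finset.sum_congr rfl fun x hx => ?_
    rw [uniformBelow, dif_pos hn, PMF.uniformOfFinset_apply, if_pos hx, Finset.card_range]
  · intro x hx
    rw [uniformBelow, dif_pos hn, PMF.uniformOfFinset_apply, if_neg hx, zero_mul]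

/-! ### Halting probabilities and expected running times of configurations -/

theorem stepN_add (w n t : ℕ) (c : Config) :
    stepN w (n + t) c = (stepN w n c).bind (stepN w t) := by
  induction n generalizing c with
  | zero => simp [stepN]
  | succ n ih =>
    rw [Nat.succ_add, stepN, stepN, PMF.bind_bind]
    congr 1
    funext c'
    exact ih c'

theorem stepN_halted (w t : ℕ) (s : State) : stepN w t ([], s) = PMF.pure ([], s) := by
  induction t with
  | zero => rfl
  | succ t ih => rw [stepN, step, PMF.pure_bind, ih]

/-- The value of `g` at the final memory contents of a halted configuration, and `0` at a
configuration that has not halted. -/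
noncomputable def haltValue (g : State → ℝ≥0∞) (c : Config) : ℝ≥0∞ :=
  if c.1 = [] then g c.2 else 0

/-- The expectation of `g` at the final memory contents of a computation started at `c`, where
computations that do not halt contribute `0`. -/
noncomputable def haltExpect (w : ℕ) (g : State → ℝ≥0∞) (c : Config) : ℝ≥0∞ :=
  ⨆ t, expect (stepN w t c) (haltValue g)

theorem haltValue_le_expect (w t : ℕ) (g : State → ℝ≥0∞) (c : Config) :
    haltValue g c ≤ expect (stepN w t c) (haltValue g) := by
  obtain ⟨K, s⟩ := c
  by_cases hK : K = []
  · subst hK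
    rw [stepN_halted, expect_pure]
  · simp [haltValue, hK]

theorem expect_haltValue_mono (w : ℕ) (g : State → ℝ≥0∞) :
    Monotone fun t c => expect (stepN w t c) (haltValue g) := by
  refine monotone_nat_of_le_succ fun t c => ?_
  rw [stepN_add, expect_bind]
  exact expect_mono _ fun c' => haltValue_le_expect w 1 g c'

theorem haltExpect_eq_expect (w n : ℕ) (g : State → ℝ≥0∞) (c : Config) :
    haltExpect w g c = expect (stepN w n c) (haltExpect w g) := by
  unfold haltExpect
  rw [expect_iSup _ _ (expect_haltValue_mono w g)]
  simp only [← expect_bind, ← stepN_add]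
  refine le_antisymm (iSup_le fun t => ?_) (iSup_le fun t => ?_)
  · exact le_iSup_of_le t (expect_haltValue_mono w g (Nat.le_add_left t n) c)
  · exact le_iSup_of_le (n + t) le_rfl

theorem haltExpect_halted (w : ℕ) (g : State → ℝ≥0∞) (s : State) :
    haltExpect w g ([], s) = g s := by
  simp [haltExpect, stepN_halted, expect_pure, haltValue]

open Classical in
theorem haltExpect_eq_tsum (w : ℕ) (g : State → ℝ≥0∞) (p : Prog) (s : State) :
    haltExpect w g ([p], s) = ∑' s', haltProb w p s s' * g s' := by
  have key (q : PMF Config) (f : State → ℝ≥0∞) :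
      expect q (haltValue f) = ∑' s', q ([], s') * f s' := by
    rw [expect, ENNReal.tsum_prod (f := fun K s' => q (K, s') * haltValue f (K, s')),
      tsum_eq_single ([] : List Prog)]
    · simp [haltValue]
    · intro K hK
      simp [haltValue, hK]
  have hmono : Monotone fun t s' => stepN w t ([p], s) ([], s') * g s' := by
    intro t t' htt' s'
    refine mul_le_mul_left ?_ _
    have h := expect_haltValue_mono w (fun x => if x = s' then 1 else 0) htt' ([p], s)
    simpa [key] using h
  let _ : MeasurableSpace State := ⊤
  simp only [haltExpect, haltProb, key, ENNReal.iSup_mul, ← MeasureTheory.lintegral_count]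
  rw [MeasureTheory.lintegral_iSup (fun n => measurable_from_top) hmono]

theorem haltExpect_le (w : ℕ) {g : State → ℝ≥0∞} {v : ℝ≥0∞} (h : ∀ s, g s ≤ v) (c : Config) :
    haltExpect w g c ≤ v := by
  refine iSup_le fun t => (expect_mono _ fun c' => ?_).trans (expect_const _ v).le
  unfold haltValue
  split_ifs
  exacts [h _, zero_le]

/-- The expected number of steps of a computation started at `c` that are among its first `N`
steps. Unlike the expected running time it is finite for trivial reasons. -/
noncomputable def truncTime (w N : ℕ) (c : Config) : ℝ≥0∞ :=
  ∑ t ∈ Finset.range N, expect (stepN w t c) fun c' => if c'.1 = [] then 0 else 1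

theorem expect_running_le (p : PMF Config) :
    expect p (fun c' => if c'.1 = [] then (0 : ℝ≥0∞) else 1) ≤ 1 :=
  (expect_mono p (g := fun _ => 1) fun c' => by split_ifs <;> simp).trans (expect_const p 1).le

theorem truncTime_le_nat (w N : ℕ) (c : Config) : truncTime w N c ≤ N := by
  refine (Finset.sum_le_card_nsmul _ _ 1 fun t _ => expect_running_le _).trans ?_
  simp

theorem truncTime_halted (w N : ℕ) (s : State) : truncTime w N ([], s) = 0 := by
  simp [truncTime, stepN_halted, expect_pure]

theorem truncTime_le (w N n : ℕ) (c : Config) :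
    truncTime w N c ≤ n + expect (stepN w n c) (truncTime w N) := by
  have h1 : expect (stepN w n c) (truncTime w N) = ∑ t ∈ Finset.range N,
      expect (stepN w (n + t) c) fun c' => if c'.1 = [] then 0 else 1 := by
    unfold truncTime
    simp only [stepN_add, expect_bind]
    induction N with
    | zero => simp [expect]
    | succ N ih => simp only [Finset.sum_range_succ, expect_add, ih]
  rw [h1, truncTime]
  have h2 : Finset.range N ⊆ Finset.range (n + N) := by
    intro x; simp only [Finset.mem_range]; omega
  refine (Finset.sum_le_sum_of_subset h2).trans ?_
  rw [Finset.sum_range_add]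
  refine add_le_add_left ?_ _
  refine (Finset.sum_le_card_nsmul _ _ 1 fun t _ => expect_running_le _).trans ?_
  simp

theorem expectedTime_eq_iSup (w : ℕ) (p : Prog) (s : State) :
    expectedTime w p s = ⨆ N, truncTime w N ([p], s) := by
  have h (q : PMF Config) : q.toOuterMeasure {c | c.1 ≠ []} =
      expect q fun c' => if c'.1 = [] then 0 else 1 := by
    rw [PMF.toOuterMeasure_apply, expect]
    refine tsum_congr fun c => ?_
    by_cases hc : c.1 = [] <;> simp [hc]
  rw [expectedTime, ENNReal.tsum_eq_iSup_nat]
  simp only [h, truncTime]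

/-! ### Deterministic computations -/

/-- The computation from `c` reaches `c'` after `n` steps with certainty. -/
def Det (w : ℕ) (c : Config) (n : ℕ) (c' : Config) : Prop := stepN w n c = PMF.pure c'

theorem Det.refl (w : ℕ) (c : Config) : Det w c 0 c := rfl

theorem Det.trans {w : ℕ} {c c' c'' : Config} {n n' : ℕ} (h : Det w c n c')
    (h' : Det w c' n' c'') : Det w c (n + n') c'' := by
  rw [Det, stepN_add, h, PMF.pure_bind, h']

theorem Det.one {w : ℕ} {c c' : Config} (h : step w c = PMF.pure c') : Det w c 1 c' := by
  rw [Det, stepN, h, PMF.pure_bind, stepN]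

theorem Det.haltExpect {w : ℕ} {c c' : Config} {n : ℕ} (h : Det w c n c') (g : State → ℝ≥0∞) :
    haltExpect w g c = haltExpect w g c' := by
  rw [haltExpect_eq_expect w n, h, expect_pure]

theorem Det.truncTime {w : ℕ} {c c' : Config} {n : ℕ} (h : Det w c n c') (N : ℕ) :
    truncTime w N c ≤ n + truncTime w N c' := by
  refine (truncTime_le w N n c).trans ?_
  rw [h, expect_pure]

theorem haltExpect_rand {w : ℕ} {d x : ℕ} {K : List Prog} {s : State} (hx : 0 < s.reg x)
    (g : State → ℝ≥0∞) :
    haltExpect w g (.rand d x :: K, s) =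
      (s.reg x : ℝ≥0∞)⁻¹ * ∑ v ∈ Finset.range (s.reg x), haltExpect w g (K, s.setReg d v) := by
  rw [haltExpect_eq_expect w 1, stepN, expect_bind, step, expect_map]
  rw [expect_uniformBelow hx]
  simp [stepN, expect_pure]

theorem truncTime_rand {w : ℕ} {d x : ℕ} {K : List Prog} {s : State} (hx : 0 < s.reg x) (N : ℕ) :
    truncTime w N (.rand d x :: K, s) ≤ 1 +
      (s.reg x : ℝ≥0∞)⁻¹ * ∑ v ∈ Finset.range (s.reg x), truncTime w N (K, s.setReg d v) := by
  refine (truncTime_le w N 1 _).trans ?_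
  rw [stepN, expect_bind, step, expect_map, expect_uniformBelow hx]
  simp [stepN, expect_pure]

/-! ### A structured language over named arrays -/

/-- The arrays used by the programs. A variable is the cell with index `0` of an array; registers
hold intermediate results only. -/
inductive Name where
  /-- input array `A` -/
  | inp (A : ℕ)
  /-- the size of relation `r` -/
  | siz (r : ℕ)
  /-- the input size -/
  | tot
  /-- the counter of the current loop -/
  | ctr
  /-- binary logarithms of the numbers up to the input size -/
  | log
  /-- a strict upper bound for the logarithms -/
  | lim
  /-- powers of two -/
  | pow
  /-- the table of the potential -/
  | tab
  /-- the dictionary of the values in column `i` of table `c` -/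
  | val (c i : ℕ)
  /-- the dictionary of the children of the level `i` nodes of trie `c` -/
  | child (c i : ℕ)
  /-- the level `i` nodes above the rows of table `c` -/
  | path (c i : ℕ)
  /-- the numbers of leaves below the level `i` nodes of trie `c` -/
  | cnt (c i : ℕ)
  /-- the numbers of leaves below those children of the level `i` nodes of trie `c` that have
  been placed -/
  | used (c i : ℕ)
  /-- the positions of the first leaves below the level `i` nodes of trie `c` -/
  | base (c i : ℕ)
  /-- the rows at the leaves of trie `c` -/
  | leaf (c : ℕ)
  /-- the degree of table `c` -/
  | maxdeg (c : ℕ)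
  /-- the number of codes -/
  | codes
  /-- the code to be decoded below level `i` -/
  | rem (i : ℕ)
  /-- the level `i` nodes of the tuple being decoded -/
  | node (i : ℕ)
  /-- the degrees of the tuple being decoded at level `i` -/
  | deg (i : ℕ)
  /-- the potential of the tuple being decoded at level `i` -/
  | pot (i : ℕ)
  /-- for each constraint, the value of attribute `i` that it proposes -/
  | cand (i : ℕ)
  /-- attribute `i` of the decoded tuple -/
  | out (i : ℕ)
  /-- for each constraint, the code that it leaves for the levels below `i` -/
  | off (i : ℕ)
  /-- for each constraint, whether it bounds the drop of the potential at level `i` -/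
  | test (i : ℕ)
  /-- whether the levels above `i` have been decoded successfully -/
  | ok (i : ℕ)
  /-- whether the sampler has to go on -/
  | go
  /-- the number of failed rounds of the sampler -/
  | rnd
  /-- whether the join is known to be non-empty -/
  | flag
  /-- whether the sampler has found a tuple -/
  | res
  deriving DecidableEq

/-- Whether the array holds values of the input, which can be arbitrary words. -/
def Name.IsVal : Name → Bool
  | inp _ => true
  | cand _ => true
  | out _ => true
  | _ => false

/-- A numbering of the names by triples. -/
def Name.triple : Name → ℕ × ℕ × ℕ
  | .inp A => (0, A, 0)
  | .siz r => (1, r, 0)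
  | .tot => (2, 0, 0)
  | .ctr => (3, 0, 0)
  | .log => (4, 0, 0)
  | .lim => (5, 0, 0)
  | .pow => (6, 0, 0)
  | .tab => (7, 0, 0)
  | .val c i => (8, c, i)
  | .child c i => (9, c, i)
  | .path c i => (10, c, i)
  | .cnt c i => (11, c, i)
  | .used c i => (12, c, i)
  | .base c i => (13, c, i)
  | .leaf c => (14, c, 0)
  | .maxdeg c => (15, c, 0)
  | .codes => (16, 0, 0)
  | .rem i => (17, i, 0)
  | .node i => (18, i, 0)
  | .deg i => (19, i, 0)
  | .pot i => (20, i, 0)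
  | .cand i => (21, i, 0)
  | .out i => (22, i, 0)
  | .off i => (23, i, 0)
  | .test i => (24, i, 0)
  | .ok i => (25, i, 0)
  | .go => (26, 0, 0)
  | .rnd => (27, 0, 0)
  | .flag => (28, 0, 0)
  | .res => (29, 0, 0)

/-- The name with a given triple. -/
def Name.ofTriple : ℕ × ℕ × ℕ → Name
  | (0, A, _) => .inp A
  | (1, r, _) => .siz r
  | (2, _, _) => .tot
  | (3, _, _) => .ctr
  | (4, _, _) => .log
  | (5, _, _) => .lim
  | (6, _, _) => .pow
  | (7, _, _) => .tab
  | (8, c, i) => .val c i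
  | (9, c, i) => .child c i
  | (10, c, i) => .path c i
  | (11, c, i) => .cnt c i
  | (12, c, i) => .used c i
  | (13, c, i) => .base c i
  | (14, c, _) => .leaf c
  | (15, c, _) => .maxdeg c
  | (16, _, _) => .codes
  | (17, i, _) => .rem i
  | (18, i, _) => .node i
  | (19, i, _) => .deg i
  | (20, i, _) => .pot i
  | (21, i, _) => .cand i
  | (22, i, _) => .out i
  | (23, i, _) => .off i
  | (24, i, _) => .test i
  | (25, i, _) => .ok i
  | (26, _, _) => .go
  | (27, _, _) => .rnd
  | (28, _, _) => .flag
  | (_, _, _) => .res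

theorem Name.ofTriple_triple (A : Name) : Name.ofTriple A.triple = A := by
  cases A <;> rfl

/-- A numbering of the names. -/
def Name.number (A : Name) : ℕ := Encodable.encode A.triple

theorem Name.number_injective : Function.Injective Name.number :=
  Encodable.encode_injective.comp (Function.LeftInverse.injective Name.ofTriple_triple)

/-- The number of an array in the machine; the numbers below `K` are those of the input arrays. -/
def Name.code (K : ℕ) (A : Name) : ℕ :=
  if A.triple.1 = 0 ∧ A.triple.2.1 < K then A.triple.2.1 else K + A.number

theorem Name.code_inp {K A : ℕ} (h : A < K) : (Name.inp A).code K = A := if_pos ⟨rfl, h⟩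

theorem Name.code_injective (K : ℕ) : Function.Injective (Name.code K) := by
  have h (A : Name) : A.code K = K + A.number ∨ ∃ j < K, A = .inp j ∧ A.code K = j := by
    by_cases hA : A.triple.1 = 0 ∧ A.triple.2.1 < K
    · refine .inr ⟨A.triple.2.1, hA.2, ?_, if_pos hA⟩
      cases A <;> simp_all [Name.triple]
    · exact .inl (if_neg hA)
  intro A A' hAA'
  rcases h A with h1 | ⟨j, hj, rfl, h1⟩ <;> rcases h A' with h2 | ⟨j', hj', rfl, h2⟩
  · exact Name.number_injective (by omega)
  · omega
  · omega
  · rw [h1, h2] at hAA'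
    rw [hAA']

/-- Memory contents of named arrays. -/
abbrev Mem : Type := Name → ℕ → ℕ

/-- Replace one entry of an array. -/
def Mem.set (M : Mem) (A : Name) (i v : ℕ) : Mem :=
  Function.update M A (Function.update (M A) i v)

theorem Mem.set_apply (M : Mem) (A B : Name) (i j v : ℕ) :
    M.set A i v B j = if B = A ∧ j = i then v else M B j := by
  unfold Mem.set
  by_cases h : B = A
  · subst h; by_cases h' : j = i <;> simp [h']
  · simp [h]

theorem Mem.set_of_ne (M : Mem) {A B : Name} (i v : ℕ) (h : B ≠ A) : M.set A i v B = M B := by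
  simp [Mem.set, h]

/-- Expressions over memory entries. -/
inductive Expr where
  | const (n : ℕ)
  | load (A : Name) (e : Expr)
  | op (o : ArithOp) (e f : Expr)

namespace Expr

instance : Add Expr := ⟨op .add⟩
instance : Sub Expr := ⟨op .sub⟩
instance : Mul Expr := ⟨op .mul⟩
instance : Div Expr := ⟨op .div⟩
instance : Mod Expr := ⟨op .mod⟩

/-- The variable stored in cell `0` of array `A`. -/
def var (A : Name) : Expr := load A (const 0)

/-- `1` if `e < f`, and `0` otherwise. -/
def lt (e f : Expr) : Expr := const 1 - (const 1 - (f - e))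

/-- `1` if `e ≤ f`, and `0` otherwise. -/
def le (e f : Expr) : Expr := const 1 - (e - f)

/-- `1` if `e = f`, and `0` otherwise. -/
def eq (e f : Expr) : Expr := le e f * le f e

/-- Sum of the expressions `f i` for `i < n`. -/
def sum (n : ℕ) (f : ℕ → Expr) : Expr := Nat.rec (const 0) (fun i e => e + f i) n

/-- Product of the expressions `f i` for `i < n`. -/
def prod (n : ℕ) (f : ℕ → Expr) : Expr := Nat.rec (const 1) (fun i e => e * f i) n

end Expr

/-- Arithmetic on unbounded natural numbers. -/
def ArithOp.ideal : ArithOp → ℕ → ℕ → ℕ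
  | .add, x, y => x + y
  | .sub, x, y => x - y
  | .mul, x, y => x * y
  | .div, x, y => x / y
  | .mod, x, y => x % y

namespace Expr

/-- The value of an expression, computed with unbounded natural numbers. -/
def eval (M : Mem) : Expr → ℕ
  | const n => n
  | load A e => M A (e.eval M)
  | op o e f => o.ideal (e.eval M) (f.eval M)

/-- The value of an expression, computed with `w`-bit words. -/
def wordEval (w : ℕ) (M : Mem) : Expr → ℕ
  | const n => n % 2 ^ w
  | load A e => M A (e.wordEval w M)
  | op o e f => o.eval w (e.wordEval w M) (f.wordEval w M)

/-- The number of machine steps of the evaluation. -/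
def cost : Expr → ℕ
  | const _ => 1
  | load _ e => e.cost + 2
  | op _ e f => e.cost + f.cost + 3

/-- An exponent `d` such that all numbers in the evaluation are at most `B ^ d` if all entries
of arrays that do not hold input values are at most `B`. -/
def degree : Expr → ℕ
  | const n => n + 1
  | load _ e => e.degree + 1
  | op _ e f => e.degree + f.degree + 1

/-- Whether the expression reads an input value. -/
def IsValLoad : Expr → Prop
  | load A _ => A.IsVal = true
  | _ => False

/-- No arithmetic is performed on input values, which can be used as addresses only. -/
def Wf : Expr → Prop
  | const _ => True
  | load _ e => e.Wf
  | op _ e f => (e.Wf ∧ ¬ e.IsValLoad) ∧ f.Wf ∧ ¬ f.IsValLoad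

section simp_lemmas

variable (M : Mem) (e f : Expr) (A : Name) (n : ℕ) (F : ℕ → Expr)

@[simp] theorem eval_const : (const n).eval M = n := rfl
@[simp] theorem eval_load : (load A e).eval M = M A (e.eval M) := rfl
@[simp] theorem eval_add : (e + f).eval M = e.eval M + f.eval M := rfl
@[simp] theorem eval_sub : (e - f).eval M = e.eval M - f.eval M := rfl
@[simp] theorem eval_mul : (e * f).eval M = e.eval M * f.eval M := rfl
@[simp] theorem eval_div : (e / f).eval M = e.eval M / f.eval M := rfl
@[simp] theorem eval_mod : (e % f).eval M = e.eval M % f.eval M := rfl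
@[simp] theorem eval_var : (var A).eval M = M A 0 := rfl

@[simp] theorem eval_lt : (lt e f).eval M = if e.eval M < f.eval M then 1 else 0 := by
  simp only [lt, eval_sub, eval_const]
  split_ifs <;> omega

@[simp] theorem eval_le : (le e f).eval M = if e.eval M ≤ f.eval M then 1 else 0 := by
  simp only [le, eval_sub, eval_const]
  split_ifs <;> omega

@[simp] theorem eval_eq : (eq e f).eval M = if e.eval M = f.eval M then 1 else 0 := by
  simp only [eq, eval_mul, eval_le]
  split_ifs <;> omega

@[simp] theorem eval_sum : (sum n F).eval M = ∑ i ∈ Finset.range n, (F i).eval M := by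
  induction n with
  | zero => rfl
  | succ n ih => rw [Finset.sum_range_succ, ← ih]; rfl

@[simp] theorem eval_prod : (prod n F).eval M = ∏ i ∈ Finset.range n, (F i).eval M := by
  induction n with
  | zero => rfl
  | succ n ih => rw [Finset.prod_range_succ, ← ih]; rfl

@[simp] theorem wf_const : (const n).Wf := trivial
@[simp] theorem wf_load : (load A e).Wf ↔ e.Wf := Iff.rfl
@[simp] theorem wf_var : (var A).Wf := trivial
@[simp] theorem wf_add : (e + f).Wf ↔ (e.Wf ∧ ¬ e.IsValLoad) ∧ f.Wf ∧ ¬ f.IsValLoad := Iff.rfl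
@[simp] theorem wf_sub : (e - f).Wf ↔ (e.Wf ∧ ¬ e.IsValLoad) ∧ f.Wf ∧ ¬ f.IsValLoad := Iff.rfl
@[simp] theorem wf_mul : (e * f).Wf ↔ (e.Wf ∧ ¬ e.IsValLoad) ∧ f.Wf ∧ ¬ f.IsValLoad := Iff.rfl
@[simp] theorem wf_div : (e / f).Wf ↔ (e.Wf ∧ ¬ e.IsValLoad) ∧ f.Wf ∧ ¬ f.IsValLoad := Iff.rfl
@[simp] theorem wf_mod : (e % f).Wf ↔ (e.Wf ∧ ¬ e.IsValLoad) ∧ f.Wf ∧ ¬ f.IsValLoad := Iff.rfl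
@[simp] theorem isValLoad_const : ¬ (const n).IsValLoad := id
@[simp] theorem isValLoad_add : ¬ (e + f).IsValLoad := id
@[simp] theorem isValLoad_sub : ¬ (e - f).IsValLoad := id
@[simp] theorem isValLoad_mul : ¬ (e * f).IsValLoad := id
@[simp] theorem isValLoad_div : ¬ (e / f).IsValLoad := id
@[simp] theorem isValLoad_mod : ¬ (e % f).IsValLoad := id
@[simp] theorem isValLoad_load : (load A e).IsValLoad ↔ A.IsVal = true := Iff.rfl
@[simp] theorem isValLoad_var : (var A).IsValLoad ↔ A.IsVal = true := Iff.rfl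
@[simp] theorem isValLoad_lt : ¬ (lt e f).IsValLoad := id
@[simp] theorem isValLoad_le : ¬ (le e f).IsValLoad := id
@[simp] theorem isValLoad_eq : ¬ (eq e f).IsValLoad := id

@[simp] theorem wf_lt : (lt e f).Wf ↔ (e.Wf ∧ ¬ e.IsValLoad) ∧ f.Wf ∧ ¬ f.IsValLoad := by
  simp [lt, and_comm]

@[simp] theorem wf_le : (le e f).Wf ↔ (e.Wf ∧ ¬ e.IsValLoad) ∧ f.Wf ∧ ¬ f.IsValLoad := by
  simp [le]

@[simp] theorem wf_eq : (eq e f).Wf ↔ (e.Wf ∧ ¬ e.IsValLoad) ∧ f.Wf ∧ ¬ f.IsValLoad := by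
  simp only [eq, wf_mul, wf_le, isValLoad_le, not_false_eq_true, and_true]
  tauto

@[simp] theorem isValLoad_sum : ¬ (sum n F).IsValLoad := by cases n <;> exact id
@[simp] theorem isValLoad_prod : ¬ (prod n F).IsValLoad := by cases n <;> exact id

theorem wf_sum (h : ∀ i < n, (F i).Wf ∧ ¬ (F i).IsValLoad) : (sum n F).Wf := by
  induction n with
  | zero => trivial
  | succ n ih =>
    exact ⟨⟨ih fun i hi => h i (by omega), isValLoad_sum n F⟩, h n (by omega)⟩

theorem wf_prod (h : ∀ i < n, (F i).Wf ∧ ¬ (F i).IsValLoad) : (prod n F).Wf := by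
  induction n with
  | zero => trivial
  | succ n ih =>
    exact ⟨⟨ih fun i hi => h i (by omega), isValLoad_prod n F⟩, h n (by omega)⟩

end simp_lemmas

end Expr

/-- All entries of arrays that do not hold input values are at most `B`. -/
def Mem.Small (M : Mem) (B : ℕ) : Prop := ∀ A, A.IsVal = false → ∀ i, M A i ≤ B

theorem Mem.Small.set {M : Mem} {B : ℕ} (h : M.Small B) {A : Name} {i v : ℕ}
    (hv : A.IsVal = true ∨ v ≤ B) : (M.set A i v).Small B := by
  intro A' hA' j
  rw [Mem.set_apply]
  split_ifs with h'
  · obtain ⟨rfl, -⟩ := h'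
    rcases hv with hv | hv
    · simp [hv] at hA'
    · exact hv
  · exact h A' hA' j

/-- If the words are long enough, the evaluation of an expression does not overflow. -/
theorem Expr.wordEval_eq {w B : ℕ} {M : Mem} (hM : M.Small B) (hB : 2 ≤ B) (e : Expr)
    (he : e.Wf) (hd : B ^ e.degree < 2 ^ w) :
    e.wordEval w M = e.eval M ∧ (¬ e.IsValLoad → e.eval M ≤ B ^ e.degree) := by
  have hpos : 0 < B := by omega
  have hmono {x y : ℕ} (h : x ≤ y) : B ^ x ≤ B ^ y := Nat.pow_le_pow_right hpos h
  induction e with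
  | const n =>
    have h1 : n < B ^ (n + 1) :=
      (Nat.lt_pow_self (by omega)).trans_le (hmono (Nat.le_succ n))
    exact ⟨Nat.mod_eq_of_lt (h1.trans hd), fun _ => h1.le⟩
  | load A e ih =>
    obtain ⟨h1, -⟩ := ih he ((hmono (Nat.le_succ _)).trans_lt hd)
    refine ⟨by simp [wordEval, eval, h1], fun h => ?_⟩
    refine (hM A (by simpa using h) _).trans ?_
    exact Nat.le_self_pow (Nat.succ_ne_zero _) B
  | op o e f ihe ihf =>
    have hde : B ^ e.degree ≤ B ^ (op o e f).degree := hmono (by simp only [degree]; omega)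
    have hdf : B ^ f.degree ≤ B ^ (op o e f).degree := hmono (by simp only [degree]; omega)
    obtain ⟨he1, he2⟩ := ihe he.1.1 (hde.trans_lt hd)
    obtain ⟨hf1, hf2⟩ := ihf he.2.1 (hdf.trans_lt hd)
    replace he2 := he2 he.1.2
    replace hf2 := hf2 he.2.2
    have hadd : e.eval M + f.eval M ≤ B ^ (op o e f).degree := by
      have h1 : B ^ e.degree ≤ B ^ (e.degree + f.degree) := hmono (by omega)
      have h2 : B ^ f.degree ≤ B ^ (e.degree + f.degree) := hmono (by omega)
      calc _ ≤ B ^ (e.degree + f.degree) * 2 := by omega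
        _ ≤ B ^ (e.degree + f.degree) * B := Nat.mul_le_mul_left _ hB
    have hmul : e.eval M * f.eval M ≤ B ^ (op o e f).degree := by
      calc _ ≤ B ^ e.degree * B ^ f.degree := Nat.mul_le_mul he2 hf2
        _ = B ^ (e.degree + f.degree) := (pow_add _ _ _).symm
        _ ≤ _ := hmono (Nat.le_succ _)
    have hid : o.ideal (e.eval M) (f.eval M) ≤ B ^ (op o e f).degree := by
      cases o
      · exact hadd
      · exact (Nat.sub_le _ _).trans (he2.trans hde)
      · exact hmul
      · exact (Nat.div_le_self _ _).trans (he2.trans hde)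
      · exact (Nat.mod_le _ _).trans (he2.trans hde)
    refine ⟨?_, fun _ => hid⟩
    simp only [wordEval, eval, he1, hf1]
    cases o
    · exact Nat.mod_eq_of_lt (hid.trans_lt hd)
    · rfl
    · exact Nat.mod_eq_of_lt (hid.trans_lt hd)
    · rfl
    · rfl

/-- Code that computes the value of an expression in register `d`, using no register below `d`. -/
def Expr.compile (K : ℕ) : Expr → ℕ → Prog
  | const n, d => .const d n
  | load A e, d => .seq (e.compile K d) (.load d (A.code K) d)
  | op o e f, d => .seq (e.compile K d) (.seq (f.compile K (d + 1)) (.arith o d d (d + 1)))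

/-- The machine memory holds the named arrays `M`. -/
def State.Holds (K : ℕ) (s : State) (M : Mem) : Prop := ∀ A : Name, s.arr (A.code K) = M A

theorem Det.seq (w : ℕ) (p q : Prog) (K : List Prog) (s : State) :
    Det w (.seq p q :: K, s) 1 (p :: q :: K, s) := Det.one rfl

/-- The machine evaluates an expression deterministically, uses no register below `d`, and leaves
the arrays as they are. -/
theorem Expr.compile_spec {w K : ℕ} {M : Mem} (e : Expr) (d : ℕ) (s : State) (hs : s.Holds K M)
    (R : List Prog) : ∃ s' : State, Det w (e.compile K d :: R, s) e.cost (R, s') ∧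
      s'.arr = s.arr ∧ s'.reg d = e.wordEval w M ∧ ∀ r < d, s'.reg r = s.reg r := by
  induction e generalizing d s R with
  | const n =>
    refine ⟨s.setReg d (n % 2 ^ w), Det.one rfl, rfl, by simp [State.setReg, wordEval], ?_⟩
    intro r hr
    simp [State.setReg, hr.ne]
  | load A e ih =>
    obtain ⟨s1, h1, ha1, hv1, hr1⟩ := ih d s hs (.load d (A.code K) d :: R)
    refine ⟨s1.setReg d (s1.arr (A.code K) (s1.reg d)), ?_, ha1, ?_, ?_⟩
    · have := ((Det.seq w _ _ R s).trans h1).trans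
        (Det.one (w := w) (c := (.load d (A.code K) d :: R, s1)) rfl)
      rw [show (load A e).cost = 1 + e.cost + 1 by simp only [cost]; omega]
      exact this
    · simp only [State.setReg, Function.update_self, wordEval, hv1, ha1, hs A]
    · intro r hr
      simp only [State.setReg, Function.update_of_ne hr.ne, hr1 r hr]
  | op o e f ihe ihf =>
    obtain ⟨s1, h1, ha1, hv1, hr1⟩ := ihe d s hs
      (.seq (f.compile K (d + 1)) (.arith o d d (d + 1)) :: R)
    have hs1 : s1.Holds K M := fun A => by rw [ha1]; exact hs A
    obtain ⟨s2, h2, ha2, hv2, hr2⟩ := ihf (d + 1) s1 hs1 (.arith o d d (d + 1) :: R)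
    refine ⟨s2.setReg d (o.eval w (s2.reg d) (s2.reg (d + 1))), ?_, ha2.trans ha1, ?_, ?_⟩
    · have := ((((Det.seq w _ _ R s).trans h1).trans (Det.seq w _ _ R s1)).trans h2).trans
        (Det.one (w := w) (c := (.arith o d d (d + 1) :: R, s2)) rfl)
      rw [show (op o e f).cost = 1 + e.cost + 1 + f.cost + 1 by simp only [cost]; omega]
      exact this
    · simp only [State.setReg, Function.update_self, wordEval, hv2, hr2 d (by omega), hv1]
    · intro r hr
      simp only [State.setReg, Function.update_of_ne hr.ne, hr2 r (by omega), hr1 r hr]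

/-! ### Deterministic programs -/

/-- Programs without loops. -/
inductive Stmt where
  | skip
  /-- `A[i] := e` -/
  | asg (A : Name) (i e : Expr)
  | seq (p q : Stmt)
  /-- `if a < b then p else q` -/
  | ite (a b : Expr) (p q : Stmt)

namespace Stmt

/-- Assignment to a variable. -/
def setVar (A : Name) (e : Expr) : Stmt := asg A (.const 0) e

/-- The statements `f i` for `i < n`, one after the other. -/
def each (n : ℕ) (f : ℕ → Stmt) : Stmt := Nat.rec skip (fun i p => p.seq (f i)) n

/-- The effect of a statement on the memory. -/
def run : Stmt → Mem → Mem
  | skip, M => M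
  | asg A i e, M => M.set A (i.eval M) (e.eval M)
  | seq p q, M => q.run (p.run M)
  | ite a b p q, M => if a.eval M < b.eval M then p.run M else q.run M

/-- Every number that is stored in an array that does not hold input values is at most `B`. -/
def Keeps (B : ℕ) : Stmt → Mem → Prop
  | skip, _ => True
  | asg A _ e, M => A.IsVal = true ∨ e.eval M ≤ B
  | seq p q, M => p.Keeps B M ∧ q.Keeps B (p.run M)
  | ite a b p q, M => if a.eval M < b.eval M then p.Keeps B M else q.Keeps B M

/-- An upper bound for the number of machine steps. -/
def cost : Stmt → ℕ
  | skip => 1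
  | asg _ i e => i.cost + e.cost + 3
  | seq p q => p.cost + q.cost + 1
  | ite a b p q => a.cost + b.cost + 3 + p.cost + q.cost

/-- An upper bound for the degrees of the expressions. -/
def degree : Stmt → ℕ
  | skip => 1
  | asg _ i e => i.degree + e.degree
  | seq p q => p.degree + q.degree
  | ite a b p q => a.degree + b.degree + p.degree + q.degree

/-- Input values are used as addresses, or stored in arrays that hold input values. -/
def Wf : Stmt → Prop
  | skip => True
  | asg A i e => i.Wf ∧ e.Wf ∧ (e.IsValLoad → A.IsVal = true)
  | seq p q => p.Wf ∧ q.Wf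
  | ite a b p q => a.Wf ∧ b.Wf ∧ p.Wf ∧ q.Wf

/-- Machine code that uses the registers from `2` on. -/
def compile (K : ℕ) : Stmt → Prog
  | skip => .skip
  | asg A i e => .seq (i.compile K 2) (.seq (e.compile K 3) (.store (A.code K) 2 3))
  | seq p q => .seq (p.compile K) (q.compile K)
  | ite a b p q =>
      .seq (a.compile K 2) (.seq (b.compile K 3) (.ifLt 2 3 (p.compile K) (q.compile K)))

theorem keeps_each {B n : ℕ} {f : ℕ → Stmt} {M : Mem} :
    (each (n + 1) f).Keeps B M ↔ (each n f).Keeps B M ∧ (f n).Keeps B ((each n f).run M) := Iff.rfl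

theorem run_each_succ (n : ℕ) (f : ℕ → Stmt) (M : Mem) :
    (each (n + 1) f).run M = (f n).run ((each n f).run M) := rfl

theorem wf_each {n : ℕ} {f : ℕ → Stmt} (h : ∀ i < n, (f i).Wf) : (each n f).Wf := by
  induction n with
  | zero => trivial
  | succ n ih => exact ⟨ih fun i hi => h i (by omega), h n (by omega)⟩

end Stmt

theorem State.Holds.setArr {K : ℕ} {s : State} {M : Mem} (h : s.Holds K M) (A : Name) (i v : ℕ) :
    (s.setArr (A.code K) i v).Holds K (M.set A i v) := by
  intro A'
  unfold State.setArr Mem.set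
  by_cases hA : A' = A
  · subst hA; simp [h A']
  · have : A'.code K ≠ A.code K := fun h' => hA (Name.code_injective K h')
    simp [hA, this, h A']

theorem State.Holds.congr {K : ℕ} {s s' : State} {M : Mem} (h : s.Holds K M)
    (hs : s'.arr = s.arr) : s'.Holds K M := fun A => by rw [hs, h A]

/-- If the words are long enough for the numbers in a run of a program without loops, the machine
carries out the ideal run. -/
theorem Stmt.compile_spec {w B K : ℕ} (hB : 2 ≤ B) (p : Stmt) (M : Mem) (hM : M.Small B)
    (hk : p.Keeps B M) (hw : p.Wf) (hd : B ^ p.degree < 2 ^ w) (s : State) (hs : s.Holds K M)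
    (R : List Prog) :
    ∃ n ≤ p.cost, ∃ s' : State, Det w (p.compile K :: R, s) n (R, s') ∧
      s'.Holds K (p.run M) ∧ (p.run M).Small B ∧ ∀ r < 2, s'.reg r = s.reg r := by
  have hmono {x y : ℕ} (h : x ≤ y) : B ^ x ≤ B ^ y := Nat.pow_le_pow_right (by omega) h
  induction p generalizing M s R with
  | skip => exact ⟨1, le_rfl, s, Det.one rfl, hs, hM, fun r _ => rfl⟩
  | asg A i e =>
    obtain ⟨hwi, hwe, -⟩ := hw
    simp only [degree] at hd
    have hi := (i.wordEval_eq hM hB hwi ((hmono (by omega)).trans_lt hd)).1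
    have he := (e.wordEval_eq hM hB hwe ((hmono (by omega)).trans_lt hd)).1
    obtain ⟨s1, h1, ha1, hv1, hr1⟩ := i.compile_spec (w := w) 2 s hs
      (.seq (e.compile K 3) (.store (A.code K) 2 3) :: R)
    obtain ⟨s2, h2, ha2, hv2, hr2⟩ := e.compile_spec (w := w) 3 s1 (hs.congr ha1)
      (.store (A.code K) 2 3 :: R)
    have hdet := ((((Det.seq w _ _ R s).trans h1).trans (Det.seq w _ _ R s1)).trans h2).trans
      (Det.one (w := w) (c := (.store (A.code K) 2 3 :: R, s2)) rfl)
    refine ⟨_, ?_, _, hdet, ?_, hM.set hk, ?_⟩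
    · simp only [cost]; omega
    · rw [hr2 2 (by omega), hv1, hv2, hi, he]
      exact State.Holds.setArr ((hs.congr ha1).congr ha2) _ _ _
    · intro r hr
      exact (hr2 r (by omega)).trans (hr1 r hr)
  | seq p q ihp ihq =>
    simp only [degree] at hd
    obtain ⟨n1, hn1, s1, h1, hh1, hm1, hr1⟩ := ihp M hM hk.1 hw.1
      ((hmono (by omega)).trans_lt hd) s hs (q.compile K :: R)
    obtain ⟨n2, hn2, s2, h2, hh2, hm2, hr2⟩ := ihq _ hm1 hk.2 hw.2
      ((hmono (by omega)).trans_lt hd) s1 hh1 R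
    refine ⟨_, ?_, s2, ((Det.seq w _ _ R s).trans h1).trans h2, hh2, hm2, fun r hr => ?_⟩
    · simp only [cost]; omega
    · rw [hr2 r hr, hr1 r hr]
  | ite a b p q ihp ihq =>
    obtain ⟨hwa, hwb, hwp, hwq⟩ := hw
    simp only [degree] at hd
    have ha := (a.wordEval_eq hM hB hwa ((hmono (by omega)).trans_lt hd)).1
    have hb := (b.wordEval_eq hM hB hwb ((hmono (by omega)).trans_lt hd)).1
    obtain ⟨s1, h1, ha1, hv1, hr1⟩ := a.compile_spec (w := w) 2 s hs
      (.seq (b.compile K 3) (.ifLt 2 3 (p.compile K) (q.compile K)) :: R)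
    obtain ⟨s2, h2, ha2, hv2, hr2⟩ := b.compile_spec (w := w) 3 s1 (hs.congr ha1)
      (.ifLt 2 3 (p.compile K) (q.compile K) :: R)
    have hdet := ((((Det.seq w _ _ R s).trans h1).trans (Det.seq w _ _ R s1)).trans h2).trans
      (Det.one (w := w) (c := (.ifLt 2 3 (p.compile K) (q.compile K) :: R, s2)) rfl)
    rw [hr2 2 (by omega), hv1, hv2, ha, hb] at hdet
    have hr (r : ℕ) (h : r < 2) : s2.reg r = s.reg r := (hr2 r (by omega)).trans (hr1 r h)
    have hs2 : s2.Holds K M := (hs.congr ha1).congr ha2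
    unfold Keeps at hk
    unfold run
    split_ifs at hk hdet ⊢ with hab
    · obtain ⟨n3, hn3, s3, h3, hh3, hm3, hr3⟩ := ihp M hM hk hwp
        ((hmono (by omega)).trans_lt hd) s2 hs2 R
      refine ⟨_, ?_, s3, hdet.trans h3, hh3, hm3, fun r h => (hr3 r h).trans (hr r h)⟩
      simp only [cost]; omega
    · obtain ⟨n3, hn3, s3, h3, hh3, hm3, hr3⟩ := ihq M hM hk hwq
        ((hmono (by omega)).trans_lt hd) s2 hs2 R
      refine ⟨_, ?_, s3, hdet.trans h3, hh3, hm3, fun r h => (hr3 r h).trans (hr r h)⟩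
      simp only [cost]; omega

/-- The memory after `n` iterations of a loop with body `p`, which finds the number of the
iteration in the variable `ctr`. -/
def Stmt.iter (p : Stmt) (M : Mem) : ℕ → Mem
  | 0 => M
  | n + 1 => p.run ((p.iter M n).set .ctr 0 n)

/-- Programs with loops that are not nested. -/
inductive Cmd where
  | stmt (p : Stmt)
  | seq (p q : Cmd)
  /-- `for ctr := 0, …, e - 1 do p`, where `e` is evaluated once -/
  | loop (e : Expr) (p : Stmt)

namespace Cmd

/-- The programs `f i` for `i < n`, one after the other. -/
def each (n : ℕ) (f : ℕ → Cmd) : Cmd := Nat.rec (stmt .skip) (fun i p => p.seq (f i)) n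

/-- The effect of a program on the memory. -/
def run : Cmd → Mem → Mem
  | stmt p, M => p.run M
  | seq p q, M => q.run (p.run M)
  | loop e p, M => p.iter M (e.eval M)

/-- Every number that is stored in an array that does not hold input values is at most `B`, and
every loop has at most `N` iterations. -/
def Keeps (B N : ℕ) : Cmd → Mem → Prop
  | stmt p, M => p.Keeps B M
  | seq p q, M => p.Keeps B N M ∧ q.Keeps B N (p.run M)
  | loop e p, M => (e.eval M ≤ N ∧ e.eval M ≤ B) ∧
      ∀ j < e.eval M, p.Keeps B ((p.iter M j).set .ctr 0 j)

/-- An upper bound for the number of machine steps if every loop has at most `N` iterations. -/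
def cost (N : ℕ) : Cmd → ℕ
  | stmt p => p.cost
  | seq p q => p.cost N + q.cost N + 1
  | loop e p => e.cost + 4 + N * (p.cost + 9)

/-- An upper bound for the degrees of the expressions. -/
def degree : Cmd → ℕ
  | stmt p => p.degree
  | seq p q => p.degree + q.degree
  | loop e p => e.degree + p.degree + 1

/-- Input values are used as addresses, or stored in arrays that hold input values. -/
def Wf : Cmd → Prop
  | stmt p => p.Wf
  | seq p q => p.Wf ∧ q.Wf
  | loop e p => e.Wf ∧ p.Wf

/-- Machine code; register `0` holds the number of the current iteration of a loop, and
register `1` the number of all iterations. -/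
def compile (K : ℕ) : Cmd → Prog
  | stmt p => p.compile K
  | seq p q => .seq (p.compile K) (q.compile K)
  | loop e p => .seq (.const 0 0) (.seq (e.compile K 1) (.whileLt 0 1
      (.seq (.const 2 0) (.seq (.store (Name.ctr.code K) 2 0)
        (.seq (p.compile K) (.seq (.const 2 1) (.arith .add 0 0 2)))))))

theorem cost_le (N : ℕ) (p : Cmd) : p.cost N ≤ p.cost 1 * (N + 1) := by
  induction p with
  | stmt p => simp only [cost]; nlinarith [p.cost.zero_le, N.zero_le]
  | seq p q ihp ihq => simp only [cost]; nlinarith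
  | loop e p => simp only [cost]; nlinarith [e.cost.zero_le, N.zero_le]

theorem wf_each {n : ℕ} {f : ℕ → Cmd} (h : ∀ i < n, (f i).Wf) : (each n f).Wf := by
  induction n with
  | zero => trivial
  | succ n ih => exact ⟨ih fun i hi => h i (by omega), h n (by omega)⟩

end Cmd

theorem State.holds_setReg {K : ℕ} {s : State} {M : Mem} (h : s.Holds K M) (d v : ℕ) :
    (s.setReg d v).Holds K M := h

/-- If the words are long enough for the numbers in the run of a program, the machine carries out
the ideal run within the time bound. -/
theorem Cmd.compile_spec {w B N K : ℕ} (hB : 2 ≤ B) (p : Cmd) (M : Mem) (hM : M.Small B)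
    (hk : p.Keeps B N M) (hw : p.Wf) (hd : B ^ p.degree < 2 ^ w) (s : State) (hs : s.Holds K M)
    (R : List Prog) :
    ∃ n ≤ p.cost N, ∃ s' : State, Det w (p.compile K :: R, s) n (R, s') ∧
      s'.Holds K (p.run M) ∧ (p.run M).Small B := by
  have hmono {x y : ℕ} (h : x ≤ y) : B ^ x ≤ B ^ y := Nat.pow_le_pow_right (by omega) h
  induction p generalizing M s R with
  | stmt p =>
    obtain ⟨n, hn, s', h, hh, hm, -⟩ := p.compile_spec hB M hM hk hw hd s hs R
    exact ⟨n, hn, s', h, hh, hm⟩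
  | seq p q ihp ihq =>
    simp only [degree] at hd
    obtain ⟨n1, hn1, s1, h1, hh1, hm1⟩ := ihp M hM hk.1 hw.1
      ((hmono (by omega)).trans_lt hd) s hs (q.compile K :: R)
    obtain ⟨n2, hn2, s2, h2, hh2, hm2⟩ := ihq _ hm1 hk.2 hw.2
      ((hmono (by omega)).trans_lt hd) s1 hh1 R
    refine ⟨_, ?_, s2, ((Det.seq w _ _ R s).trans h1).trans h2, hh2, hm2⟩
    simp only [cost]; omega
  | loop e p =>
    obtain ⟨hwe, hwp⟩ := hw
    simp only [degree] at hd
    obtain ⟨⟨hN, hnB⟩, hk⟩ := hk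
    have he := (e.wordEval_eq hM hB hwe ((hmono (by omega)).trans_lt hd)).1
    have hBw : B < 2 ^ w := (Nat.le_self_pow (by omega) B).trans_lt hd
    set body : Prog := .seq (.const 2 0) (.seq (.store (Name.ctr.code K) 2 0)
        (.seq (p.compile K) (.seq (.const 2 1) (.arith .add 0 0 2)))) with hbody
    obtain ⟨s1, h1, ha1, hv1, hr1⟩ := e.compile_spec (w := w) 1 (s.setReg 0 (0 % 2 ^ w)) hs
      (.whileLt 0 1 body :: R)
    have hstart : Det w ((loop e p).compile K :: R, s) (1 + 1 + 1 + e.cost)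
        (.whileLt 0 1 body :: R, s1) :=
      (((Det.seq w _ _ R s).trans (Det.one rfl)).trans (Det.seq w _ _ _ _)).trans h1
    have hloop : ∀ j ≤ e.eval M, ∃ n ≤ j * (p.cost + 9), ∃ s2 : State,
        Det w (.whileLt 0 1 body :: R, s1) n (.whileLt 0 1 body :: R, s2) ∧
        s2.Holds K (p.iter M j) ∧ (p.iter M j).Small B ∧ s2.reg 0 = j ∧
        s2.reg 1 = e.eval M := by
      intro j
      induction j with
      | zero =>
        refine fun _ => ⟨0, by simp, s1, Det.refl _ _, hs.congr ha1, hM, ?_, by rw [hv1, he]⟩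
        rw [hr1 0 (by omega)]
        simp [State.setReg]
      | succ j ih =>
        intro hj
        obtain ⟨n, hn, s2, h2, hh2, hm2, hr20, hr21⟩ := ih (by omega)
        set s3 := s2.setReg 2 (0 % 2 ^ w)
        set s4 := s3.setArr (Name.ctr.code K) (s3.reg 2) (s3.reg 0)
        have hs4 : s4.Holds K ((p.iter M j).set .ctr 0 j) := by
          have := State.Holds.setArr (State.holds_setReg hh2 2 (0 % 2 ^ w)) .ctr 0 j
          have e1 : s3.reg 2 = 0 := by simp [s3, State.setReg]
          have e2 : s3.reg 0 = j := by simp [s3, State.setReg, hr20]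
          simp only [s4, e1, e2]
          exact this
        obtain ⟨n5, hn5, s5, h5, hh5, hm5, hr5⟩ := p.compile_spec hB _
          (hm2.set (.inr (by omega))) (hk j (by omega)) hwp ((hmono (by omega)).trans_lt hd)
          s4 hs4 (.seq (.const 2 1) (.arith .add 0 0 2) :: .whileLt 0 1 body :: R)
        have hwhile : Det w (.whileLt 0 1 body :: R, s2) 1 (body :: .whileLt 0 1 body :: R, s2) := by
          refine Det.one ?_
          rw [step, if_pos (by omega)]
        have hbegin : Det w (body :: .whileLt 0 1 body :: R, s2) (1 + 1 + 1 + 1 + 1)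
            (p.compile K :: .seq (.const 2 1) (.arith .add 0 0 2) :: .whileLt 0 1 body :: R, s4) :=
          ((((Det.seq w _ _ _ _).trans (Det.one rfl)).trans (Det.seq w _ _ _ _)).trans
            (Det.one rfl)).trans (Det.seq w _ _ _ _)
        set s6 := s5.setReg 2 (1 % 2 ^ w)
        have hend : Det w (.seq (.const 2 1) (.arith .add 0 0 2) :: .whileLt 0 1 body :: R, s5)
            (1 + 1 + 1) (.whileLt 0 1 body :: R,
              s6.setReg 0 (ArithOp.add.eval w (s6.reg 0) (s6.reg 2))) :=
          ((Det.seq w _ _ _ _).trans (Det.one rfl)).trans (Det.one rfl)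
        refine ⟨_, ?_, _, (((h2.trans hwhile).trans hbegin).trans h5).trans hend, hh5, hm5, ?_, ?_⟩
        · rw [Nat.succ_mul]; omega
        · have e3 : s5.reg 0 = j := by
            rw [hr5 0 (by omega)]; simpa [s4, s3, State.setReg, State.setArr] using hr20
          have e4 : 1 % 2 ^ w = 1 := Nat.mod_eq_of_lt (by omega)
          simp only [s6, State.setReg, Function.update_self, Function.update_of_ne, e3, e4,
            ArithOp.eval, ne_eq, OfNat.zero_ne_ofNat, not_false_eq_true]
          exact Nat.mod_eq_of_lt (by omega)
        · have e5 : s5.reg 1 = e.eval M := by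
            rw [hr5 1 (by omega)]; simpa [s4, s3, State.setReg, State.setArr] using hr21
          simp [s6, State.setReg, e5]
    obtain ⟨n, hn, s2, h2, hh2, hm2, hr20, hr21⟩ := hloop _ le_rfl
    have hexit : Det w (.whileLt 0 1 body :: R, s2) 1 (R, s2) := by
      refine Det.one ?_
      rw [step, if_neg (by omega)]
    refine ⟨_, ?_, s2, (hstart.trans h2).trans hexit, hh2, hm2⟩
    have : e.eval M * (p.cost + 9) ≤ N * (p.cost + 9) := Nat.mul_le_mul_right _ hN
    simp only [cost]; omega

/-- Started on a memory with small entries, the program runs without exceeding the bounds and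
establishes `Q`. -/
def Cmd.Ensures (B N : ℕ) (p : Cmd) (M : Mem) (Q : Mem → Prop) : Prop :=
  p.Keeps B N M ∧ (p.run M).Small B ∧ Q (p.run M)

theorem Stmt.small_run {B : ℕ} {p : Stmt} {M : Mem} (hM : M.Small B) (hk : p.Keeps B M) :
    (p.run M).Small B := by
  induction p generalizing M with
  | skip => exact hM
  | asg A i e => exact hM.set hk
  | seq p q ihp ihq => exact ihq (ihp hM hk.1) hk.2
  | ite a b p q ihp ihq =>
    unfold Keeps at hk
    unfold run
    split_ifs at hk ⊢
    exacts [ihp hM hk, ihq hM hk]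

namespace Cmd.Ensures

variable {B N : ℕ} {M : Mem}

theorem stmt {p : Stmt} {Q : Mem → Prop} (hM : M.Small B) (hk : p.Keeps B M) (hQ : Q (p.run M)) :
    (Cmd.stmt p).Ensures B N M Q :=
  ⟨hk, Stmt.small_run hM hk, hQ⟩

theorem seq {p q : Cmd} {Q R : Mem → Prop} (hp : p.Ensures B N M Q)
    (hq : ∀ M', M'.Small B → Q M' → q.Ensures B N M' R) : (p.seq q).Ensures B N M R := by
  obtain ⟨h1, h2, h3⟩ := hp
  obtain ⟨h4, h5, h6⟩ := hq _ h2 h3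
  exact ⟨⟨h1, h4⟩, h5, h6⟩

theorem mono {p : Cmd} {Q R : Mem → Prop} (hp : p.Ensures B N M Q) (h : ∀ M', Q M' → R M') :
    p.Ensures B N M R :=
  ⟨hp.1, hp.2.1, h _ hp.2.2⟩

/-- The loop rule: `Inv j` holds after `j` iterations. -/
theorem loop {e : Expr} {p : Stmt} (Inv : ℕ → Mem → Prop) (hM : M.Small B) {n : ℕ}
    (hn : e.eval M = n) (hnN : n ≤ N) (hnB : n ≤ B) (h0 : Inv 0 M)
    (hstep : ∀ j < n, ∀ M', M'.Small B → Inv j M' →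
      p.Keeps B (M'.set .ctr 0 j) ∧ Inv (j + 1) (p.run (M'.set .ctr 0 j))) :
    (Cmd.loop e p).Ensures B N M (Inv n) := by
  have h : ∀ j ≤ n, (p.iter M j).Small B ∧ Inv j (p.iter M j) ∧
      ∀ j' < j, p.Keeps B ((p.iter M j').set .ctr 0 j') := by
    intro j
    induction j with
    | zero => exact fun _ => ⟨hM, h0, fun j' hj' => by omega⟩
    | succ j ih =>
      intro hj
      obtain ⟨h1, h2, h3⟩ := ih (by omega)
      obtain ⟨h4, h5⟩ := hstep j (by omega) _ h1 h2
      refine ⟨Stmt.small_run (h1.set (.inr (by omega))) h4, h5, fun j' hj' => ?_⟩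
      rcases Nat.lt_succ_iff_lt_or_eq.1 hj' with h | rfl
      exacts [h3 j' h, h4]
  obtain ⟨h1, h2, h3⟩ := h n le_rfl
  subst hn
  exact ⟨⟨⟨hnN, hnB⟩, h3⟩, h1, h2⟩

/-- The rule for the composition of a fixed number of programs. -/
theorem each {n : ℕ} {f : ℕ → Cmd} (Inv : ℕ → Mem → Prop) (hM : M.Small B) (h0 : Inv 0 M)
    (hstep : ∀ i < n, ∀ M', M'.Small B → Inv i M' → (f i).Ensures B N M' (Inv (i + 1))) :
    (Cmd.each n f).Ensures B N M (Inv n) := by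
  induction n with
  | zero => exact ⟨trivial, hM, h0⟩
  | succ n ih =>
    exact (ih fun i hi => hstep i (by omega)).seq fun M' hM' h => hstep n (by omega) M' hM' h

end Cmd.Ensures

/-! ### Tries -/

open Classical in
/-- One more than the first `j < s` with `p j`, or `0` if there is none. -/
noncomputable def firstIdx (p : ℕ → Prop) : ℕ → ℕ
  | 0 => 0
  | s + 1 => if firstIdx p s ≠ 0 then firstIdx p s else if p s then s + 1 else 0

theorem firstIdx_spec (p : ℕ → Prop) (s : ℕ) :
    (firstIdx p s = 0 ∧ ∀ j < s, ¬ p j) ∨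
      ∃ j < s, firstIdx p s = j + 1 ∧ p j ∧ ∀ j' < j, ¬ p j' := by
  induction s with
  | zero => exact .inl ⟨rfl, by simp⟩
  | succ s ih =>
    rcases ih with ⟨h1, h2⟩ | ⟨j, hj, h1, h2, h3⟩
    · by_cases hp : p s
      · exact .inr ⟨s, by omega, by simp [firstIdx, h1, hp], hp, h2⟩
      · refine .inl ⟨by simp [firstIdx, h1, hp], fun j hj => ?_⟩
        rcases Nat.lt_succ_iff_lt_or_eq.1 hj with h | rfl
        exacts [h2 j h, hp]
    · exact .inr ⟨j, by omega, by simp [firstIdx, h1], h2, h3⟩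

theorem firstIdx_le (p : ℕ → Prop) (s : ℕ) : firstIdx p s ≤ s := by
  rcases firstIdx_spec p s with ⟨h, -⟩ | ⟨j, hj, h, -⟩ <;> omega

theorem firstIdx_ne_zero {p : ℕ → Prop} {s j : ℕ} (hj : j < s) (h : p j) : firstIdx p s ≠ 0 := by
  rcases firstIdx_spec p s with ⟨-, h'⟩ | ⟨j, hj, h, -⟩
  · exact absurd h (h' j hj)
  · omega

theorem firstIdx_eq_succ {p : ℕ → Prop} {s j : ℕ} (h : firstIdx p s = j + 1) :
    j < s ∧ p j ∧ ∀ j' < j, ¬ p j' := by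
  rcases firstIdx_spec p s with ⟨h', -⟩ | ⟨j', hj, h', h2⟩
  · omega
  · obtain rfl : j = j' := by omega
    exact ⟨hj, h2⟩

theorem exists_of_firstIdx_ne_zero {p : ℕ → Prop} {s : ℕ} (h : firstIdx p s ≠ 0) :
    ∃ j < s, firstIdx p s = j + 1 ∧ p j := by
  rcases firstIdx_spec p s with ⟨h', -⟩ | ⟨j', hj, h', h2, -⟩
  · exact absurd h' h
  · exact ⟨j', hj, h', h2⟩

theorem firstIdx_congr {p q : ℕ → Prop} {s : ℕ} (h : ∀ j < s, (p j ↔ q j)) :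
    firstIdx p s = firstIdx q s := by
  induction s with
  | zero => rfl
  | succ s ih =>
    have h1 := ih fun j hj => h j (by omega)
    have h2 := h s (by omega)
    simp only [firstIdx, h1]
    split_ifs <;> simp_all

/-- A table with `s` rows and columns `0, …, k - 1`; the entry of row `j` in column `i` is
`val j i`. -/
structure Table where
  rows : ℕ
  cols : ℕ
  val : ℕ → ℕ → ℕ

namespace Table

variable (T : Table)

/-- Row `j` agrees with `u` on the first `i` columns. -/
def Agree (i : ℕ) (u : ℕ → ℕ) (j : ℕ) : Prop := ∀ l < i, T.val j l = u l

/-- The node of the trie of `T` for the first `i` entries of `u`: one more than the number of the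
first row that starts with them, or `0` if there is none. -/
noncomputable def node (i : ℕ) (u : ℕ → ℕ) : ℕ := firstIdx (T.Agree i u) T.rows

/-- The level `i` node above row `j`. -/
noncomputable def path (i j : ℕ) : ℕ := T.node i (T.val j)

/-- The dictionary entry of the value `v` in column `i`. -/
noncomputable def dict (i v : ℕ) : ℕ := firstIdx (fun j => T.val j i = v) T.rows

/-- The key under which the trie stores the child of a level `i` node for the value `v`. -/
noncomputable def key (i a v : ℕ) : ℕ := a * (T.rows + 1) + T.dict i v

open Classical in
/-- The number of leaves below the level `i` node `a`. A leaf is represented by the first row of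
a class of equal rows. -/
noncomputable def cnt (i a : ℕ) : ℕ :=
  ∑ j ∈ Finset.range T.rows, if T.path T.cols j = j + 1 ∧ T.path i j = a then 1 else 0

open Classical in
/-- The number of leaves below those children of the level `i` node `a` whose first row is one of
the first `j` rows. -/
noncomputable def used (i j a : ℕ) : ℕ :=
  ∑ j' ∈ Finset.range j, if T.path (i + 1) j' = j' + 1 ∧ T.path i j' = a
    then T.cnt (i + 1) (j' + 1) else 0

/-- The position of the first leaf below the level `i` node `a`, if the children of each node are
ordered by their first rows. -/
noncomputable def base : ℕ → ℕ → ℕ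
  | 0, _ => 0
  | i + 1, a => base i (T.path i (a - 1)) + T.used i (a - 1) (T.path i (a - 1))

variable {T} {i j j' l : ℕ} {u v : ℕ → ℕ}

theorem Agree.mono (h : T.Agree i u j) (hl : l ≤ i) : T.Agree l u j :=
  fun x hx => h x (by omega)

theorem agree_self : T.Agree i (T.val j) j := fun _ _ => rfl

theorem node_le : T.node i u ≤ T.rows := firstIdx_le _ _

theorem path_le : T.path i j ≤ T.rows := firstIdx_le _ _

theorem dict_le {w : ℕ} : T.dict i w ≤ T.rows := firstIdx_le _ _

theorem node_congr (h : ∀ l < i, u l = v l) : T.node i u = T.node i v := by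
  refine firstIdx_congr fun j _ => forall₂_congr fun l hl => ?_
  rw [h l hl]

theorem node_zero (h : 0 < T.rows) : T.node 0 u = 1 := by
  obtain ⟨j, hj, h1, -, h2⟩ := (firstIdx_spec (T.Agree 0 u) T.rows).resolve_left
    fun h' => h'.2 0 h fun l hl => by omega
  have : j = 0 := by
    by_contra h0
    exact h2 0 (by omega) fun l hl => by omega
  rw [node, h1, this]

theorem node_eq_path (h : T.Agree i u j) : T.node i u = T.path i j :=
  node_congr fun l hl => (h l hl).symm

theorem path_ne_zero (hj : j < T.rows) : T.path i j ≠ 0 := firstIdx_ne_zero hj agree_self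

theorem exists_row (h : T.node i u ≠ 0) :
    ∃ j < T.rows, T.node i u = j + 1 ∧ T.Agree i u j ∧ T.path i j = j + 1 := by
  obtain ⟨j, hj, h1, h2⟩ := exists_of_firstIdx_ne_zero h
  exact ⟨j, hj, h1, h2, (node_eq_path h2).symm.trans h1⟩

theorem node_ne_zero (hj : j < T.rows) (h : T.Agree i u j) : T.node i u ≠ 0 :=
  firstIdx_ne_zero hj h

theorem path_eq_node_iff (hj : j < T.rows) : T.path i j = T.node i u ↔ T.Agree i u j := by
  refine ⟨fun h => ?_, fun h => (node_eq_path h).symm⟩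
  have h0 : T.node i u ≠ 0 := h ▸ path_ne_zero hj
  obtain ⟨j0, hj0, h1, h2, -⟩ := exists_row h0
  obtain ⟨-, h3, -⟩ := firstIdx_eq_succ (h.trans h1)
  intro l hl
  rw [← h3 l hl, h2 l hl]

theorem path_eq_path_iff (hj : j < T.rows) :
    T.path i j = T.path i j' ↔ T.Agree i (T.val j') j := path_eq_node_iff hj

theorem path_eq_of_le (hj : j < T.rows) (h : T.path i j = T.path i j') (hl : l ≤ i) :
    T.path l j = T.path l j' :=
  (path_eq_path_iff hj).2 (((path_eq_path_iff hj).1 h).mono hl)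

theorem node_ne_zero_of_le (h : T.node i u ≠ 0) (hl : l ≤ i) : T.node l u ≠ 0 := by
  obtain ⟨j, hj, -, h2, -⟩ := exists_row h
  exact node_ne_zero hj (h2.mono hl)

/-- The first row of the class of row `j` at level `i`. -/
theorem exists_first (i : ℕ) (hj : j < T.rows) :
    ∃ j0 < T.rows, T.path i j = j0 + 1 ∧ T.path i j0 = j0 + 1 ∧ j0 ≤ j := by
  obtain ⟨j0, hj0, h1, -, h2⟩ := exists_row (path_ne_zero (T := T) (i := i) hj)
  refine ⟨j0, hj0, h1, h2, ?_⟩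
  by_contra h
  exact (firstIdx_eq_succ h1).2.2 j (by omega) agree_self

theorem dict_inj {a b : ℕ} (h : T.dict i a = T.dict i b) (hj : j < T.rows) (hb : T.val j i = b) :
    a = b := by
  have h0 : T.dict i b ≠ 0 := firstIdx_ne_zero hj hb
  obtain ⟨j0, hj0, h1, h2⟩ := exists_of_firstIdx_ne_zero h0
  obtain ⟨-, h3, -⟩ := firstIdx_eq_succ (h.trans h1)
  exact h3.symm.trans h2

theorem key_eq_iff (hj : j < T.rows) :
    T.key i (T.path i j) (T.val j i) = T.key i (T.node i u) (u i) ↔ T.Agree (i + 1) u j := by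
  constructor
  · intro h
    have h1 : T.dict i (T.val j i) < T.rows + 1 := Nat.lt_succ_of_le dict_le
    have h2 : T.dict i (u i) < T.rows + 1 := Nat.lt_succ_of_le dict_le
    unfold key at h
    have h3 := congrArg (· / (T.rows + 1)) h
    have h4 := congrArg (· % (T.rows + 1)) h
    simp only [Nat.add_comm (_ * _), Nat.add_mul_div_right _ _ (Nat.succ_pos _),
      Nat.div_eq_of_lt h1, Nat.div_eq_of_lt h2, zero_add, Nat.add_mul_mod_self_right,
      Nat.mod_eq_of_lt h1, Nat.mod_eq_of_lt h2] at h3 h4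
    intro l hl
    rcases Nat.lt_succ_iff_lt_or_eq.1 hl with hl | rfl
    · exact (path_eq_node_iff hj).1 h3 l hl
    · exact (dict_inj h4.symm hj rfl).symm
  · intro h
    rw [(path_eq_node_iff hj).2 (h.mono (Nat.le_succ i)), h i (Nat.lt_succ_self i)]

/-- The children of a node are found under their keys. -/
theorem firstIdx_key : firstIdx (fun j => T.key i (T.path i j) (T.val j i) =
    T.key i (T.node i u) (u i)) T.rows = T.node (i + 1) u :=
  firstIdx_congr fun _ hj => key_eq_iff hj

theorem cnt_le {a : ℕ} : T.cnt i a ≤ T.rows := by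
  classical
  unfold cnt
  refine (Finset.sum_le_card_nsmul _ _ 1 fun j _ => ?_).trans (by simp)
  split_ifs <;> simp

theorem cnt_path_pos (hi : i ≤ T.cols) (hj : j < T.rows) : 0 < T.cnt i (T.path i j) := by
  classical
  obtain ⟨j0, hj0, h1, h2, -⟩ := exists_first T.cols hj
  refine lt_of_lt_of_le Nat.zero_lt_one ?_
  have := Finset.single_le_sum (f := fun x =>
    if T.path T.cols x = x + 1 ∧ T.path i x = T.path i j then 1 else 0)
    (fun _ _ => Nat.zero_le _) (Finset.mem_range.2 hj0)
  refine le_trans (le_of_eq ?_) this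
  rw [if_pos ⟨h2, path_eq_of_le hj0 (h2.trans h1.symm) hi⟩]

theorem cnt_node_pos (hi : i ≤ T.cols) (h : T.node i u ≠ 0) : 0 < T.cnt i (T.node i u) := by
  obtain ⟨j, hj, h1, -, h2⟩ := exists_row h
  rw [h1, ← h2]
  exact cnt_path_pos hi hj

theorem cnt_cols (hj : j < T.rows) : T.cnt T.cols (T.path T.cols j) = 1 := by
  classical
  obtain ⟨j0, hj0, h1, h2, -⟩ := exists_first T.cols hj
  rw [cnt, Finset.sum_eq_single_of_mem j0 (Finset.mem_range.2 hj0)]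
  · rw [if_pos ⟨h2, h2.trans h1.symm⟩]
  · intro x _ hx
    rw [if_neg]
    rintro ⟨h3, h4⟩
    omega

/-- The leaves below a node are those below its children. -/
theorem used_rows (a : ℕ) : T.used i T.rows a = T.cnt i a := by
  classical
  unfold used cnt
  have h : ∀ j' ∈ Finset.range T.rows,
      (if T.path (i + 1) j' = j' + 1 ∧ T.path i j' = a then
        ∑ j ∈ Finset.range T.rows,
          if T.path T.cols j = j + 1 ∧ T.path (i + 1) j = j' + 1 then 1 else 0 else 0) =
      ∑ j ∈ Finset.range T.rows, if T.path (i + 1) j = j' + 1 then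
        (if T.path T.cols j = j + 1 ∧ T.path i j = a then 1 else 0) else 0 := by
    intro j' hj'
    rw [Finset.mem_range] at hj'
    split_ifs with h
    · refine Finset.sum_congr rfl fun j hj => ?_
      rw [Finset.mem_range] at hj
      by_cases h1 : T.path (i + 1) j = j' + 1
      · have : T.path i j = a :=
          (path_eq_of_le hj (h1.trans h.1.symm) (Nat.le_succ i)).trans h.2
        simp [h1, this]
      · simp [h1]
    · refine (Finset.sum_eq_zero fun j hj => ?_).symm
      rw [Finset.mem_range] at hj
      split_ifs with h1 h2
      · obtain ⟨j0, hj0, h3, h4, -⟩ := exists_first (i + 1) hj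
        obtain rfl : j0 = j' := by omega
        exact absurd ⟨h4, (path_eq_of_le hj (h1.trans h4.symm) (Nat.le_succ i)).symm.trans h2.2⟩ h
      · rfl
      · rfl
  rw [Finset.sum_congr rfl h, Finset.sum_comm]
  refine Finset.sum_congr rfl fun j hj => ?_
  rw [Finset.mem_range] at hj
  obtain ⟨j0, hj0, h1, -, -⟩ := exists_first (i + 1) hj
  rw [Finset.sum_eq_single_of_mem j0 (Finset.mem_range.2 hj0), if_pos h1]
  intro x _ hx
  rw [if_neg]
  omega

theorem used_mono (a : ℕ) (h : j ≤ j') : T.used i j a ≤ T.used i j' a :=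
  Finset.sum_le_sum_of_subset (by simpa using h)

theorem used_le {a : ℕ} (hj : j ≤ T.rows) : T.used i j a ≤ T.cnt i a :=
  (used_mono a hj).trans (used_rows a).le

theorem base_le {a : ℕ} (ha : a ≤ T.rows) : T.base i a ≤ i * T.rows := by
  induction i generalizing a with
  | zero => simp [base]
  | succ i ih =>
    have h1 := ih (path_le (T := T) (i := i) (j := a - 1))
    have h2 := (used_le (T := T) (i := i) (j := a - 1) (a := T.path i (a - 1))
      (by omega)).trans cnt_le
    rw [base, Nat.succ_mul]
    omega

/-- The leaves below the child of a node form a block of the leaves below the node. -/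
theorem base_succ_path (hj : j < T.rows) :
    ∃ j0 < T.rows, T.path (i + 1) j = j0 + 1 ∧ T.path i j0 = T.path i j ∧
      T.base (i + 1) (T.path (i + 1) j) = T.base i (T.path i j) + T.used i j0 (T.path i j) ∧
      T.used i (j0 + 1) (T.path i j) =
        T.used i j0 (T.path i j) + T.cnt (i + 1) (T.path (i + 1) j) := by
  obtain ⟨j0, hj0, h1, h2, -⟩ := exists_first (i + 1) hj
  have h3 : T.path i j0 = T.path i j := path_eq_of_le hj0 (h2.trans h1.symm) (Nat.le_succ i)
  refine ⟨j0, hj0, h1, h3, ?_, ?_⟩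
  · rw [h1, base, Nat.add_sub_cancel, h3]
  · rw [used, Finset.sum_range_succ, if_pos ⟨h2, h3⟩, h1]
    rfl

theorem base_succ_mem (hj : j < T.rows) :
    T.base i (T.path i j) ≤ T.base (i + 1) (T.path (i + 1) j) ∧
      T.base (i + 1) (T.path (i + 1) j) + T.cnt (i + 1) (T.path (i + 1) j) ≤
        T.base i (T.path i j) + T.cnt i (T.path i j) := by
  obtain ⟨j0, hj0, -, -, h1, h2⟩ := base_succ_path (i := i) hj
  have h3 := used_le (T := T) (i := i) (a := T.path i j) (show j0 + 1 ≤ T.rows from hj0)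
  omega

theorem base_disjoint (hj : j < T.rows) (hj' : j' < T.rows)
    (h : T.path i j ≠ T.path i j') :
    T.base i (T.path i j) + T.cnt i (T.path i j) ≤ T.base i (T.path i j') ∨
      T.base i (T.path i j') + T.cnt i (T.path i j') ≤ T.base i (T.path i j) := by
  induction i with
  | zero =>
    refine absurd ?_ h
    exact (path_eq_path_iff hj).2 fun l hl => by omega
  | succ i ih =>
    have h1 := base_succ_mem (i := i) hj
    have h2 := base_succ_mem (i := i) hj'
    by_cases hp : T.path i j = T.path i j'
    · obtain ⟨a, ha, ha1, -, ha2, ha3⟩ := base_succ_path (i := i) hj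
      obtain ⟨b, hb, hb1, -, hb2, hb3⟩ := base_succ_path (i := i) hj'
      rw [← hp] at hb2 hb3
      rcases lt_trichotomy a b with hab | hab | hab
      · have := used_mono (T := T) (i := i) (T.path i j) (Nat.succ_le_of_lt hab)
        left
        simp only [Nat.succ_eq_add_one] at this
        omega
      · omega
      · have := used_mono (T := T) (i := i) (T.path i j) (Nat.succ_le_of_lt hab)
        right
        simp only [Nat.succ_eq_add_one] at this
        omega
    · rcases ih hp with h3 | h3
      · left; omega
      · right; omega

/-- The position of the leaf of row `j`. -/
noncomputable def pos (T : Table) (j : ℕ) : ℕ := T.base T.cols (T.path T.cols j)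

theorem path_eq_of_pos_eq (hj : j < T.rows) (hj' : j' < T.rows) (h : T.pos j = T.pos j') :
    T.path T.cols j = T.path T.cols j' := by
  by_contra hne
  have h1 := cnt_cols hj
  have h2 := cnt_cols hj'
  have h3 := base_disjoint hj hj' hne
  unfold pos at h
  omega

theorem pos_mem (hi : i ≤ T.cols) (hj : j < T.rows) :
    T.base i (T.path i j) ≤ T.pos j ∧ T.pos j < T.base i (T.path i j) + T.cnt i (T.path i j) := by
  induction hi using Nat.decreasingInduction with
  | self =>
    have := cnt_cols hj
    unfold pos
    omega
  | of_succ i _ ih =>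
    have := base_succ_mem (i := i) hj
    omega

/-- Every position in the block of a node is the position of a leaf below the node. -/
theorem exists_pos_eq {p : ℕ} (hi : i ≤ T.cols)
    (h1 : T.base i (T.path i j) ≤ p)
    (h2 : p < T.base i (T.path i j) + T.cnt i (T.path i j)) :
    ∃ l < T.rows, T.path i l = T.path i j ∧ T.pos l = p := by
  classical
  set S := (Finset.range T.rows).filter
    fun l => T.path T.cols l = l + 1 ∧ T.path i l = T.path i j with hS
  have hcard : S.card = T.cnt i (T.path i j) := by
    rw [cnt, Finset.sum_boole, Nat.cast_id]
  set I := Finset.Ico (T.base i (T.path i j)) (T.base i (T.path i j) + T.cnt i (T.path i j))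
  have hmaps : ∀ l ∈ S, T.pos l ∈ I := by
    intro l hl
    simp only [hS, Finset.mem_filter, Finset.mem_range] at hl
    have := pos_mem hi hl.1
    rw [hl.2.2] at this
    exact Finset.mem_Ico.2 this
  have hinj : Set.InjOn T.pos S := by
    intro a ha b hb hab
    simp only [hS, Finset.coe_filter, Finset.mem_range, Set.mem_ofPred_eq] at ha hb
    have := path_eq_of_pos_eq ha.1 hb.1 hab
    omega
  obtain ⟨l, hl, hlp⟩ := Finset.surj_on_of_inj_on_of_card_le (fun l _ => T.pos l) hmaps
    (fun a b ha hb h => hinj ha hb h) (by rw [hcard, Nat.card_Ico]; omega) p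
    (Finset.mem_Ico.2 ⟨h1, h2⟩)
  simp only [hS, Finset.mem_filter, Finset.mem_range] at hl
  exact ⟨l, hl.1, hl.2.2, hlp.symm⟩

/-- The array `f` holds at the position of each leaf a row of the class of that leaf. -/
def IsLeafArray (T : Table) (f : ℕ → ℕ) : Prop :=
  ∀ j < T.rows, f (T.pos j) < T.rows ∧ T.path T.cols (f (T.pos j)) = T.path T.cols j

theorem IsLeafArray.agree {f : ℕ → ℕ} (hf : T.IsLeafArray f) {p : ℕ} (hi : i ≤ T.cols)
    (hu : T.node i u ≠ 0) (h1 : T.base i (T.node i u) ≤ p)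
    (h2 : p < T.base i (T.node i u) + T.cnt i (T.node i u)) :
    f p < T.rows ∧ T.Agree i u (f p) ∧ T.pos (f p) = p := by
  obtain ⟨j, hj, -, h3, -⟩ := exists_row hu
  rw [node_eq_path h3] at h1 h2
  obtain ⟨l, hl, h4, rfl⟩ := exists_pos_eq hi h1 h2
  obtain ⟨h5, h6⟩ := hf l hl
  refine ⟨h5, (path_eq_node_iff h5).1 ?_, ?_⟩
  · rw [node_eq_path h3, ← h4]
    exact path_eq_of_le h5 h6 hi
  · rw [pos, h6, pos]

theorem block_succ (hu : T.node (i + 1) u ≠ 0) :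
    T.base i (T.node i u) ≤ T.base (i + 1) (T.node (i + 1) u) ∧
      T.base (i + 1) (T.node (i + 1) u) + T.cnt (i + 1) (T.node (i + 1) u) ≤
        T.base i (T.node i u) + T.cnt i (T.node i u) := by
  obtain ⟨j, hj, -, h, -⟩ := exists_row hu
  rw [node_eq_path h, node_eq_path (h.mono (Nat.le_succ i))]
  exact base_succ_mem hj

theorem cnt_succ_le (hu : T.node (i + 1) u ≠ 0) :
    T.cnt (i + 1) (T.node (i + 1) u) ≤ T.cnt i (T.node i u) := by
  have := block_succ hu
  omega

end Table

/-! ### The potential -/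

/-- The part of a sampling problem that the programs may depend on: the numbers of attributes and
constraints, which attributes a constraint `(X, Y)` of a relation contains (`mem`, for `Y`) and
bounds (`act`, for `Y \ X`), the level at which `X` is complete (`lvl`), and where the relation is
found in the memory: register `rel` holds its size, and array `src` the values of an attribute. -/
structure Shape where
  k : ℕ
  n : ℕ
  mem : ℕ → ℕ → Bool
  act : ℕ → ℕ → Bool
  lvl : ℕ → ℕ
  rel : ℕ → ℕ
  src : ℕ → ℕ → ℕ

/-- A sampling problem: one table per constraint, and a strict upper bound for the logarithms of
the numbers of rows. A table contains `0` in the columns that do not belong to its constraint. -/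
structure Inst extends Shape where
  table : ℕ → Table
  lim : ℕ

namespace Inst

variable (I : Inst)

/-- The total number of rows of the tables. -/
def tot : ℕ := ∑ c ∈ Finset.range I.n, (I.table c).rows

/-- The conditions on a sampling problem. -/
structure Valid : Prop where
  cols : ∀ c < I.n, (I.table c).cols = I.k
  lvl_le_k : ∀ c < I.n, I.lvl c ≤ I.k
  lvl_le : ∀ c < I.n, ∀ i, I.act c i = true → I.lvl c ≤ i ∧ I.mem c i = true
  cover : ∀ i < I.k, ∃ c < I.n, I.act c i = true
  lim_eq : I.lim = Nat.log 2 I.tot + 1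

variable {I} in
theorem rows_le_tot {c : ℕ} (hc : c < I.n) : (I.table c).rows ≤ I.tot :=
  Finset.single_le_sum (f := fun c => (I.table c).rows) (fun _ _ => Nat.zero_le _)
    (Finset.mem_range.2 hc)

variable {I} in
theorem Valid.lim_pos (hI : I.Valid) : 0 < I.lim := by
  rw [hI.lim_eq]
  exact Nat.succ_pos _

variable {I} in
theorem Valid.log_lt (hI : I.Valid) (c : ℕ) (hc : c < I.n) :
    Nat.log 2 (I.table c).rows < I.lim := by
  rw [hI.lim_eq]
  exact Nat.lt_succ_of_le (Nat.log_mono_right (rows_le_tot hc))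

/-- The exponent of attribute `i` in the exponent vector number `x`. -/
def digit (x i : ℕ) : ℕ := x / I.lim ^ i % I.lim

/-- Exponents for the attributes that respect upper bounds `e` for the constraints. -/
def Feasible (h e : ℕ → ℕ) : Prop :=
  ∀ c < I.n, (∑ i ∈ Finset.range I.k, if I.act c i then h i else 0) ≤ e c

open Classical in
/-- The potential of a vector `e` of upper bounds: the maximum of `2 ^ ∑ h i` over the feasible
exponent vectors `h`, an integral version of the polymatroid bound. -/
noncomputable def potential (e : ℕ → ℕ) : ℕ :=
  (Finset.range (I.lim ^ I.k)).sup fun x =>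
    if I.Feasible (I.digit x) e then 2 ^ ∑ i ∈ Finset.range I.k, I.digit x i else 0

variable {I}

theorem digit_sum {n : ℕ} {e : ℕ → ℕ} (he : ∀ c < n, e c < I.lim) :
    (∑ c ∈ Finset.range n, e c * I.lim ^ c) < I.lim ^ n ∧
      ∀ c < n, I.digit (∑ c ∈ Finset.range n, e c * I.lim ^ c) c = e c := by
  let f : Fin n → Fin I.lim := fun i => ⟨e i, he i i.2⟩
  have h1 : (finFunctionFinEquiv f : ℕ) = ∑ c ∈ Finset.range n, e c * I.lim ^ c := by
    rw [finFunctionFinEquiv_apply, Finset.sum_range]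
  rw [← h1]
  refine ⟨(finFunctionFinEquiv f).2, fun i hi => ?_⟩
  have h2 := finFunctionFinEquiv_symm_apply_val (finFunctionFinEquiv f) ⟨i, hi⟩
  rw [Equiv.symm_apply_apply] at h2
  exact h2.symm

theorem exists_digit {h : ℕ → ℕ} (hh : ∀ i < I.k, h i < I.lim) :
    ∃ x < I.lim ^ I.k, ∀ i < I.k, I.digit x i = h i :=
  ⟨_, digit_sum hh⟩

theorem Feasible.congr {h h' e : ℕ → ℕ} (hf : I.Feasible h e) (hh : ∀ i < I.k, h' i = h i) :
    I.Feasible h' e := by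
  intro c hc
  refine le_trans (le_of_eq (Finset.sum_congr rfl fun i hi => ?_)) (hf c hc)
  rw [hh i (Finset.mem_range.1 hi)]

theorem Feasible.le (hI : I.Valid) {h e : ℕ → ℕ} (hf : I.Feasible h e) {i : ℕ} (hi : i < I.k) :
    ∃ c < I.n, I.act c i = true ∧ h i ≤ e c := by
  obtain ⟨c, hc, hci⟩ := hI.cover i hi
  refine ⟨c, hc, hci, le_trans ?_ (hf c hc)⟩
  refine le_trans (le_of_eq ?_) (Finset.single_le_sum
    (f := fun i => if I.act c i then h i else 0) (fun _ _ => Nat.zero_le _)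
    (Finset.mem_range.2 hi))
  rw [if_pos hci]

theorem le_potential (hI : I.Valid) {h e : ℕ → ℕ} (hf : I.Feasible h e)
    (he : ∀ c < I.n, e c < I.lim) : 2 ^ ∑ i ∈ Finset.range I.k, h i ≤ I.potential e := by
  classical
  obtain ⟨x, hx, hxh⟩ := exists_digit (I := I) (h := h) fun i hi => by
    obtain ⟨c, hc, -, h1⟩ := hf.le hI hi
    exact h1.trans_lt (he c hc)
  refine le_trans (le_of_eq ?_) (Finset.le_sup (f := fun x =>
    if I.Feasible (I.digit x) e then 2 ^ ∑ i ∈ Finset.range I.k, I.digit x i else 0)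
    (Finset.mem_range.2 hx))
  rw [if_pos (hf.congr hxh)]
  congr 1
  exact Finset.sum_congr rfl fun i hi => (hxh i (Finset.mem_range.1 hi)).symm

theorem exists_feasible (hI : I.Valid) (e : ℕ → ℕ) :
    ∃ h, I.Feasible h e ∧ (∀ i, h i < I.lim) ∧
      I.potential e = 2 ^ ∑ i ∈ Finset.range I.k, h i := by
  classical
  have hdig (x i : ℕ) : I.digit x i < I.lim := Nat.mod_lt _ hI.lim_pos
  have h0 : I.Feasible (I.digit 0) e := by
    intro c _
    refine le_trans (le_of_eq (Finset.sum_eq_zero fun i _ => ?_)) (Nat.zero_le _)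
    simp [digit]
  have hne : (Finset.range (I.lim ^ I.k)).Nonempty :=
    Finset.nonempty_range_iff.2 (pow_pos hI.lim_pos _).ne'
  obtain ⟨x, hx, hxe⟩ := Finset.exists_mem_eq_sup _ hne fun x =>
    if I.Feasible (I.digit x) e then 2 ^ ∑ i ∈ Finset.range I.k, I.digit x i else 0
  have hpot : I.potential e = if I.Feasible (I.digit x) e then
      2 ^ ∑ i ∈ Finset.range I.k, I.digit x i else 0 := hxe
  by_cases hf : I.Feasible (I.digit x) e
  · exact ⟨_, hf, hdig x, hpot.trans (if_pos hf)⟩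
  · rw [if_neg hf] at hpot
    have h1 := Finset.le_sup (f := fun x =>
      if I.Feasible (I.digit x) e then 2 ^ ∑ i ∈ Finset.range I.k, I.digit x i else 0)
      (Finset.mem_range.2 (pow_pos hI.lim_pos I.k))
    simp only [if_pos h0] at h1
    have h2 : 0 < 2 ^ ∑ i ∈ Finset.range I.k, I.digit 0 i := by positivity
    unfold potential at hpot
    omega

theorem potential_pos (hI : I.Valid) (e : ℕ → ℕ) : 0 < I.potential e := by
  obtain ⟨h, -, -, h1⟩ := exists_feasible hI e
  rw [h1]
  positivity

theorem potential_le (hI : I.Valid) (e : ℕ → ℕ) : I.potential e ≤ 2 ^ (I.k * I.lim) := by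
  obtain ⟨h, -, h1, h2⟩ := exists_feasible hI e
  rw [h2]
  refine Nat.pow_le_pow_right (by omega) ?_
  refine (Finset.sum_le_card_nsmul _ _ I.lim fun i _ => (h1 i).le).trans ?_
  simp

theorem potential_zero (hI : I.Valid) {e : ℕ → ℕ} (he : ∀ c < I.n, e c = 0) :
    I.potential e = 1 := by
  obtain ⟨h, hf, -, h2⟩ := exists_feasible hI e
  rw [h2, Finset.sum_eq_zero, pow_zero]
  intro i hi
  obtain ⟨c, hc, -, h3⟩ := hf.le hI (Finset.mem_range.1 hi)
  rw [he c hc] at h3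
  omega

theorem potential_congr {e e' : ℕ → ℕ} (h : ∀ c < I.n, e c = e' c) :
    I.potential e = I.potential e' := by
  have : ∀ d, I.Feasible d e ↔ I.Feasible d e' := fun d =>
    forall₂_congr fun c hc => by rw [h c hc]
  classical
  exact Finset.sup_congr rfl fun x _ => if_congr (this _) rfl rfl

/-- If the bounds of all constraints on attribute `i` drop by at least `d`, the potential drops
by a factor of at least `2 ^ d`: increase the exponent of attribute `i` in an optimal solution
by `d`. -/
theorem potential_mul_le (hI : I.Valid) {e e' : ℕ → ℕ} {d i : ℕ} (hi : i < I.k)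
    (he : ∀ c < I.n, e c < I.lim) (hle : ∀ c < I.n, e' c ≤ e c)
    (hd : ∀ c < I.n, I.act c i = true → e' c + d ≤ e c) :
    I.potential e' * 2 ^ d ≤ I.potential e := by
  obtain ⟨h, hf, -, h2⟩ := exists_feasible hI e'
  have hi' := Finset.mem_range.2 hi
  have hsplit (f : ℕ → ℕ) : ∑ x ∈ Finset.range I.k, (f x + if x = i then d else 0) =
      (∑ x ∈ Finset.range I.k, f x) + d := by
    rw [Finset.sum_add_distrib, Finset.sum_ite_eq' (Finset.range I.k) i, if_pos hi']
  have hf' : I.Feasible (fun x => h x + if x = i then d else 0) e := by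
    intro c hc
    by_cases hci : I.act c i = true
    · refine le_trans ?_ (hd c hc hci)
      refine le_trans ?_ (Nat.add_le_add_right (hf c hc) d)
      rw [← hsplit]
      refine Finset.sum_le_sum fun x _ => ?_
      dsimp only
      split_ifs <;> omega
    · refine le_trans (Finset.sum_le_sum fun x _ => ?_) ((hf c hc).trans (hle c hc))
      by_cases hx : x = i
      · subst hx; simp [hci]
      · simp [hx]
  rw [h2, ← pow_add, ← hsplit]
  exact le_potential hI hf' he

end Inst

/-! ### Codes of tuples -/

namespace Table

/-- The maximum number of leaves below a level `l` node. -/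
noncomputable def maxCnt (T : Table) (l : ℕ) : ℕ :=
  (Finset.range T.rows).sup fun j => T.cnt l (T.path l j)

theorem maxCnt_le {T : Table} {l : ℕ} : T.maxCnt l ≤ T.rows :=
  Finset.sup_le fun _ _ => cnt_le

theorem cnt_le_maxCnt {T : Table} {l : ℕ} {u : ℕ → ℕ} (h : T.node l u ≠ 0) :
    T.cnt l (T.node l u) ≤ T.maxCnt l := by
  obtain ⟨j, hj, h1, -, h2⟩ := exists_row h
  rw [h1, ← h2]
  exact Finset.le_sup (f := fun j => T.cnt l (T.path l j)) (Finset.mem_range.2 hj)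

end Table

namespace Inst

variable (I : Inst)

/-- The part of the tuple `u` that constraint `c` sees. -/
def view (c : ℕ) (u : ℕ → ℕ) (i : ℕ) : ℕ := if I.mem c i then u i else 0

/-- The node that `u` reaches in trie `c` at level `i`. -/
noncomputable def node (c i : ℕ) (u : ℕ → ℕ) : ℕ := (I.table c).node i (I.view c u)

/-- The number of tuples of table `c` that are compatible with the first `i` entries of `u`. -/
noncomputable def cnt (c i : ℕ) (u : ℕ → ℕ) : ℕ := (I.table c).cnt i (I.node c i u)

/-- The degree of constraint `(X, Y)` number `c` after the first `i` entries of `u` have been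
fixed: the number of compatible tuples over `Y` if `X` is fixed completely, and the maximum degree
before that. -/
noncomputable def deg (c i : ℕ) (u : ℕ → ℕ) : ℕ :=
  if I.lvl c ≤ i then I.cnt c i u else (I.table c).maxCnt (I.lvl c)

/-- The value of the potential after the first `i` entries of `u` have been fixed. -/
noncomputable def pot (i : ℕ) (u : ℕ → ℕ) : ℕ := I.potential fun c => Nat.log 2 (I.deg c i u)

/-- The number of codes for the completions of the first `i` entries of `u`. -/
noncomputable def weight (i : ℕ) (u : ℕ → ℕ) : ℕ := (2 * I.n) ^ (I.k - i) * I.pot i u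

/-- The number of codes per constraint for the completions of the first `i` entries of `u`. -/
noncomputable def share (i : ℕ) (u : ℕ → ℕ) : ℕ := 2 * (2 * I.n) ^ (I.k - (i + 1)) * I.pot i u

/-- The first `i` entries of `u` are compatible with all tables. -/
def Alive (i : ℕ) (u : ℕ → ℕ) : Prop := ∀ c < I.n, I.node c i u ≠ 0

/-- Constraint `c` bounds attribute `i`, and the number of codes per compatible tuple of table `c`
does not increase when `u i` is fixed. -/
def Test (c i : ℕ) (u : ℕ → ℕ) : Prop :=
  I.act c i = true ∧ I.weight (i + 1) u * I.deg c i u ≤ I.share i u * I.deg c (i + 1) u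

/-- The first constraint that passes the test. -/
def IsFirst (c i : ℕ) (u : ℕ → ℕ) : Prop := I.Test c i u ∧ ∀ c' < c, ¬ I.Test c' i u

/-- The first code that constraint `c` reserves for the value `u i` at level `i`: the block of
leaves below the child starts at a fraction of the block of the node, and the codes are split in
the same proportion. -/
noncomputable def first (c i : ℕ) (u : ℕ → ℕ) : ℕ :=
  (((I.table c).base (i + 1) (I.node c (i + 1) u) - (I.table c).base i (I.node c i u)) *
    I.share i u + I.cnt c i u - 1) / I.cnt c i u

variable {I} {c i x q : ℕ} {u v : ℕ → ℕ}

theorem view_congr (h : ∀ l < i, u l = v l) : ∀ l < i, I.view c u l = I.view c v l := by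
  intro l hl
  unfold view
  rw [h l hl]

theorem node_congr (h : ∀ l < i, u l = v l) : I.node c i u = I.node c i v :=
  Table.node_congr (view_congr h)

theorem cnt_congr (h : ∀ l < i, u l = v l) : I.cnt c i u = I.cnt c i v := by
  unfold cnt
  rw [node_congr h]

theorem deg_congr (h : ∀ l < i, u l = v l) : I.deg c i u = I.deg c i v := by
  unfold deg
  rw [cnt_congr h]

theorem pot_congr (h : ∀ l < i, u l = v l) : I.pot i u = I.pot i v :=
  potential_congr fun c _ => by rw [deg_congr h]

theorem weight_congr (h : ∀ l < i, u l = v l) : I.weight i u = I.weight i v := by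
  unfold weight
  rw [pot_congr h]

theorem share_congr (h : ∀ l < i, u l = v l) : I.share i u = I.share i v := by
  unfold share
  rw [pot_congr h]

theorem alive_congr (h : ∀ l < i, u l = v l) : I.Alive i u ↔ I.Alive i v :=
  forall₂_congr fun c _ => by rw [node_congr h]

theorem test_congr (h : ∀ l < i + 1, u l = v l) : I.Test c i u ↔ I.Test c i v := by
  have h' : ∀ l < i, u l = v l := fun l hl => h l (by omega)
  unfold Test
  rw [weight_congr h, deg_congr h', share_congr h', deg_congr h]

theorem isFirst_congr (h : ∀ l < i + 1, u l = v l) : I.IsFirst c i u ↔ I.IsFirst c i v :=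
  and_congr (test_congr h) (forall₂_congr fun _ _ => not_congr (test_congr h))

theorem first_congr (h : ∀ l < i + 1, u l = v l) : I.first c i u = I.first c i v := by
  have h' : ∀ l < i, u l = v l := fun l hl => h l (by omega)
  unfold first
  rw [node_congr h, node_congr h', share_congr h', cnt_congr h']

theorem Alive.of_succ (h : I.Alive (i + 1) u) : I.Alive i u :=
  fun c hc => Table.node_ne_zero_of_le (h c hc) (Nat.le_succ i)

theorem deg_le_rows : I.deg c i u ≤ (I.table c).rows := by
  unfold deg
  split_ifs
  exacts [Table.cnt_le, Table.maxCnt_le]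

theorem cnt_pos (hI : I.Valid) (hc : c < I.n) (hi : i ≤ I.k) (h : I.Alive i u) :
    0 < I.cnt c i u :=
  Table.cnt_node_pos (by rw [hI.cols c hc]; exact hi) (h c hc)

theorem deg_succ_le (hc : c < I.n) (h : I.Alive (i + 1) u) :
    I.deg c (i + 1) u ≤ I.deg c i u := by
  unfold deg
  split_ifs with h1 h2 h2
  · exact Table.cnt_succ_le (h c hc)
  · obtain h3 : I.lvl c = i + 1 := by omega
    rw [h3]
    exact Table.cnt_le_maxCnt (h c hc)
  · omega
  · exact le_rfl

theorem deg_act (hI : I.Valid) (hc : c < I.n) (h : I.act c i = true) :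
    I.deg c i u = I.cnt c i u ∧ I.deg c (i + 1) u = I.cnt c (i + 1) u := by
  have := (hI.lvl_le c hc i h).1
  exact ⟨if_pos this, if_pos (by omega)⟩

theorem log_deg_lt (hI : I.Valid) (hc : c < I.n) : Nat.log 2 (I.deg c i u) < I.lim :=
  (Nat.log_mono_right deg_le_rows).trans_lt (hI.log_lt c hc)

theorem pot_pos (hI : I.Valid) : 0 < I.pot i u := potential_pos hI _

theorem share_pos (hI : I.Valid) (hi : i < I.k) : 0 < I.share i u := by
  obtain ⟨c, hc, -⟩ := hI.cover i hi
  have := pot_pos (i := i) (u := u) hI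
  have : 0 < I.n := by omega
  unfold share
  positivity

theorem weight_eq (hi : i < I.k) : I.weight i u = I.share i u * I.n := by
  unfold weight share
  obtain ⟨d, hd⟩ : ∃ d, I.k = i + 1 + d := ⟨I.k - (i + 1), by omega⟩
  rw [show I.k - i = (I.k - (i + 1)) + 1 by omega, pow_succ]
  ring

theorem weight_pos (hI : I.Valid) : 0 < I.weight i u := by
  by_cases hi : i < I.k
  · obtain ⟨c, hc, -⟩ := hI.cover i hi
    have := share_pos (u := u) hI hi
    rw [weight_eq hi]
    have : 0 < I.n := by omega
    positivity
  · rw [weight, Nat.sub_eq_zero_of_le (by omega), pow_zero, one_mul]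
    exact pot_pos hI

/-- A complete tuple has exactly one code. -/
theorem weight_k (hI : I.Valid) (h : I.Alive I.k u) : I.weight I.k u = 1 := by
  rw [weight, Nat.sub_self, pow_zero, one_mul]
  refine potential_zero hI fun c hc => ?_
  obtain ⟨j, hj, h1, -, h2⟩ := Table.exists_row (h c hc)
  have h3 : I.cnt c I.k u = 1 := by
    have := Table.cnt_cols hj
    rw [hI.cols c hc] at this
    rw [cnt, node, h1, ← h2, this]
  rw [deg, if_pos (hI.lvl_le_k c hc), h3]
  simp

/-- If `u` is compatible with all tables, some constraint passes the test: one whose logarithmic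
degree drops least. -/
theorem exists_isFirst (hI : I.Valid) (hi : i < I.k) (h : I.Alive (i + 1) u) :
    ∃ c < I.n, I.IsFirst c i u := by
  classical
  suffices hex : ∃ c < I.n, I.Test c i u by
    obtain ⟨c, hc, ht⟩ := hex
    have hex : ∃ c, I.Test c i u := ⟨c, ht⟩
    exact ⟨Nat.find hex, (Nat.find_min' hex ht).trans_lt hc, Nat.find_spec hex,
      fun c' hc' => Nat.find_min hex hc'⟩
  set S := (Finset.range I.n).filter fun c => I.act c i = true with hS
  have hne : S.Nonempty := by
    obtain ⟨c, hc, hci⟩ := hI.cover i hi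
    exact ⟨c, by simp [hS, hc, hci]⟩
  have hmono : ∀ c < I.n, Nat.log 2 (I.deg c (i + 1) u) ≤ Nat.log 2 (I.deg c i u) :=
    fun c hc => Nat.log_mono_right (deg_succ_le hc h)
  obtain ⟨c, hcS, hmin⟩ := S.exists_min_image
    (fun c => Nat.log 2 (I.deg c i u) - Nat.log 2 (I.deg c (i + 1) u)) hne
  have hcS' := hcS
  simp only [hS, Finset.mem_filter, Finset.mem_range] at hcS'
  obtain ⟨hc, hci⟩ := hcS'
  refine ⟨c, hc, hci, ?_⟩
  set d := Nat.log 2 (I.deg c i u) - Nat.log 2 (I.deg c (i + 1) u) with hd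
  have hpot : I.pot (i + 1) u * 2 ^ d ≤ I.pot i u := by
    refine potential_mul_le hI hi (fun c hc => log_deg_lt hI hc) hmono fun c' hc' hci' => ?_
    have h1 := hmin c' (by simp [hS, hc', hci'])
    have h2 := hmono c' hc'
    omega
  have h1 : I.deg c i u ≤ 2 ^ (d + 1) * 2 ^ Nat.log 2 (I.deg c (i + 1) u) := by
    rw [← pow_add]
    refine (Nat.lt_pow_succ_log_self (by omega) _).le.trans (Nat.pow_le_pow_right (by omega) ?_)
    have := hmono c hc
    omega
  have h2 : 2 ^ Nat.log 2 (I.deg c (i + 1) u) ≤ I.deg c (i + 1) u := by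
    refine Nat.pow_log_le_self 2 ?_
    rw [(deg_act hI hc hci).2]
    exact (cnt_pos hI hc hi h).ne'
  unfold weight share
  calc _ ≤ (2 * I.n) ^ (I.k - (i + 1)) * I.pot (i + 1) u *
        (2 ^ (d + 1) * I.deg c (i + 1) u) :=
        Nat.mul_le_mul_left _ (h1.trans (Nat.mul_le_mul_left _ h2))
    _ = 2 * (2 * I.n) ^ (I.k - (i + 1)) * (I.pot (i + 1) u * 2 ^ d) * I.deg c (i + 1) u := by ring
    _ ≤ _ := Nat.mul_le_mul_right _ (Nat.mul_le_mul_left _ hpot)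

variable (I) in
open Classical in
/-- The code at level `i` of the completion of the first `i + 1` entries of `u` with code `x`. -/
noncomputable def back (i : ℕ) (u : ℕ → ℕ) (x : ℕ) : ℕ :=
  if h : ∃ c, I.IsFirst c i u then (x + I.first h.choose i u) * I.n + h.choose else 0

theorem isFirst_unique {c c' : ℕ} (h : I.IsFirst c i u) (h' : I.IsFirst c' i u) : c = c' := by
  rcases lt_trichotomy c c' with hc | hc | hc
  · exact absurd h.1 (h'.2 c hc)
  · exact hc
  · exact absurd h'.1 (h.2 c' hc)

theorem back_eq (h : I.IsFirst c i u) (x : ℕ) :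
    I.back i u x = (x + I.first c i u) * I.n + c := by
  have hex : ∃ c, I.IsFirst c i u := ⟨c, h⟩
  rw [back, dif_pos hex, isFirst_unique hex.choose_spec h]

theorem back_congr (h : ∀ l < i + 1, u l = v l) (x : ℕ) : I.back i u x = I.back i v x := by
  by_cases hex : ∃ c, I.IsFirst c i u
  · obtain ⟨c, hc⟩ := hex
    rw [back_eq hc, back_eq ((isFirst_congr h).1 hc), first_congr h]
  · have hex' : ¬ ∃ c, I.IsFirst c i v := fun ⟨c, hc⟩ => hex ⟨c, (isFirst_congr h).2 hc⟩
    rw [back, back, dif_neg hex, dif_neg hex']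

theorem le_ceil_mul {a d : ℕ} (hd : 0 < d) : a ≤ (a + d - 1) / d * d := by
  have := Nat.lt_div_mul_add hd (a := a + d - 1)
  omega

/-- The codes reserved for the child point to the leaves below the child. -/
theorem slot_mem (hI : I.Valid) (hi : i < I.k) (h : I.Alive (i + 1) u) (hc : c < I.n)
    (ht : I.Test c i u) (hx : x < I.weight (i + 1) u) :
    (I.table c).base (i + 1) (I.node c (i + 1) u) ≤ (I.table c).base i (I.node c i u) +
        (x + I.first c i u) * I.cnt c i u / I.share i u ∧
      (I.table c).base i (I.node c i u) + (x + I.first c i u) * I.cnt c i u / I.share i u <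
        (I.table c).base (i + 1) (I.node c (i + 1) u) + I.cnt c (i + 1) u ∧
      x + I.first c i u < I.share i u := by
  obtain ⟨hci, hle⟩ := ht
  rw [(deg_act hI hc hci).1, (deg_act hI hc hci).2] at hle
  obtain ⟨hb1, hb2⟩ := Table.block_succ (T := I.table c) (h c hc)
  change (I.table c).base i (I.node c i u) ≤ (I.table c).base (i + 1) (I.node c (i + 1) u) at hb1
  change (I.table c).base (i + 1) (I.node c (i + 1) u) + I.cnt c (i + 1) u ≤
    (I.table c).base i (I.node c i u) + I.cnt c i u at hb2
  have hD := cnt_pos hI hc hi.le h.of_succ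
  have hM := share_pos (u := u) hI hi
  unfold first
  set D := I.cnt c i u
  set D' := I.cnt c (i + 1) u
  set M := I.share i u
  set W := I.weight (i + 1) u
  set b := (I.table c).base i (I.node c i u)
  set b' := (I.table c).base (i + 1) (I.node c (i + 1) u)
  obtain ⟨st, hst⟩ : ∃ st, b' = b + st := ⟨b' - b, by omega⟩
  rw [hst, Nat.add_sub_cancel_left]
  set f := (st * M + D - 1) / D with hf
  have h1 : st * M ≤ f * D := le_ceil_mul hD
  have h2 : f * D ≤ st * M + D - 1 := Nat.div_mul_le_self _ _
  have h3 : (x + f) * D < (st + D') * M := by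
    have h4 : (x + 1) * D ≤ W * D := Nat.mul_le_mul_right _ hx
    have h5 : (st + D') * M = st * M + M * D' := by ring
    have h6 : (x + f) * D + D = (x + 1) * D + f * D := by ring
    omega
  refine ⟨?_, ?_, ?_⟩
  · refine Nat.add_le_add_left ((Nat.le_div_iff_mul_le hM).2 ?_) b
    rw [add_mul]
    omega
  · have := (Nat.div_lt_iff_lt_mul hM).2 h3
    omega
  · have h4 : (st + D') * M ≤ D * M := Nat.mul_le_mul_right _ (by omega)
    have h5 : (x + f) * D < M * D := by rw [mul_comm M]; omega
    exact lt_of_mul_lt_mul_right h5 (Nat.zero_le _)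

theorem back_lt (hI : I.Valid) (hi : i < I.k) (h : I.Alive (i + 1) u)
    (hx : x < I.weight (i + 1) u) : I.back i u x < I.weight i u := by
  obtain ⟨c, hc, hf⟩ := exists_isFirst hI hi h
  obtain ⟨-, -, h1⟩ := slot_mem hI hi h hc hf.1 hx
  rw [back_eq hf, weight_eq hi]
  calc _ < (x + I.first c i u) * I.n + I.n := by omega
    _ = (x + I.first c i u + 1) * I.n := by ring
    _ ≤ _ := Nat.mul_le_mul_right _ h1

/-- The arrays `leaf c` hold the leaves of the tries. -/
def LeafArrays (I : Inst) (leaf : ℕ → ℕ → ℕ) : Prop :=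
  ∀ c < I.n, (I.table c).IsLeafArray (leaf c)

variable (I) in
/-- The value that constraint `c` proposes at level `i` for quotient `q`. -/
noncomputable def proposal (leaf : ℕ → ℕ → ℕ) (c i : ℕ) (u : ℕ → ℕ) (q : ℕ) : ℕ :=
  (I.table c).val (leaf c ((I.table c).base i (I.node c i u) + q * I.cnt c i u / I.share i u)) i

theorem proposal_congr {leaf : ℕ → ℕ → ℕ} (h : ∀ l < i, u l = v l) :
    I.proposal leaf c i u q = I.proposal leaf c i v q := by
  unfold proposal
  rw [node_congr h, cnt_congr h, share_congr h]

/-- Decoding recovers the first constraint, the value and the remaining code. -/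
theorem decode_back (hI : I.Valid) {leaf : ℕ → ℕ → ℕ} (hleaf : I.LeafArrays leaf) (hi : i < I.k)
    (h : I.Alive (i + 1) u) (hx : x < I.weight (i + 1) u) :
    ∃ c < I.n, I.IsFirst c i u ∧ I.back i u x % I.n = c ∧
      I.back i u x / I.n = x + I.first c i u ∧
      I.proposal leaf c i u (I.back i u x / I.n) = u i := by
  obtain ⟨c, hc, hf⟩ := exists_isFirst hI hi h
  obtain ⟨h1, h2, -⟩ := slot_mem hI hi h hc hf.1 hx
  have h3 : I.back i u x % I.n = c := by
    rw [back_eq hf, add_comm, Nat.add_mul_mod_self_right, Nat.mod_eq_of_lt hc]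
  have h4 : I.back i u x / I.n = x + I.first c i u := by
    rw [back_eq hf, add_comm, Nat.add_mul_div_right _ _ (by omega), Nat.div_eq_of_lt hc, zero_add]
  refine ⟨c, hc, hf, h3, h4, ?_⟩
  have h5 := (hleaf c hc).agree (by rw [hI.cols c hc]; exact hi) (h c hc) h1 h2
  rw [proposal, h4, h5.2.1 i (Nat.lt_succ_self i), view, if_pos (hI.lvl_le c hc i hf.1.1).2]

/-- If the value proposed by the first constraint is compatible with all tables, the code of the
result is the given one. -/
theorem back_decode (hI : I.Valid) {leaf : ℕ → ℕ → ℕ} (hleaf : I.LeafArrays leaf) (hi : i < I.k)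
    (h : I.Alive (i + 1) u) (hx : x < I.weight i u) (hf : I.IsFirst (x % I.n) i u)
    (hu : I.proposal leaf (x % I.n) i u (x / I.n) = u i) :
    I.back i u (x / I.n - I.first (x % I.n) i u) = x := by
  have hn : 0 < I.n := by
    obtain ⟨c, hc, -⟩ := hI.cover i hi
    omega
  have hc := Nat.mod_lt x hn
  set c := x % I.n with hcdef
  set q := x / I.n with hq
  suffices hle : I.first c i u ≤ q by
    rw [back_eq hf, Nat.sub_add_cancel hle, hq, hcdef, Nat.div_add_mod']
  have hqM : q < I.share i u := by
    rw [hq, Nat.div_lt_iff_lt_mul hn, ← weight_eq hi]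
    exact hx
  have hM := share_pos (u := u) hI hi
  have hD := cnt_pos hI hc hi.le h.of_succ
  have hlt : q * I.cnt c i u / I.share i u < I.cnt c i u := by
    rw [Nat.div_lt_iff_lt_mul hM, mul_comm (I.cnt c i u)]
    exact Nat.mul_lt_mul_of_pos_right hqM hD
  have hik : i ≤ (I.table c).cols := by rw [hI.cols c hc]; exact hi.le
  have hik' : i + 1 ≤ (I.table c).cols := by rw [hI.cols c hc]; exact hi
  obtain ⟨h1, h2, h3⟩ := (hleaf c hc).agree (u := I.view c u)
    (p := (I.table c).base i (I.node c i u) + q * I.cnt c i u / I.share i u) hik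
    (h.of_succ c hc) (Nat.le_add_right _ _) (Nat.add_lt_add_left hlt _)
  set l := leaf c ((I.table c).base i (I.node c i u) + q * I.cnt c i u / I.share i u) with hl
  have h4 : (I.table c).Agree (i + 1) (I.view c u) l := by
    intro y hy
    rcases Nat.lt_succ_iff_lt_or_eq.1 hy with hy | rfl
    · exact h2 y hy
    · rw [view, if_pos (hI.lvl_le c hc y hf.1.1).2, ← hu, proposal]
  have h5 := (Table.pos_mem hik' h1).1
  rw [h3, ← Table.node_eq_path h4] at h5
  change (I.table c).base (i + 1) (I.node c (i + 1) u) ≤ _ at h5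
  unfold first
  set st := (I.table c).base (i + 1) (I.node c (i + 1) u) - (I.table c).base i (I.node c i u)
  have h6 : st ≤ q * I.cnt c i u / I.share i u := tsub_le_iff_left.2 h5
  rw [Nat.le_div_iff_mul_le hM] at h6
  rw [← Nat.lt_succ_iff, Nat.div_lt_iff_lt_mul hD, Nat.succ_mul]
  omega

variable (I) in
/-- The code of the completion of the first `i` entries of `u` with code `x`. -/
noncomputable def encode : ℕ → (ℕ → ℕ) → ℕ → ℕ
  | 0, _, x => x
  | i + 1, u, x => encode i u (I.back i u x)

theorem encode_congr (h : ∀ l < i, u l = v l) (x : ℕ) : I.encode i u x = I.encode i v x := by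
  induction i generalizing x with
  | zero => rfl
  | succ i ih =>
    rw [encode, encode, back_congr h, ih fun l hl => h l (by omega)]

theorem encode_lt (hI : I.Valid) (hi : i ≤ I.k) (h : I.Alive i u) (hx : x < I.weight i u) :
    I.encode i u x < I.weight 0 u := by
  induction i generalizing x with
  | zero => exact hx
  | succ i ih => exact ih (by omega) h.of_succ (back_lt hI hi h hx)

theorem encode_injective (hI : I.Valid) {leaf : ℕ → ℕ → ℕ} (hleaf : I.LeafArrays leaf)
    {y : ℕ} (hi : i ≤ I.k) (hu : I.Alive i u) (hv : I.Alive i v) (hx : x < I.weight i u)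
    (hy : y < I.weight i v) (h : I.encode i u x = I.encode i v y) :
    (∀ l < i, u l = v l) ∧ x = y := by
  induction i generalizing x y with
  | zero => exact ⟨fun l hl => by omega, h⟩
  | succ i ih =>
    obtain ⟨h1, h2⟩ := ih (by omega) hu.of_succ hv.of_succ (back_lt hI hi hu hx)
      (back_lt hI hi hv hy) h
    obtain ⟨c, hc, hf, h3, h4, h5⟩ := decode_back hI hleaf hi hu hx
    obtain ⟨c', hc', hf', h3', h4', h5'⟩ := decode_back hI hleaf hi hv hy
    rw [h2] at h3 h4 h5
    obtain rfl : c = c' := h3.symm.trans h3'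
    rw [proposal_congr h1] at h5
    have h6 : ∀ l < i + 1, u l = v l := by
      intro l hl
      rcases Nat.lt_succ_iff_lt_or_eq.1 hl with hl | rfl
      exacts [h1 l hl, h5.symm.trans h5']
    refine ⟨h6, ?_⟩
    rw [first_congr h6] at h4
    omega

end Inst

/-! ### Preprocessing programs -/

/-- The loop counter. -/
def Expr.ctr : Expr := Expr.var .ctr

namespace Shape

open JoinSampling.Expr

variable (S : Shape)

/-- The number of rows of table `c`. -/
def rowsE (c : ℕ) : Expr := var (.siz (S.rel c))

/-- The entry of the current row of table `c` in column `i`. -/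
def entryE (c i : ℕ) : Expr := if S.mem c i then load (.inp (S.src c i)) ctr else const 0

/-- The address of the child of the level `i` node `a` of trie `c` for the value `v`. -/
def keyE (c i : ℕ) (a v : Expr) : Expr := a * (S.rowsE c + const 1) + load (.val c i) v

/-- Put all rows below the root of trie `c`. -/
def rootCmd (c : ℕ) : Cmd := .loop (S.rowsE c) (.asg (.path c 0) ctr (const 1))

/-- Extend trie `c` from level `i` to level `i + 1`. -/
def levelCmd (c i : ℕ) : Cmd :=
  let v := S.entryE c i
  let key := S.keyE c i (load (.path c i) ctr) v
  .loop (S.rowsE c) <|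
    .seq (.asg (.val c i) v
      (load (.val c i) v + eq (load (.val c i) v) (const 0) * (ctr + const 1))) <|
    .seq (.asg (.child c i) key
      (load (.child c i) key + eq (load (.child c i) key) (const 0) * (ctr + const 1))) <|
    .asg (.path c (i + 1)) ctr (load (.child c i) key)

/-- Count the leaves below the level `i` nodes of trie `c`. -/
def cntCmd (c i : ℕ) : Cmd :=
  let a := load (.path c i) ctr
  .loop (S.rowsE c) <|
    .asg (.cnt c i) a (load (.cnt c i) a + eq (load (.path c S.k) ctr) (ctr + const 1))

/-- Compute the maximum number of leaves below a node at level `lvl c`. -/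
def maxdegCmd (c : ℕ) : Cmd :=
  .loop (S.rowsE c) <| .setVar (.maxdeg c) <| var (.maxdeg c) +
    (load (.cnt c (S.lvl c)) (load (.path c (S.lvl c)) ctr) - var (.maxdeg c))

/-- Place the blocks of the level `i + 1` nodes of trie `c`. The position that is computed for a
row that is not the first one of its class is not used. -/
def baseCmd (c i : ℕ) : Cmd :=
  let a := load (.path c i) ctr
  .loop (S.rowsE c) <|
    .seq (.asg (.base c (i + 1)) (ctr + const 1) (load (.base c i) a + load (.used c i) a)) <|
    .asg (.used c i) a (load (.used c i) a +
      eq (load (.path c (i + 1)) ctr) (ctr + const 1) * load (.cnt c (i + 1)) (ctr + const 1))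

/-- Record a row for each leaf of trie `c`. -/
def leafCmd (c : ℕ) : Cmd :=
  .loop (S.rowsE c) <| .asg (.leaf c) (load (.base c S.k) (load (.path c S.k) ctr)) ctr

/-- Build trie `c`. -/
def trieCmd (c : ℕ) : Cmd :=
  .seq (S.rootCmd c) <| .seq (.each S.k (S.levelCmd c)) <| .seq (.each (S.k + 1) (S.cntCmd c)) <|
    .seq (S.maxdegCmd c) <| .seq (.each S.k (S.baseCmd c)) (S.leafCmd c)

end Shape

namespace Inst

variable (I : Inst)

/-- The intended contents of the arrays that are prepared for sampling. -/
def Spec : Name → (ℕ → ℕ) → Prop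
  | .tot, f => f 0 = I.tot
  | .log, f => ∀ x ≤ I.tot, f x = Nat.log 2 x
  | .lim, f => f 0 = I.lim
  | .pow, f => ∀ x ≤ I.k * I.lim, f x = 2 ^ x
  | .tab, f => ∀ e : ℕ → ℕ, (∀ c < I.n, e c < I.lim) →
      f (∑ c ∈ Finset.range I.n, e c * I.lim ^ c) = I.potential e
  | .val c i, f => ∀ v, f v = (I.table c).dict i v
  | .child c i, f => ∀ a, f a = firstIdx (fun j => (I.table c).key i ((I.table c).path i j)
      ((I.table c).val j i) = a) (I.table c).rows
  | .path c i, f => ∀ j < (I.table c).rows, f j = (I.table c).path i j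
  | .cnt c i, f => ∀ a, f a = (I.table c).cnt i a
  | .base c i, f => ∀ j < (I.table c).rows, f (j + 1) = (I.table c).base i (j + 1)
  | .leaf c, f => (I.table c).IsLeafArray f
  | .maxdeg c, f => f 0 = (I.table c).maxCnt (I.lvl c)
  | .node i, f => i = 0 → ∀ c < I.n, ∀ u, f c = I.node c 0 u
  | .deg i, f => i = 0 → ∀ c < I.n, ∀ u, f c = I.deg c 0 u
  | .pot i, f => i = 0 → ∀ u, f 0 = I.pot 0 u
  | .ok i, f => i = 0 → ∀ u, f 0 ≤ 1 ∧ (f 0 = 1 ↔ I.Alive 0 u)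
  | .codes, f => ∀ u, f 0 = I.weight 0 u
  | _, _ => True

/-- The arrays in `D` have been prepared, and the others contain what they contained in `M₀`. -/
def Progress (M₀ : Mem) (D : Set Name) (M : Mem) : Prop :=
  (∀ A ∈ D, I.Spec A (M A)) ∧ ∀ A ∉ D, A ≠ .ctr → M A = M₀ A

/-- The memory contains the tables, and nothing else. -/
structure Initial (M₀ : Mem) : Prop where
  rows : ∀ c < I.n, M₀ (.siz (I.rel c)) 0 = (I.table c).rows
  val : ∀ c < I.n, ∀ i < I.k, ∀ j < (I.table c).rows, (I.table c).val j i =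
    if I.mem c i then M₀ (.inp (I.src c i)) j else 0
  zero : ∀ A, (∀ a, A ≠ .inp a) → (∀ r, A ≠ .siz r) → ∀ j, M₀ A j = 0

/-- `B` bounds all numbers that the programs compute, and `N` the numbers of iterations of the
loops. -/
structure Bounds (B N : ℕ) : Prop where
  tot : (I.k + 1) * I.tot + 2 ≤ B
  codes : (2 * I.n) ^ I.k * 2 ^ (I.k * I.lim) ≤ B
  pow : 2 ^ (I.k * I.lim) ≤ B
  size : I.lim ^ (I.n + I.k) ≤ B
  tot' : I.tot + 1 ≤ N
  size' : I.lim ^ (I.n + I.k) ≤ N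
  lim' : I.k * I.lim ≤ N

variable {I} {M₀ M : Mem} {D : Set Name} {B N : ℕ}

theorem Progress.extend {W : Set Name} {M' : Mem} (h : I.Progress M₀ D M)
    (hM : ∀ A ∉ W, A ≠ .ctr → M' A = M A)
    (hctr : .ctr ∉ D) (hs : ∀ A ∈ W, I.Spec A (M' A)) : I.Progress M₀ (D ∪ W) M' := by
  classical
  refine ⟨fun A hA => ?_, fun A hA hc => ?_⟩
  · by_cases hAW : A ∈ W
    · exact hs A hAW
    · have hAD : A ∈ D := hA.resolve_right hAW
      rw [hM A hAW fun h => hctr (h ▸ hAD)]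
      exact h.1 A hAD
  · rw [Set.mem_union, not_or] at hA
    rw [hM A hA.2 hc, h.2 A hA.1 hc]

theorem Bounds.rows_lt (hB : I.Bounds B N) {c : ℕ} (hc : c < I.n) :
    (I.table c).rows + 2 ≤ B ∧ (I.table c).rows ≤ N := by
  have h1 := rows_le_tot hc
  have h2 := hB.tot
  have h3 := hB.tot'
  constructor
  · nlinarith [I.k.zero_le]
  · omega

/-- The arrays that are given. -/
def Given (D : Set Name) : Prop := (∀ a, .inp a ∉ D) ∧ (∀ r, .siz r ∉ D) ∧ .ctr ∉ D

theorem firstIdx_eq_of_lt {p : ℕ → Prop} {j s : ℕ} (hj : j < s) (h : p j) :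
    firstIdx p s = firstIdx p (j + 1) := by
  induction s with
  | zero => omega
  | succ s ih =>
    rcases Nat.lt_succ_iff_lt_or_eq.1 hj with hjs | rfl
    · have h1 := firstIdx_ne_zero hjs h
      rw [← ih hjs, firstIdx, if_pos h1]
    · rfl

/-- The update of a dictionary that maps keys to the first rows with these keys. -/
theorem firstIdx_update {f g : ℕ → ℕ} {j : ℕ} (hf : ∀ a, f a = firstIdx (fun j => g j = a) j)
    (a : ℕ) :
    (if a = g j then f (g j) + (if f (g j) = 0 then 1 else 0) * (j + 1) else f a) =
      firstIdx (fun j => g j = a) (j + 1) := by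
  rw [firstIdx, hf, hf]
  by_cases ha : a = g j
  · subst ha
    by_cases h0 : firstIdx (fun j' => g j' = g j) j = 0 <;> simp [h0]
  · simp only [if_neg ha, if_neg (Ne.symm ha)]
    split_ifs with h0
    · rfl
    · omega

theorem entryE_eval (hI₀ : I.Initial M₀) {c i j : ℕ} (hc : c < I.n) (hi : i < I.k)
    (hj : j < (I.table c).rows) {M' : Mem} (h1 : M' .ctr 0 = j)
    (h2 : ∀ a, M' (.inp a) = M₀ (.inp a)) : (I.entryE c i).eval M' = (I.table c).val j i := by
  rw [hI₀.val c hc i hi j hj, Shape.entryE]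
  split_ifs
  · simp [Expr.ctr, h1, h2]
  · rfl

theorem level_ensures (hI₀ : I.Initial M₀) (hB : I.Bounds B N) (hD : Given D)
    {c i : ℕ} (hc : c < I.n) (hi : i < I.k) (hM : M.Small B) (h : I.Progress M₀ D M)
    (h1 : .path c i ∈ D) (h2 : .val c i ∉ D) (h3 : .child c i ∉ D) :
    (I.levelCmd c i).Ensures B N M
      (I.Progress M₀ (D ∪ {.val c i, .child c i, .path c (i + 1)})) := by
  have hrows : M (.siz (I.rel c)) 0 = (I.table c).rows := by
    rw [h.2 _ (hD.2.1 _) (by simp), hI₀.rows c hc]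
  have hpath : ∀ j < (I.table c).rows, M (.path c i) j = (I.table c).path i j := h.1 _ h1
  have hentry := @entryE_eval I M₀ hI₀ c i
  obtain ⟨hB1, hN1⟩ := hB.rows_lt hc
  set T := I.table c with hT
  let Inv : ℕ → Mem → Prop := fun j M' =>
    (∀ A ∉ ({.val c i, .child c i, .path c (i + 1)} : Set Name), A ≠ .ctr → M' A = M A) ∧
    (∀ v, M' (.val c i) v = firstIdx (fun j => T.val j i = v) j) ∧
    (∀ a, M' (.child c i) a = firstIdx (fun j => T.key i (T.path i j) (T.val j i) = a) j) ∧
    ∀ j' < j, M' (.path c (i + 1)) j' = T.path (i + 1) j'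
  refine (Cmd.Ensures.loop Inv hM (n := T.rows) ?_ hN1 (by omega) ?_ ?_).mono ?_
  · simpa [Shape.rowsE] using hrows
  · refine ⟨fun _ _ _ => rfl, fun v => ?_, fun a => ?_, fun j' hj' => by omega⟩
    · rw [h.2 _ h2 (by simp), hI₀.zero _ (by simp) (by simp)]; rfl
    · rw [h.2 _ h3 (by simp), hI₀.zero _ (by simp) (by simp)]; rfl
  · rintro j hj M' hM' ⟨i1, i2, i3, i4⟩
    have e1 : M' (.siz (I.rel c)) 0 = T.rows := by rw [i1 _ (by simp) (by simp), hrows]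
    have e2 : M' (.path c i) j = T.path i j := by rw [i1 _ (by simp) (by simp), hpath j hj]
    have e3 : ∀ a, M' (.inp a) = M₀ (.inp a) := fun a => by
      rw [i1 _ (by simp) (by simp), h.2 _ (hD.1 _) (by simp)]
    have e4 := fun M' => hentry (M' := M') hc hi hj
    have e5 := firstIdx_update i2
    have e6 := firstIdx_update i3
    have e7 := e5 (T.val j i)
    rw [if_pos rfl, ← firstIdx_eq_of_lt (p := fun j' => T.val j' i = T.val j i) hj rfl] at e7
    change _ = T.dict i (T.val j i) at e7
    have e8 := e6 (T.key i (T.path i j) (T.val j i))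
    rw [if_pos rfl, ← firstIdx_eq_of_lt (p := fun j' => T.key i (T.path i j') (T.val j' i) =
      T.key i (T.path i j) (T.val j i)) hj rfl] at e8
    change _ = firstIdx (fun j' => T.key i (T.path i j') (T.val j' i) =
      T.key i (T.node i (T.val j)) (T.val j i)) T.rows at e8
    rw [Table.firstIdx_key] at e8
    change M' _ (T.key i (T.path i j) _) + (if M' _ (T.key i (T.path i j) _) = 0 then _ else _) * _ =
      T.path (i + 1) j at e8
    simp only [e7] at e5
    simp only [e8] at e6
    have e9 : T.path i j * (T.rows + 1) + T.dict i (T.val j i) = T.key i (T.path i j) (T.val j i) :=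
      rfl
    have e10 : T.dict i (T.val j i) ≤ T.rows := Table.dict_le
    have e11 : T.path (i + 1) j ≤ T.rows := Table.path_le
    simp only [Stmt.run, Stmt.Keeps, Shape.keyE, Shape.rowsE, Expr.eval_load, Expr.eval_add,
      Expr.eval_mul, Expr.eval_const, Expr.eval_eq, Expr.eval_var, Expr.ctr, Mem.set_apply, e4,
      Mem.set_of_ne, e3, ne_eq, reduceCtorEq, not_false_eq_true, implies_true, e2, e1, and_self,
      false_and, and_true, if_true, if_false, e7, e8, e9]
    refine ⟨⟨.inr (by omega), .inr (by omega), .inr (by omega)⟩, fun A hA hA' => ?_, fun v => ?_,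
      fun a => ?_, fun j' hj' => ?_⟩
    · simp only [Set.mem_insert_iff, Set.mem_singleton_iff, not_or] at hA
      rw [Mem.set_of_ne _ _ _ hA.2.2, Mem.set_of_ne _ _ _ hA.2.1, Mem.set_of_ne _ _ _ hA.1,
        Mem.set_of_ne _ _ _ hA', i1 A (by simp [hA]) hA']
    · rw [← e5 v]
      simp [Mem.set_apply]
    · rw [← e6 a]
      simp [Mem.set_apply]
    · by_cases hjj : j' = j
      · simp [Mem.set_apply, hjj]
      · simp [Mem.set_apply, hjj, i4 j' (by omega)]
  · rintro M' ⟨i1, i2, i3, i4⟩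
    refine h.extend i1 hD.2.2 ?_
    · rintro A (rfl | rfl | rfl)
      exacts [i2, i3, i4]

theorem root_ensures (hI₀ : I.Initial M₀) (hB : I.Bounds B N) (hD : Given D)
    {c : ℕ} (hc : c < I.n) (hM : M.Small B) (h : I.Progress M₀ D M) (h1 : .base c 0 ∉ D) :
    (I.rootCmd c).Ensures B N M (I.Progress M₀ (D ∪ {.path c 0, .base c 0})) := by
  have hrows : M (.siz (I.rel c)) 0 = (I.table c).rows := by
    rw [h.2 _ (hD.2.1 _) (by simp), hI₀.rows c hc]
  obtain ⟨hB1, hN1⟩ := hB.rows_lt hc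
  set T := I.table c with hT
  let Inv : ℕ → Mem → Prop := fun j M' =>
    (∀ A ∉ ({.path c 0} : Set Name), A ≠ .ctr → M' A = M A) ∧
    ∀ j' < j, M' (.path c 0) j' = T.path 0 j'
  refine (Cmd.Ensures.loop Inv hM (n := T.rows) ?_ hN1 (by omega) ?_ ?_).mono ?_
  · simpa [Shape.rowsE] using hrows
  · exact ⟨fun _ _ _ => rfl, fun j' hj' => by omega⟩
  · rintro j hj M' hM' ⟨i1, i2⟩
    simp only [Stmt.run, Stmt.Keeps, Expr.eval_const, Expr.eval_var, Expr.ctr, Mem.set_apply,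
      and_self, if_true]
    refine ⟨.inr (by omega), fun A hA hA' => ?_, fun j' hj' => ?_⟩
    · rw [Mem.set_of_ne _ _ _ hA, Mem.set_of_ne _ _ _ hA', i1 A hA hA']
    · have : T.path 0 j' = 1 := Table.node_zero (by omega)
      by_cases hjj : j' = j
      · simp [Mem.set_apply, hjj, ← this]
      · simp [Mem.set_apply, hjj, i2 j' (by omega)]
  · rintro M' ⟨i1, i2⟩
    refine h.extend (fun A hA => i1 A (fun h => hA (.inl h))) hD.2.2 ?_
    · rintro A (rfl | rfl)
      · exact i2
      · intro j _
        rw [i1 _ (by simp) (by simp), h.2 _ h1 (by simp), hI₀.zero _ (by simp) (by simp)]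
        rfl

theorem cnt_ensures (hI : I.Valid) (hI₀ : I.Initial M₀) (hB : I.Bounds B N) (hD : Given D)
    {c i : ℕ} (hc : c < I.n) (hM : M.Small B) (h : I.Progress M₀ D M)
    (h1 : .path c i ∈ D) (h2 : .path c I.k ∈ D) (h3 : .cnt c i ∉ D) :
    (I.cntCmd c i).Ensures B N M (I.Progress M₀ (D ∪ {.cnt c i})) := by
  classical
  have hrows : M (.siz (I.rel c)) 0 = (I.table c).rows := by
    rw [h.2 _ (hD.2.1 _) (by simp), hI₀.rows c hc]
  have hpath : ∀ j < (I.table c).rows, M (.path c i) j = (I.table c).path i j := h.1 _ h1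
  have hpath' : ∀ j < (I.table c).rows, M (.path c I.k) j = (I.table c).path I.k j := h.1 _ h2
  obtain ⟨hB1, hN1⟩ := hB.rows_lt hc
  have hcols := hI.cols c hc
  set T := I.table c with hT
  let Inv : ℕ → Mem → Prop := fun j M' =>
    (∀ A ∉ ({.cnt c i} : Set Name), A ≠ .ctr → M' A = M A) ∧
    ∀ a, M' (.cnt c i) a = ∑ j ∈ Finset.range j,
      if T.path T.cols j = j + 1 ∧ T.path i j = a then 1 else 0
  refine (Cmd.Ensures.loop Inv hM (n := T.rows) ?_ hN1 (by omega) ?_ ?_).mono ?_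
  · simpa [Shape.rowsE] using hrows
  · refine ⟨fun _ _ _ => rfl, fun a => ?_⟩
    rw [h.2 _ h3 (by simp), hI₀.zero _ (by simp) (by simp)]; rfl
  · rintro j hj M' hM' ⟨i1, i2⟩
    have e1 : M' (.path c i) j = T.path i j := by rw [i1 _ (by simp) (by simp), hpath j hj]
    have e2 : M' (.path c I.k) j = T.path I.k j := by rw [i1 _ (by simp) (by simp), hpath' j hj]
    have hle : M' (.cnt c i) (T.path i j) ≤ j := by
      rw [i2]
      refine (Finset.sum_le_card_nsmul _ _ 1 fun _ _ => ?_).trans (by simp)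
      split_ifs <;> simp
    simp only [Stmt.run, Stmt.Keeps, Expr.eval_const, Expr.eval_var, Expr.ctr, Mem.set_apply,
      and_self, if_true, Expr.eval_load, Expr.eval_add, Expr.eval_eq, reduceCtorEq, false_and,
      if_false, e1, e2]
    refine ⟨.inr ?_, fun A hA hA' => ?_, fun a => ?_⟩
    · split_ifs <;> omega
    · rw [Mem.set_of_ne _ _ _ hA, Mem.set_of_ne _ _ _ hA', i1 A hA hA']
    · rw [Finset.sum_range_succ, ← i2, hcols]
      by_cases ha : a = T.path i j
      · simp [Mem.set_apply, ha]
      · simp [Mem.set_apply, ha, Ne.symm ha]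
  · rintro M' ⟨i1, i2⟩
    refine h.extend i1 hD.2.2 ?_
    · rintro A rfl
      exact i2

theorem maxdeg_ensures (hI₀ : I.Initial M₀) (hB : I.Bounds B N) (hD : Given D)
    {c : ℕ} (hc : c < I.n) (hM : M.Small B) (h : I.Progress M₀ D M)
    (h1 : .path c (I.lvl c) ∈ D) (h2 : .cnt c (I.lvl c) ∈ D) (h3 : .maxdeg c ∉ D) :
    (I.maxdegCmd c).Ensures B N M (I.Progress M₀ (D ∪ {.maxdeg c})) := by
  have hrows : M (.siz (I.rel c)) 0 = (I.table c).rows := by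
    rw [h.2 _ (hD.2.1 _) (by simp), hI₀.rows c hc]
  have hpath : ∀ j < (I.table c).rows, M (.path c (I.lvl c)) j = (I.table c).path (I.lvl c) j :=
    h.1 _ h1
  have hcnt : ∀ a, M (.cnt c (I.lvl c)) a = (I.table c).cnt (I.lvl c) a := h.1 _ h2
  obtain ⟨hB1, hN1⟩ := hB.rows_lt hc
  set T := I.table c with hT
  let Inv : ℕ → Mem → Prop := fun j M' =>
    (∀ A ∉ ({.maxdeg c} : Set Name), A ≠ .ctr → M' A = M A) ∧
    M' (.maxdeg c) 0 = (Finset.range j).sup fun j => T.cnt (I.lvl c) (T.path (I.lvl c) j)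
  refine (Cmd.Ensures.loop Inv hM (n := T.rows) ?_ hN1 (by omega) ?_ ?_).mono ?_
  · simpa [Shape.rowsE] using hrows
  · refine ⟨fun _ _ _ => rfl, ?_⟩
    rw [h.2 _ h3 (by simp), hI₀.zero _ (by simp) (by simp)]; rfl
  · rintro j hj M' hM' ⟨i1, i2⟩
    have e1 : M' (.path c (I.lvl c)) j = T.path (I.lvl c) j := by
      rw [i1 _ (by simp) (by simp), hpath j hj]
    have e2 : ∀ a, M' (.cnt c (I.lvl c)) a = T.cnt (I.lvl c) a := fun a => by
      rw [i1 _ (by simp) (by simp), hcnt a]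
    have e3 : T.cnt (I.lvl c) (T.path (I.lvl c) j) ≤ T.rows := Table.cnt_le
    have e4 := hM' (.maxdeg c) rfl 0
    simp only [Stmt.run, Stmt.Keeps, Expr.eval_const, Expr.eval_var, Expr.ctr, Mem.set_apply,
      and_self, if_true, Expr.eval_load, Expr.eval_add, Expr.eval_sub, reduceCtorEq, false_and,
      if_false, e1, e2, Stmt.setVar]
    refine ⟨.inr (by omega), fun A hA hA' => ?_, ?_⟩
    · rw [Mem.set_of_ne _ _ _ hA, Mem.set_of_ne _ _ _ hA', i1 A hA hA']
    · rw [Finset.range_add_one, Finset.sup_insert, ← i2]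
      simp only [Mem.set_apply, and_self, if_true]
      omega
  · rintro M' ⟨i1, i2⟩
    refine h.extend i1 hD.2.2 ?_
    · rintro A rfl
      exact i2

theorem base_ensures (hI : I.Valid) (hI₀ : I.Initial M₀) (hB : I.Bounds B N) (hD : Given D)
    {c i : ℕ} (hc : c < I.n) (hi : i < I.k) (hM : M.Small B) (h : I.Progress M₀ D M)
    (h1 : .path c i ∈ D) (h2 : .path c (i + 1) ∈ D) (h3 : .cnt c (i + 1) ∈ D) (h4 : .base c i ∈ D)
    (h5 : .used c i ∉ D) :
    (I.baseCmd c i).Ensures B N M (I.Progress M₀ (D ∪ {.base c (i + 1), .used c i})) := by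
  classical
  have hrows : M (.siz (I.rel c)) 0 = (I.table c).rows := by
    rw [h.2 _ (hD.2.1 _) (by simp), hI₀.rows c hc]
  have hpath : ∀ j < (I.table c).rows, M (.path c i) j = (I.table c).path i j := h.1 _ h1
  have hpath' : ∀ j < (I.table c).rows, M (.path c (i + 1)) j = (I.table c).path (i + 1) j :=
    h.1 _ h2
  have hcnt : ∀ a, M (.cnt c (i + 1)) a = (I.table c).cnt (i + 1) a := h.1 _ h3
  have hbase : ∀ j < (I.table c).rows, M (.base c i) (j + 1) = (I.table c).base i (j + 1) :=
    h.1 _ h4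
  obtain ⟨hB1, hN1⟩ := hB.rows_lt hc
  have hB2 : (I.k + 1) * (I.table c).rows ≤ B :=
    (Nat.mul_le_mul_left _ (rows_le_tot hc)).trans (by have := hB.tot; omega)
  have hcols := hI.cols c hc
  set T := I.table c with hT
  let Inv : ℕ → Mem → Prop := fun j M' =>
    (∀ A ∉ ({.base c (i + 1), .used c i} : Set Name), A ≠ .ctr → M' A = M A) ∧
    (∀ j' < j, M' (.base c (i + 1)) (j' + 1) = T.base (i + 1) (j' + 1)) ∧
    ∀ a, M' (.used c i) a = T.used i j a
  refine (Cmd.Ensures.loop Inv hM (n := T.rows) ?_ hN1 (by omega) ?_ ?_).mono ?_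
  · simpa [Shape.rowsE] using hrows
  · refine ⟨fun _ _ _ => rfl, fun j' hj' => by omega, fun a => ?_⟩
    rw [h.2 _ h5 (by simp), hI₀.zero _ (by simp) (by simp)]; rfl
  · rintro j hj M' hM' ⟨i1, i2, i3⟩
    have e1 : M' (.path c i) j = T.path i j := by rw [i1 _ (by simp) (by simp), hpath j hj]
    have e2 : M' (.path c (i + 1)) j = T.path (i + 1) j := by
      rw [i1 _ (by simp) (by simp), hpath' j hj]
    have e3 : ∀ a, M' (.cnt c (i + 1)) a = T.cnt (i + 1) a := fun a => by
      rw [i1 _ (by simp) (by simp), hcnt a]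
    have e4 : M' (.base c i) (T.path i j) = T.base i (T.path i j) := by
      rw [i1 _ (by simp) (by simp)]
      obtain ⟨j0, hj0, h7, -⟩ := Table.exists_first i hj
      rw [h7, hbase j0 hj0]
    have e5 : T.base (i + 1) (j + 1) = T.base i (T.path i j) + T.used i j (T.path i j) := rfl
    have e6 : T.base (i + 1) (j + 1) ≤ B := by
      refine (Table.base_le (by omega)).trans (le_trans ?_ hB2)
      exact Nat.mul_le_mul_right _ (by omega)
    have e7 : T.used i (j + 1) (T.path i j) ≤ T.rows :=
      (Table.used_le (by omega)).trans Table.cnt_le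
    have e8 : ∀ a, T.used i (j + 1) a = T.used i j a +
        if T.path (i + 1) j = j + 1 ∧ T.path i j = a then T.cnt (i + 1) (j + 1) else 0 :=
      fun a => Finset.sum_range_succ _ _
    have e9 := e8 (T.path i j)
    simp only [and_true] at e9
    simp only [Stmt.run, Stmt.Keeps, Expr.eval_const, Expr.eval_var, Expr.ctr, Mem.set_apply,
      and_self, if_true, Expr.eval_load, Expr.eval_add, Expr.eval_eq, reduceCtorEq, false_and,
      if_false, e1, e2, e3, e4, i3, Expr.eval_mul, ite_mul, one_mul, zero_mul, ← e5, ← e9,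
      Nat.left_eq_add, one_ne_zero]
    refine ⟨⟨.inr e6, .inr (by omega)⟩, fun A hA hA' => ?_, fun j' hj' => ?_, fun a => ?_⟩
    · simp only [Set.mem_insert_iff, Set.mem_singleton_iff, not_or] at hA
      rw [Mem.set_of_ne _ _ _ hA.2, Mem.set_of_ne _ _ _ hA.1, Mem.set_of_ne _ _ _ hA',
        i1 A (by simp [hA]) hA']
    · by_cases hjj : j' = j
      · simp [Mem.set_apply, hjj]
      · simp [Mem.set_apply, hjj, i2 j' (by omega)]
    · rw [e8 a]
      by_cases ha : a = T.path i j
      · simp [Mem.set_apply, ha, e9]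
      · simp [Mem.set_apply, ha, Ne.symm ha, i3]
  · rintro M' ⟨i1, i2, i3⟩
    refine h.extend i1 hD.2.2 ?_
    · rintro A (rfl | rfl)
      exacts [i2, trivial]

theorem leaf_ensures (hI : I.Valid) (hI₀ : I.Initial M₀) (hB : I.Bounds B N) (hD : Given D)
    {c : ℕ} (hc : c < I.n) (hM : M.Small B) (h : I.Progress M₀ D M)
    (h1 : .path c I.k ∈ D) (h2 : .base c I.k ∈ D) :
    (I.leafCmd c).Ensures B N M (I.Progress M₀ (D ∪ {.leaf c})) := by
  have hrows : M (.siz (I.rel c)) 0 = (I.table c).rows := by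
    rw [h.2 _ (hD.2.1 _) (by simp), hI₀.rows c hc]
  have hpath : ∀ j < (I.table c).rows, M (.path c I.k) j = (I.table c).path I.k j := h.1 _ h1
  have hbase : ∀ j < (I.table c).rows, M (.base c I.k) (j + 1) = (I.table c).base I.k (j + 1) :=
    h.1 _ h2
  obtain ⟨hB1, hN1⟩ := hB.rows_lt hc
  have hcols := hI.cols c hc
  set T := I.table c with hT
  let Inv : ℕ → Mem → Prop := fun j M' =>
    (∀ A ∉ ({.leaf c} : Set Name), A ≠ .ctr → M' A = M A) ∧
    ∀ j' < j, M' (.leaf c) (T.pos j') < T.rows ∧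
      T.path T.cols (M' (.leaf c) (T.pos j')) = T.path T.cols j'
  refine (Cmd.Ensures.loop Inv hM (n := T.rows) ?_ hN1 (by omega) ?_ ?_).mono ?_
  · simpa [Shape.rowsE] using hrows
  · exact ⟨fun _ _ _ => rfl, fun j' hj' => by omega⟩
  · rintro j hj M' hM' ⟨i1, i2⟩
    have e1 : M' (.path c I.k) j = T.path I.k j := by rw [i1 _ (by simp) (by simp), hpath j hj]
    have e2 : M' (.base c I.k) (T.path I.k j) = T.pos j := by
      rw [i1 _ (by simp) (by simp), Table.pos, hcols]
      obtain ⟨j0, hj0, h7, -⟩ := Table.exists_first I.k hj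
      rw [h7, hbase j0 hj0]
    simp only [Stmt.run, Stmt.Keeps, Expr.eval_var, Expr.ctr, Mem.set_apply,
      and_self, if_true, Expr.eval_load, reduceCtorEq, false_and, if_false, e1, e2]
    refine ⟨.inr (by omega), fun A hA hA' => ?_, fun j' hj' => ?_⟩
    · rw [Mem.set_of_ne _ _ _ hA, Mem.set_of_ne _ _ _ hA', i1 A hA hA']
    · by_cases hp : T.pos j' = T.pos j
      · have := Table.path_eq_of_pos_eq (by omega) hj hp
        simp [Mem.set_apply, hp, hj, this]
      · have hjj : j' ≠ j := fun h => hp (by rw [h])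
        simpa [Mem.set_apply, hp] using i2 j' (by omega)
  · rintro M' ⟨i1, i2⟩
    refine h.extend i1 hD.2.2 ?_
    · rintro A rfl; exact i2

end Inst

/-! ### The table of the potential and the root of the decoding -/

theorem Stmt.run_each_asg {A : Name} {e : ℕ → Expr} {n : ℕ} {M : Mem} {B : ℕ}
    (he : ∀ c < n, ∀ f, (e c).eval (Function.update M A f) = (e c).eval M)
    (hB : A.IsVal = true ∨ ∀ c < n, (e c).eval M ≤ B) :
    (each n fun c => asg A (.const c) (e c)).Keeps B M ∧
      (each n fun c => asg A (.const c) (e c)).run M =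
        Function.update M A fun j => if j < n then (e j).eval M else M A j := by
  induction n with
  | zero =>
    refine ⟨trivial, ?_⟩
    simp [each, run]
  | succ n ih =>
    obtain ⟨h1, h2⟩ := ih (fun c hc => he c (by omega)) (hB.imp_right fun h c hc => h c (by omega))
    have h3 := he n (by omega) fun j => if j < n then (e j).eval M else M A j
    rw [keeps_each, run_each_succ, h2]
    refine ⟨⟨h1, ?_⟩, ?_⟩
    · simp only [Keeps, h3]
      exact hB.imp_right fun h => h n (by omega)
    · simp only [run, h3, Mem.set, Expr.eval_const, Function.update_idem, Function.update_self]
      congr 1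
      funext j
      by_cases hj : j = n
      · simp [hj]
      · rw [Function.update_of_ne hj]
        have : j < n ↔ j < n + 1 := by omega
        simp [this]

namespace Shape

open JoinSampling.Expr

variable (S : Shape)

/-- The power of `lim` with exponent `j`. -/
def limPow (j : ℕ) : Expr := prod j fun _ => var .lim

/-- Digit number `i` of the value of `x` to the base `lim`. -/
def digitE (x : Expr) (i : ℕ) : Expr := x / limPow i % var .lim

/-- Whether the digits of `x` are feasible exponents for the bounds given by the digits of `y`. -/
def feasE (x y : Expr) : Expr := prod S.n fun c =>
  le (sum S.k fun i => if S.act c i then digitE x i else const 0) (digitE y c)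

/-- Compute the input size. -/
def totCmd : Cmd := .stmt <| .setVar .tot <| sum S.n S.rowsE

/-- Tabulate the binary logarithm. -/
def logCmd : Cmd := .loop (var .tot + const 1) <|
  .asg .log ctr (lt (const 1) ctr * (load .log (ctr / const 2) + const 1))

/-- Compute the bound for the logarithms. -/
def limCmd : Cmd := .stmt <| .setVar .lim <| load .log (var .tot) + const 1

/-- Tabulate the powers of two. -/
def powCmd : Cmd := .seq (.stmt <| .setVar .pow (const 1)) <|
  .loop (const S.k * var .lim) (.asg .pow (ctr + const 1) (const 2 * load .pow ctr))

/-- Tabulate the potential by going through all exponent vectors for all vectors of bounds. -/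
def tabCmd : Cmd :=
  let x := ctr % limPow S.k
  let y := ctr / limPow S.k
  .loop (limPow (S.n + S.k)) <| .asg .tab y <| load .tab y +
    (S.feasE x y * load .pow (sum S.k (digitE x)) - load .tab y)

/-- The degree of constraint `c` at level `i`. -/
def degE (i c : ℕ) : Expr :=
  if S.lvl c ≤ i then load (.cnt c i) (load (.node i) (const c)) else var (.maxdeg c)

/-- The potential at level `i`. -/
def potE (i : ℕ) : Expr :=
  load .tab <| sum S.n fun c => load .log (load (.deg i) (const c)) * limPow c

/-- Prepare the top level for the decoding of tuples. -/
def topCmd : Cmd :=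
  .seq (.stmt <| .each S.n fun c => .asg (.node 0) (const c) (lt (const 0) (S.rowsE c))) <|
  .seq (.stmt <| .each S.n fun c => .asg (.deg 0) (const c) (S.degE 0 c)) <|
  .seq (.stmt <| .setVar (.pot 0) (S.potE 0)) <|
  .seq (.stmt <| .setVar (.ok 0) <| prod S.n fun c => lt (const 0) (load (.node 0) (const c))) <|
  .stmt <| .setVar .codes (const ((2 * S.n) ^ S.k) * var (.pot 0))

/-- The preprocessing program. -/
def preCmd : Cmd :=
  .seq (.each S.n S.trieCmd) <| .seq S.totCmd <| .seq logCmd <| .seq limCmd <| .seq S.powCmd <|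
    .seq S.tabCmd S.topCmd

end Shape

/-- The union of the sets `W i` for `i < m`. -/
def upTo (W : ℕ → Set Name) (m : ℕ) : Set Name := {A | ∃ i < m, A ∈ W i}

theorem union_upTo_succ (D : Set Name) (W : ℕ → Set Name) (m : ℕ) :
    D ∪ upTo W m ∪ W m = D ∪ upTo W (m + 1) := by
  ext A
  simp only [upTo, Set.mem_union, Set.mem_ofPred_eq, Nat.lt_succ_iff_lt_or_eq]
  constructor
  · rintro ((h | ⟨i, hi, h⟩) | h)
    exacts [.inl h, .inr ⟨i, .inl hi, h⟩, .inr ⟨m, .inr rfl, h⟩]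
  · rintro (h | ⟨i, hi | rfl, h⟩)
    exacts [.inl (.inl h), .inl (.inr ⟨i, hi, h⟩), .inr h]

/-- The trie to which the array belongs. -/
def Name.owner : Name → Option ℕ
  | .val c _ | .child c _ | .path c _ | .cnt c _ | .used c _ | .base c _ | .leaf c | .maxdeg c =>
    some c
  | _ => none

namespace Inst

variable (I : Inst)

/-- The arrays of trie `c`. -/
def trieNames (c : ℕ) : Set Name :=
  {.path c 0, .base c 0} ∪ upTo (fun i => {.val c i, .child c i, .path c (i + 1)}) I.k ∪
    upTo (fun i => {.cnt c i}) (I.k + 1) ∪ {.maxdeg c} ∪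
    upTo (fun i => {.base c (i + 1), .used c i}) I.k ∪ {.leaf c}

variable {I} {M₀ M : Mem} {D : Set Name} {B N : ℕ}

theorem owner_of_mem_trieNames {c : ℕ} {A : Name} (h : A ∈ I.trieNames c) : A.owner = some c := by
  simp only [trieNames, upTo, Set.mem_union, Set.mem_ofPred_eq, Set.mem_insert_iff,
    Set.mem_singleton_iff] at h
  rcases h with (((((rfl | rfl) | ⟨i, -, rfl | rfl | rfl⟩) | ⟨i, -, rfl⟩) | rfl) | ⟨i, -, rfl | rfl⟩) | rfl <;> rfl

theorem each_ensures {n : ℕ} {f : ℕ → Cmd} (W : ℕ → Set Name) (hM : M.Small B)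
    (h : I.Progress M₀ D M) (hstep : ∀ i < n, ∀ M', M'.Small B →
      I.Progress M₀ (D ∪ upTo W i) M' → (f i).Ensures B N M' (I.Progress M₀ (D ∪ upTo W i ∪ W i))) :
    (Cmd.each n f).Ensures B N M (I.Progress M₀ (D ∪ upTo W n)) := by
  refine Cmd.Ensures.each (fun i => I.Progress M₀ (D ∪ upTo W i)) hM ?_ fun i hi M' hM' h' => ?_
  · simpa [upTo] using h
  · rw [← union_upTo_succ]
    exact hstep i hi M' hM' h'

theorem trie_ensures (hI : I.Valid) (hI₀ : I.Initial M₀) (hB : I.Bounds B N) (hD : Given D)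
    {c : ℕ} (hc : c < I.n) (hM : M.Small B) (h : I.Progress M₀ D M)
    (hfresh : ∀ A ∈ D, A.owner ≠ some c) :
    (I.trieCmd c).Ensures B N M (I.Progress M₀ (D ∪ I.trieNames c)) := by
  have hnot : ∀ A : Name, A.owner = some c → A ∉ D := fun A hA hAD => hfresh A hAD hA
  have hval : ∀ i, .val c i ∉ D := fun i => hnot _ rfl
  have hchild : ∀ i, .child c i ∉ D := fun i => hnot _ rfl
  have hcnt : ∀ i, .cnt c i ∉ D := fun i => hnot _ rfl
  have hused : ∀ i, .used c i ∉ D := fun i => hnot _ rfl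
  have hbase : ∀ i, .base c i ∉ D := fun i => hnot _ rfl
  have hmax : .maxdeg c ∉ D := hnot _ rfl
  obtain ⟨hD1, hD2, hD3⟩ := hD
  have hlk := hI.lvl_le_k c hc
  have hpath : ∀ i ≤ I.k, i = 0 ∨ ∃ l < I.k, i = l + 1 := by
    intro i hi
    rcases i with - | i
    exacts [.inl rfl, .inr ⟨i, hi, rfl⟩]
  unfold trieNames
  simp only [← Set.union_assoc]
  refine (root_ensures hI₀ hB ⟨hD1, hD2, hD3⟩ hc hM h (hbase 0)).seq fun M hM h => ?_
  refine (each_ensures (fun i => {.val c i, .child c i, .path c (i + 1)}) hM h fun i hi M hM h => ?_).seq fun M hM h => ?_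
  · refine level_ensures hI₀ hB ?_ hc hi hM h ?_ ?_ ?_
    · simp [Given, upTo, hD1, hD2, hD3]
    · rcases hpath i hi.le with rfl | ⟨l, hl, rfl⟩ <;> simp [upTo]
    · simp [upTo, hval]
    · simp [upTo, hchild]
  refine (each_ensures (fun i => {.cnt c i}) hM h fun i hi M hM h => ?_).seq fun M hM h => ?_
  · refine cnt_ensures hI hI₀ hB ?_ hc hM h ?_ ?_ ?_
    · simp [Given, upTo, hD1, hD2, hD3]
    · rcases hpath i (by omega) with rfl | ⟨l, hl, rfl⟩ <;> simp [upTo, *]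
    · rcases hpath I.k le_rfl with h0 | ⟨l, hl, h0⟩ <;> simp [upTo, h0]
    · simp [upTo, hcnt]
  refine (maxdeg_ensures hI₀ hB ?_ hc hM h ?_ ?_ ?_).seq fun M hM h => ?_
  · simp [Given, upTo, hD1, hD2, hD3]
  · rcases hpath _ hlk with h0 | ⟨l, hl, h0⟩
    · simp [upTo, h0]
    · simp [upTo, h0, hl]
  · simp [upTo, hlk]
  · simp [upTo, hmax]
  refine (each_ensures (fun i => {.base c (i + 1), .used c i}) hM h fun i hi M hM h => ?_).seq fun M hM h => ?_
  · refine base_ensures hI hI₀ hB ?_ hc hi hM h ?_ ?_ ?_ ?_ ?_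
    · simp [Given, upTo, hD1, hD2, hD3]
    · rcases hpath i hi.le with rfl | ⟨l, hl, rfl⟩ <;> simp [upTo, *]
    · simp [upTo, hi]
    · simp [upTo, hi]
    · rcases hpath i hi.le with rfl | ⟨l, hl, rfl⟩ <;> simp [upTo]
    · simp [upTo, hused]
  refine leaf_ensures hI hI₀ hB ?_ hc hM h ?_ ?_
  · simp [Given, upTo, hD1, hD2, hD3]
  · rcases hpath I.k le_rfl with h0 | ⟨l, hl, h0⟩ <;> simp [upTo, h0]
  · rcases hpath I.k le_rfl with h0 | ⟨l, hl, h0⟩ <;> simp [upTo, h0]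

theorem tries_ensures (hI : I.Valid) (hI₀ : I.Initial M₀) (hB : I.Bounds B N) (hM : M₀.Small B) :
    (Cmd.each I.n I.trieCmd).Ensures B N M₀ (I.Progress M₀ (upTo I.trieNames I.n)) := by
  have howner : ∀ c, ∀ A ∈ upTo I.trieNames c, ∃ c' < c, A.owner = some c' :=
    fun c A ⟨c', hc', hA⟩ => ⟨c', hc', owner_of_mem_trieNames hA⟩
  rw [← Set.empty_union (upTo I.trieNames I.n)]
  refine each_ensures _ hM ⟨fun _ h => h.elim, fun _ _ _ => rfl⟩ fun c hc M hM h => ?_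
  rw [Set.empty_union] at h ⊢
  refine trie_ensures hI hI₀ hB ⟨fun a ha => ?_, fun r hr => ?_, fun hd => ?_⟩
    hc hM h fun A hA hAc => ?_
  · obtain ⟨_, _, h⟩ := howner c _ ha; exact absurd h (by simp [Name.owner])
  · obtain ⟨_, _, h⟩ := howner c _ hr; exact absurd h (by simp [Name.owner])
  · obtain ⟨_, _, h⟩ := howner c _ hd; exact absurd h (by simp [Name.owner])
  · obtain ⟨c', hc', h⟩ := howner c _ hA
    rw [hAc, Option.some_inj] at h
    omega

theorem rows_of_progress (hI₀ : I.Initial M₀) (hD : Given D) (h : I.Progress M₀ D M) {c : ℕ}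
    (hc : c < I.n) : (I.rowsE c).eval M = (I.table c).rows := by
  rw [Shape.rowsE, Expr.eval_var, h.2 _ (hD.2.1 _) (by simp), hI₀.rows c hc]

theorem setVar_ensures {A : Name} {e : Expr} (hM : M.Small B) (h : I.Progress M₀ D M)
    (hctr : .ctr ∉ D) (hB : e.eval M ≤ B) (hs : ∀ f : ℕ → ℕ, f 0 = e.eval M → I.Spec A f) :
    (Cmd.stmt (.setVar A e)).Ensures B N M (I.Progress M₀ (D ∪ {A})) := by
  refine .stmt hM (.inr hB) (h.extend (fun A' hA' _ => Mem.set_of_ne _ _ _ hA') hctr ?_)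
  rintro A' rfl
  change I.Spec A' ((M.set A' 0 (e.eval M)) A')
  exact hs _ (by simp [Mem.set_apply])

theorem tot_ensures (hI₀ : I.Initial M₀) (hB : I.Bounds B N) (hD : Given D) (hM : M.Small B)
    (h : I.Progress M₀ D M) : I.totCmd.Ensures B N M (I.Progress M₀ (D ∪ {.tot})) := by
  have he : (Expr.sum I.n I.rowsE).eval M = I.tot := by
    rw [Expr.eval_sum]
    exact Finset.sum_congr rfl fun c hc => rows_of_progress hI₀ hD h (Finset.mem_range.1 hc)
  refine setVar_ensures hM h hD.2.2 ?_ fun f hf => hf.trans he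
  have := hB.tot
  rw [he]
  nlinarith [I.k.zero_le]

theorem log_ensures (hB : I.Bounds B N) (hD : Given D) (hM : M.Small B)
    (h : I.Progress M₀ D M) (h1 : .tot ∈ D) :
    Shape.logCmd.Ensures B N M (I.Progress M₀ (D ∪ {.log})) := by
  have htot : M .tot 0 = I.tot := h.1 _ h1
  have hB1 : I.tot + 2 ≤ B := by have := hB.tot; nlinarith [I.k.zero_le]
  let Inv : ℕ → Mem → Prop := fun j M' =>
    (∀ A ∉ ({.log} : Set Name), A ≠ .ctr → M' A = M A) ∧
    ∀ x < j, M' .log x = Nat.log 2 x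
  refine (Cmd.Ensures.loop Inv hM (n := I.tot + 1) ?_ hB.tot' (by omega) ?_ ?_).mono ?_
  · simp [htot]
  · exact ⟨fun _ _ _ => rfl, fun j' hj' => by omega⟩
  · rintro j hj M' hM' ⟨i1, i2⟩
    have e1 : (if 1 < j then 1 else 0) * (M' .log (j / 2) + 1) = Nat.log 2 j := by
      split_ifs with hj1
      · rw [i2 _ (by omega), Nat.log_div_base, one_mul]
        have := Nat.log_pos (b := 2) (n := j) (by omega) (by omega)
        omega
      · rw [Nat.log_of_lt (by omega), zero_mul]
    have e2 : Nat.log 2 j ≤ j := Nat.log_le_self 2 j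
    simp only [Stmt.run, Stmt.Keeps, Expr.eval_const, Expr.eval_var, Expr.ctr, Mem.set_apply,
      and_self, if_true, Expr.eval_load, Expr.eval_add, Expr.eval_mul, Expr.eval_div, Expr.eval_lt,
      reduceCtorEq, false_and, if_false, e1]
    refine ⟨.inr (by omega), fun A hA hA' => ?_, fun j' hj' => ?_⟩
    · rw [Mem.set_of_ne _ _ _ hA, Mem.set_of_ne _ _ _ hA', i1 A hA hA']
    · by_cases hjj : j' = j
      · simp [Mem.set_apply, hjj]
      · simp [Mem.set_apply, hjj, i2 j' (by omega)]
  · rintro M' ⟨i1, i2⟩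
    refine h.extend i1 hD.2.2 ?_
    rintro A rfl x hx
    exact i2 x (by omega)

theorem lim_ensures (hI : I.Valid) (hB : I.Bounds B N) (hD : Given D) (hM : M.Small B)
    (h : I.Progress M₀ D M) (h1 : .tot ∈ D) (h2 : .log ∈ D) :
    Shape.limCmd.Ensures B N M (I.Progress M₀ (D ∪ {.lim})) := by
  have htot : M .tot 0 = I.tot := h.1 _ h1
  have hlog : M .log I.tot = Nat.log 2 I.tot := h.1 _ h2 I.tot le_rfl
  have hB1 : I.tot + 2 ≤ B := by have := hB.tot; nlinarith [I.k.zero_le]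
  refine setVar_ensures hM h hD.2.2 ?_ fun f hf => ?_
  · have := Nat.log_le_self 2 I.tot
    simp only [Expr.eval_add, Expr.eval_load, Expr.eval_var, Expr.eval_const, htot, hlog]
    omega
  · refine hf.trans ?_
    simp [htot, hlog, hI.lim_eq]

theorem pow_ensures (hB : I.Bounds B N) (hD : Given D) (hM : M.Small B)
    (h : I.Progress M₀ D M) (h1 : .lim ∈ D) :
    I.powCmd.Ensures B N M (I.Progress M₀ (D ∪ {.pow})) := by
  have hB1 := hB.pow
  have hB2 := Nat.lt_two_pow_self (n := I.k * I.lim)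
  refine Cmd.Ensures.seq (Q := fun M' => (∀ A ∉ ({.pow} : Set Name), A ≠ .ctr → M' A = M A) ∧
    M' .pow 0 = 1) (.stmt hM (.inr ?_) ⟨fun A hA _ => ?_, ?_⟩) fun M₁ hM₁ h₁ => ?_
  · simp only [Expr.eval_const]; omega
  · exact Mem.set_of_ne _ _ _ hA
  · simp [Stmt.setVar, Stmt.run, Mem.set_apply]
  have hlim : M₁ .lim 0 = I.lim := (congrFun (h₁.1 _ (by simp) (by simp)) 0).trans (h.1 _ h1)
  let Inv : ℕ → Mem → Prop := fun j M' =>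
    (∀ A ∉ ({.pow} : Set Name), A ≠ .ctr → M' A = M A) ∧
    ∀ x ≤ j, M' .pow x = 2 ^ x
  refine (Cmd.Ensures.loop Inv hM₁ (n := I.k * I.lim) ?_ hB.lim' (by omega) ?_ ?_).mono ?_
  · simp [hlim]
  · refine ⟨h₁.1, fun x hx => ?_⟩
    obtain rfl : x = 0 := by omega
    exact h₁.2
  · rintro j hj M' hM' ⟨i1, i2⟩
    have e1 : 2 ^ (j + 1) ≤ B := (Nat.pow_le_pow_right (by omega) (by omega)).trans hB1
    rw [pow_succ'] at e1
    simp only [Stmt.run, Stmt.Keeps, Expr.eval_const, Expr.eval_var, Expr.ctr, Mem.set_apply,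
      and_self, if_true, Expr.eval_load, Expr.eval_add, Expr.eval_mul,
      reduceCtorEq, false_and, if_false, i2 j le_rfl]
    refine ⟨.inr e1, fun A hA hA' => ?_, fun j' hj' => ?_⟩
    · rw [Mem.set_of_ne _ _ _ hA, Mem.set_of_ne _ _ _ hA', i1 A hA hA']
    · by_cases hjj : j' = j + 1
      · simp [Mem.set_apply, hjj, pow_succ']
      · simp [Mem.set_apply, hjj, i2 j' (by omega)]
  · rintro M' ⟨i1, i2⟩
    refine h.extend i1 hD.2.2 ?_
    rintro A rfl x hx
    exact i2 x hx

open Classical in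
/-- The candidate for the potential that iteration `x` of the computation of the table
considers. -/
noncomputable def tabTerm (I : Inst) (x : ℕ) : ℕ :=
  if I.Feasible (I.digit (x % I.lim ^ I.k)) (I.digit (x / I.lim ^ I.k)) then
    2 ^ ∑ i ∈ Finset.range I.k, I.digit (x % I.lim ^ I.k) i else 0

theorem sum_digit_le (hI : I.Valid) (x : ℕ) :
    ∑ i ∈ Finset.range I.k, I.digit x i ≤ I.k * I.lim := by
  refine (Finset.sum_le_card_nsmul _ _ I.lim fun i _ => (Nat.mod_lt _ hI.lim_pos).le).trans ?_
  simp

/-- The maximum of the candidates for a vector of bounds is the potential of this vector. -/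
theorem sup_tabTerm (hI : I.Valid) {e : ℕ → ℕ} (he : ∀ c < I.n, e c < I.lim) :
    ((Finset.range (I.lim ^ (I.n + I.k))).sup fun x =>
      if x / I.lim ^ I.k = ∑ c ∈ Finset.range I.n, e c * I.lim ^ c then I.tabTerm x else 0) =
      I.potential e := by
  classical
  obtain ⟨h1, h2⟩ := digit_sum (I := I) he
  set E := ∑ c ∈ Finset.range I.n, e c * I.lim ^ c
  have hL := pow_pos hI.lim_pos I.k
  have hf : ∀ h, I.Feasible h (I.digit E) ↔ I.Feasible h e := fun h =>
    forall₂_congr fun c hc => by rw [h2 c hc]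
  refine le_antisymm (Finset.sup_le fun x _ => ?_) (Finset.sup_le fun y hy => ?_)
  · split_ifs with hx
    · rw [tabTerm, hx]
      refine le_trans (le_of_eq ?_) (Finset.le_sup (Finset.mem_range.2 (Nat.mod_lt x hL)))
      exact if_congr (hf _) rfl rfl
    · exact Nat.zero_le _
  · have hy' := Finset.mem_range.1 hy
    have h3 : (E * I.lim ^ I.k + y) / I.lim ^ I.k = E := by
      rw [mul_comm, Nat.mul_add_div hL, Nat.div_eq_of_lt hy', add_zero]
    have h4 : (E * I.lim ^ I.k + y) % I.lim ^ I.k = y := by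
      rw [mul_comm, Nat.mul_add_mod, Nat.mod_eq_of_lt hy']
    have h5 : E * I.lim ^ I.k + y < I.lim ^ (I.n + I.k) := by
      rw [pow_add]
      calc _ < (E + 1) * I.lim ^ I.k := by rw [Nat.succ_mul]; omega
        _ ≤ _ := Nat.mul_le_mul_right _ h1
    refine le_trans (le_of_eq ?_) (Finset.le_sup (Finset.mem_range.2 h5))
    rw [if_pos h3, tabTerm, h3, h4]
    exact if_congr (hf _).symm rfl rfl

theorem eval_limPow (h : M .lim 0 = I.lim) (j : ℕ) : (Shape.limPow j).eval M = I.lim ^ j := by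
  simp [Shape.limPow, h]

theorem eval_digitE (h : M .lim 0 = I.lim) (x : Expr) (i : ℕ) :
    (Shape.digitE x i).eval M = I.digit (x.eval M) i := by
  simp [Shape.digitE, eval_limPow h, h, digit]

open Classical in
theorem eval_feasE (h : M .lim 0 = I.lim) (x y : Expr) :
    (I.feasE x y).eval M = if I.Feasible (I.digit (x.eval M)) (I.digit (y.eval M)) then 1 else 0 := by
  have h1 : ∀ c i, (if I.act c i then Shape.digitE x i else .const 0).eval M =
      if I.act c i then I.digit (x.eval M) i else 0 := by
    intro c i
    split_ifs
    exacts [eval_digitE h x i, rfl]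
  simp only [Shape.feasE, Expr.eval_prod, Expr.eval_le, Expr.eval_sum, eval_digitE h, h1,
    Finset.prod_boole, Finset.mem_range, Feasible]
  congr

theorem tab_ensures (hI : I.Valid) (hI₀ : I.Initial M₀) (hB : I.Bounds B N) (hD : Given D)
    (hM : M.Small B) (h : I.Progress M₀ D M) (h1 : .lim ∈ D) (h2 : .pow ∈ D) (h3 : .tab ∉ D) :
    I.tabCmd.Ensures B N M (I.Progress M₀ (D ∪ {.tab})) := by
  classical
  have hlim : M .lim 0 = I.lim := h.1 _ h1
  have hpow : ∀ x ≤ I.k * I.lim, M .pow x = 2 ^ x := h.1 _ h2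
  let Inv : ℕ → Mem → Prop := fun j M' =>
    (∀ A ∉ ({.tab} : Set Name), A ≠ .ctr → M' A = M A) ∧
    ∀ a, M' .tab a = (Finset.range j).sup fun x =>
      if x / I.lim ^ I.k = a then I.tabTerm x else 0
  refine (Cmd.Ensures.loop Inv hM (n := I.lim ^ (I.n + I.k)) ?_ hB.size' hB.size ?_ ?_).mono ?_
  · simp [Shape.limPow, hlim]
  · refine ⟨fun _ _ _ => rfl, fun a => ?_⟩
    rw [h.2 _ h3 (by simp), hI₀.zero _ (by simp) (by simp)]; rfl
  · rintro j hj M' hM' ⟨i1, i2⟩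
    set M₂ := M'.set .ctr 0 j with hM₂
    have e0 : Expr.ctr.eval M₂ = j := by simp [hM₂, Expr.ctr, Mem.set_apply]
    have e1 : M₂ .lim 0 = I.lim := by
      rw [hM₂, Mem.set_of_ne _ _ _ (by simp), i1 _ (by simp) (by simp), hlim]
    have e2 : ∀ x ≤ I.k * I.lim, M₂ .pow x = 2 ^ x := fun x hx => by
      rw [hM₂, Mem.set_of_ne _ _ _ (by simp), i1 _ (by simp) (by simp), hpow x hx]
    have e3 : M₂ .tab = M' .tab := by rw [hM₂, Mem.set_of_ne _ _ _ (by simp)]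
    have e4 : (I.feasE (.ctr % Shape.limPow I.k) (.ctr / Shape.limPow I.k)).eval M₂ *
        M₂ .pow (∑ i ∈ Finset.range I.k, I.digit (j % I.lim ^ I.k) i) = I.tabTerm j := by
      rw [eval_feasE e1, e2 _ (sum_digit_le hI _)]
      simp only [Expr.eval_mod, Expr.eval_div, eval_limPow e1, e0, ite_mul, one_mul, zero_mul,
        tabTerm]
    have e5 : I.tabTerm j ≤ B := by
      unfold tabTerm
      split_ifs
      · exact (Nat.pow_le_pow_right (by omega) (sum_digit_le hI _)).trans hB.pow
      · exact Nat.zero_le _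
    have e6 := hM' .tab rfl (j / I.lim ^ I.k)
    simp only [Stmt.run, Stmt.Keeps, Expr.eval_load, Expr.eval_add, Expr.eval_sub, Expr.eval_mul,
      Expr.eval_sum, eval_digitE e1, Expr.eval_mod, Expr.eval_div, eval_limPow e1, e0, e3, e4]
    refine ⟨.inr (by omega), fun A hA hA' => ?_, fun a => ?_⟩
    · rw [Mem.set_of_ne _ _ _ hA, hM₂, Mem.set_of_ne _ _ _ hA', i1 A hA hA']
    · rw [Finset.range_add_one, Finset.sup_insert, ← i2]
      by_cases ha : j / I.lim ^ I.k = a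
      · simp only [Mem.set_apply, ha, and_self, if_true]
        omega
      · have ha' : ¬ (True ∧ a = j / I.lim ^ I.k) := fun h => ha h.2.symm
        simp only [Mem.set_apply, if_neg ha, if_neg ha', e3]
        exact (Nat.zero_max _).symm
  · rintro M' ⟨i1, i2⟩
    refine h.extend i1 hD.2.2 ?_
    rintro A rfl e he
    rw [i2, sup_tabTerm hI he]

variable (I) in
/-- The arrays that the sampler consults. -/
def tables : Set Name :=
  {.log, .lim, .tab, .node 0, .deg 0, .pot 0, .ok 0, .codes} ∪ upTo I.trieNames I.n

variable (I) in
/-- The memory contains the tables of the problem and everything that has been prepared for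
sampling. -/
structure Ready (M : Mem) : Prop where
  rows : ∀ c < I.n, M (.siz (I.rel c)) 0 = (I.table c).rows
  val : ∀ c < I.n, ∀ i < I.k, ∀ j < (I.table c).rows, (I.table c).val j i =
    if I.mem c i then M (.inp (I.src c i)) j else 0
  spec : ∀ A ∈ I.tables, I.Spec A (M A)

theorem eval_degE {i c : ℕ} {u : ℕ → ℕ} (h1 : M (.node i) c = I.node c i u)
    (h2 : I.Spec (.cnt c i) (M (.cnt c i))) (h3 : I.Spec (.maxdeg c) (M (.maxdeg c))) :
    (I.degE i c).eval M = I.deg c i u := by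
  unfold Shape.degE deg
  split_ifs
  · exact (h2 _).trans (congrArg ((I.table c).cnt i) h1)
  · exact h3

theorem eval_potE (hI : I.Valid) {i : ℕ} {u : ℕ → ℕ}
    (h1 : ∀ c < I.n, M (.deg i) c = I.deg c i u) (hlog : I.Spec .log (M .log))
    (hlim : M .lim 0 = I.lim) (htab : I.Spec .tab (M .tab)) : (I.potE i).eval M = I.pot i u := by
  have h2 : ∀ c < I.n, M .log (M (.deg i) c) = Nat.log 2 (I.deg c i u) := fun c hc => by
    rw [h1 c hc, hlog _ (deg_le_rows.trans (rows_le_tot hc))]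
  rw [pot, ← htab _ fun c hc => log_deg_lt hI hc, Shape.potE, Expr.eval_load, Expr.eval_sum]
  congr 1
  refine Finset.sum_congr rfl fun c hc => ?_
  rw [Expr.eval_mul, Expr.eval_load, Expr.eval_load, Expr.eval_const, eval_limPow hlim,
    h2 c (Finset.mem_range.1 hc)]

theorem row_ensures {A : Name} {e : ℕ → Expr} (hM : M.Small B) (h : I.Progress M₀ D M)
    (hctr : .ctr ∉ D) (he : ∀ c < I.n, ∀ f, (e c).eval (Function.update M A f) = (e c).eval M)
    (hB : ∀ c < I.n, (e c).eval M ≤ B)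
    (hs : ∀ f : ℕ → ℕ, (∀ c < I.n, f c = (e c).eval M) → I.Spec A f) :
    (Cmd.stmt (.each I.n fun c => .asg A (.const c) (e c))).Ensures B N M
      (I.Progress M₀ (D ∪ {A})) := by
  obtain ⟨h1, h2⟩ := Stmt.run_each_asg (B := B) he (.inr hB)
  refine .stmt hM h1 ?_
  rw [h2]
  refine h.extend (fun A' hA' _ => Function.update_of_ne hA' _ _) hctr ?_
  rintro A' rfl
  refine hs _ fun c hc => ?_
  rw [Function.update_self, if_pos hc]

theorem top_ensures (hI : I.Valid) (hI₀ : I.Initial M₀) (hB : I.Bounds B N) (hD : Given D)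
    (hM : M.Small B) (h : I.Progress M₀ D M) (hsub : upTo I.trieNames I.n ⊆ D)
    (hlog : .log ∈ D) (hlim : .lim ∈ D) (htab : .tab ∈ D) :
    I.topCmd.Ensures B N M
      (I.Progress M₀ (D ∪ {.node 0} ∪ {.deg 0} ∪ {.pot 0} ∪ {.ok 0} ∪ {.codes})) := by
  have hB1 := hB.tot
  have hnode : ∀ c < I.n, ∀ u, I.node c 0 u = if 0 < (I.table c).rows then 1 else 0 := by
    intro c hc u
    split_ifs with h0
    · exact Table.node_zero h0
    · have h1 : I.node c 0 u ≤ (I.table c).rows := Table.node_le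
      omega
  obtain ⟨hD1, hD2, hD3⟩ := hD
  refine (row_ensures hM h hD3 ?_ ?_ ?_).seq fun M hM h => ?_
  · intro c hc f
    rw [Expr.eval_lt, Expr.eval_lt, Shape.rowsE, Expr.eval_var, Expr.eval_var,
      Function.update_of_ne (by simp)]
    rfl
  · intro c hc
    simp only [Expr.eval_lt]
    split_ifs <;> omega
  · intro f hf _ c hc u
    rw [hf c hc, hnode c hc]
    simp only [Expr.eval_lt, Expr.eval_const, rows_of_progress hI₀ ⟨hD1, hD2, hD3⟩ h hc]
  have hn : ∀ c < I.n, ∀ u, M (.node 0) c = I.node c 0 u := h.1 (.node 0) (by simp) rfl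
  have hdeg : ∀ c < I.n, ∀ u, (I.degE 0 c).eval M = I.deg c 0 u := by
    intro c hc u
    refine eval_degE (hn c hc u) (h.1 _ ?_) (h.1 _ ?_)
    · exact .inl (hsub ⟨c, hc, by simp [trieNames, upTo]⟩)
    · exact .inl (hsub ⟨c, hc, by simp [trieNames]⟩)
  refine (row_ensures hM h (by simp [hD3]) ?_ ?_ ?_).seq fun M hM h => ?_
  · intro c hc f
    unfold Shape.degE
    split_ifs <;> simp
  · intro c hc
    rw [hdeg c hc 0]
    have := rows_le_tot hc
    have := deg_le_rows (I := I) (c := c) (i := 0) (u := 0)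
    nlinarith [I.k.zero_le]
  · intro f hf _ c hc u
    rw [hf c hc, hdeg c hc u]
  have hd : ∀ c < I.n, ∀ u, M (.deg 0) c = I.deg c 0 u := h.1 (.deg 0) (by simp) rfl
  have hpot : ∀ u, (I.potE 0).eval M = I.pot 0 u := fun u =>
    eval_potE hI (fun c hc => hd c hc u) (h.1 _ (by simp [hlog])) (h.1 .lim (by simp [hlim]))
      (h.1 _ (by simp [htab]))
  refine (setVar_ensures hM h (by simp [hD3]) ?_ ?_).seq fun M hM h => ?_
  · rw [hpot 0]
    exact (potential_le hI _).trans hB.pow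
  · intro f hf _ u
    rw [hf, hpot u]
  have hn : ∀ c < I.n, ∀ u, M (.node 0) c = I.node c 0 u := h.1 (.node 0) (by simp) rfl
  have hok : ∀ u, (Expr.prod I.n fun c => .lt (.const 0) (.load (.node 0) (.const c))).eval M ≤ 1 ∧
      ((Expr.prod I.n fun c => .lt (.const 0) (.load (.node 0) (.const c))).eval M = 1 ↔
        I.Alive 0 u) := by
    classical
    intro u
    have h0 : ∀ c ∈ Finset.range I.n, (Expr.lt (.const 0) (.load (.node 0) (.const c))).eval M =
        if I.node c 0 u ≠ 0 then 1 else 0 := by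
      intro c hc
      rw [Expr.eval_lt, ← hn c (Finset.mem_range.1 hc)]
      exact if_congr Nat.pos_iff_ne_zero rfl rfl
    rw [Expr.eval_prod, Finset.prod_congr rfl h0, Finset.prod_boole]
    simp only [Finset.mem_range]
    change _ ≤ 1 ∧ (_ ↔ ∀ c < I.n, _)
    split_ifs with h1
    · exact ⟨le_rfl, fun _ => h1, fun _ => rfl⟩
    · exact ⟨Nat.zero_le _, fun h => absurd h (by simp), fun h => absurd h h1⟩
  refine (setVar_ensures hM h (by simp [hD3]) ?_ ?_).seq fun M hM h => ?_
  · exact (hok 0).1.trans (by omega)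
  · intro f hf _ u
    rw [hf]
    exact hok u
  have hp : ∀ u, M (.pot 0) 0 = I.pot 0 u := h.1 (.pot 0) (by simp) rfl
  refine setVar_ensures hM h (by simp [hD3]) ?_ ?_
  · simp only [Expr.eval_mul, Expr.eval_const, Expr.eval_var, hp 0]
    exact (Nat.mul_le_mul_left _ (potential_le hI _)).trans hB.codes
  · intro f hf u
    rw [hf]
    simp only [Expr.eval_mul, Expr.eval_const, Expr.eval_var, hp u]
    rfl

/-- The preprocessing program prepares the memory for sampling. -/
theorem pre_ensures (hI : I.Valid) (hI₀ : I.Initial M₀) (hB : I.Bounds B N) (hM : M₀.Small B) :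
    I.preCmd.Ensures B N M₀ I.Ready := by
  have howner : ∀ {A : Name}, A ∈ upTo I.trieNames I.n → A.owner ≠ none := by
    rintro A ⟨c, -, hA⟩
    simp [owner_of_mem_trieNames hA]
  have hinp : ∀ a, .inp a ∉ upTo I.trieNames I.n := fun a h => howner h rfl
  have hsiz : ∀ a, .siz a ∉ upTo I.trieNames I.n := fun a h => howner h rfl
  have hctr : .ctr ∉ upTo I.trieNames I.n := fun h => howner h rfl
  have htab : .tab ∉ upTo I.trieNames I.n := fun h => howner h rfl
  refine (tries_ensures hI hI₀ hB hM).seq fun M hM h => ?_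
  refine (tot_ensures hI₀ hB ⟨hinp, hsiz, hctr⟩ hM h).seq fun M hM h => ?_
  refine (log_ensures hB ?_ hM h (by simp)).seq fun M hM h => ?_
  · simp [Given, hinp, hsiz, hctr]
  refine (lim_ensures hI hB ?_ hM h (by simp) (by simp)).seq fun M hM h => ?_
  · simp [Given, hinp, hsiz, hctr]
  refine (pow_ensures hB ?_ hM h (by simp)).seq fun M hM h => ?_
  · simp [Given, hinp, hsiz, hctr]
  refine (tab_ensures hI hI₀ hB ?_ hM h (by simp) (by simp) (by simp [htab])).seq fun M hM h => ?_
  · simp [Given, hinp, hsiz, hctr]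
  refine (top_ensures hI hI₀ hB ?_ hM h (fun A hA => by simp [hA]) (by simp) (by simp)
    (by simp)).mono fun M h => ?_
  · simp [Given, hinp, hsiz, hctr]
  refine ⟨fun c hc => ?_, fun c hc i hi j hj => ?_, fun A hA => h.1 A ?_⟩
  · rw [h.2 _ (by simp [hsiz]) (by simp), hI₀.rows c hc]
  · rw [h.2 _ (by simp [hinp]) (by simp), hI₀.val c hc i hi j hj]
  · simp only [tables, Set.mem_union, Set.mem_insert_iff, Set.mem_singleton_iff] at hA ⊢
    tauto

end Inst

namespace Shape

variable (S : Shape)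

theorem wf_limPow (j : ℕ) : (limPow j).Wf := Expr.wf_prod _ _ fun _ _ => by simp [Name.IsVal]

theorem wf_entryE (c i : ℕ) : (S.entryE c i).Wf := by
  unfold entryE
  split_ifs <;> simp [Expr.ctr]

theorem wf_degE (i c : ℕ) : (S.degE i c).Wf ∧ ¬ (S.degE i c).IsValLoad := by
  unfold degE
  split_ifs <;> simp [Name.IsVal]

theorem wf_potE (i : ℕ) : (S.potE i).Wf ∧ ¬ (S.potE i).IsValLoad := by
  simp only [potE, Expr.wf_load, Expr.isValLoad_load]
  refine ⟨Expr.wf_sum _ _ fun c _ => ?_, by simp [Name.IsVal]⟩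
  have h := wf_limPow c
  have h' : ¬ (limPow c).IsValLoad := Expr.isValLoad_prod _ _
  simp [Name.IsVal, h, h']

theorem wf_trieCmd (c : ℕ) : (S.trieCmd c).Wf := by
  have h := S.wf_entryE c
  refine ⟨?_, Cmd.wf_each fun i _ => ?_, Cmd.wf_each fun i _ => ?_, ?_,
    Cmd.wf_each fun i _ => ?_, ?_⟩ <;>
  simp [rootCmd, levelCmd, cntCmd, maxdegCmd, baseCmd, leafCmd, Cmd.Wf, Stmt.Wf, rowsE, keyE,
    Expr.ctr, Name.IsVal, Stmt.setVar, h]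

theorem wf_preCmd : S.preCmd.Wf := by
  have h (j : ℕ) : ¬ (limPow j).IsValLoad := Expr.isValLoad_prod _ _
  have hdig (x : Expr) (hx : x.Wf) (hx' : ¬ x.IsValLoad) (i : ℕ) : (digitE x i).Wf := by
    simp [digitE, wf_limPow, h, hx, hx', Name.IsVal]
  have hdig' (x : Expr) (i : ℕ) : ¬ (digitE x i).IsValLoad := Expr.isValLoad_mod _ _
  refine ⟨Cmd.wf_each fun c _ => S.wf_trieCmd c, ?_, ?_, ?_, ?_, ?_, ?_⟩
  · exact ⟨trivial, Expr.wf_sum _ _ fun c _ => by simp [rowsE, Name.IsVal],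
      fun h => absurd h (Expr.isValLoad_sum _ _)⟩
  · simp [logCmd, Cmd.Wf, Stmt.Wf, Expr.ctr, Name.IsVal]
  · simp [limCmd, Cmd.Wf, Stmt.Wf, Stmt.setVar, Name.IsVal]
  · simp [powCmd, Cmd.Wf, Stmt.Wf, Stmt.setVar, Expr.ctr, Name.IsVal]
  · have hx : (Expr.ctr % limPow S.k).Wf := by simp [Expr.ctr, wf_limPow, h, Name.IsVal]
    have hy : (Expr.ctr / limPow S.k).Wf := by simp [Expr.ctr, wf_limPow, h, Name.IsVal]
    have h1 : (S.feasE (Expr.ctr % limPow S.k) (Expr.ctr / limPow S.k)).Wf := by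
      refine Expr.wf_prod _ _ fun c _ => ⟨?_, Expr.isValLoad_le _ _⟩
      simp only [Expr.wf_le, Expr.isValLoad_sum, hdig', hdig _ hy (Expr.isValLoad_div _ _),
        not_false_eq_true, and_true]
      refine Expr.wf_sum _ _ fun i _ => ?_
      split_ifs
      · exact ⟨hdig _ hx (Expr.isValLoad_mod _ _) i, hdig' _ _⟩
      · simp
    have h2 : ¬ (S.feasE (Expr.ctr % limPow S.k) (Expr.ctr / limPow S.k)).IsValLoad :=
      Expr.isValLoad_prod _ _
    have h3 : (Expr.sum S.k (digitE (Expr.ctr % limPow S.k))).Wf :=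
      Expr.wf_sum _ _ fun i _ => ⟨hdig _ hx (Expr.isValLoad_mod _ _) i, hdig' _ _⟩
    simp [tabCmd, Cmd.Wf, Stmt.Wf, wf_limPow, hy, h1, h2, h3, Name.IsVal]
  · refine ⟨Stmt.wf_each fun c _ => ?_, Stmt.wf_each fun c _ => ?_, ?_, ?_, ?_⟩
    · simp [Stmt.Wf, rowsE, Name.IsVal]
    · simp [Stmt.Wf, S.wf_degE]
    · simp [Stmt.Wf, Stmt.setVar, S.wf_potE, Cmd.Wf]
    · exact ⟨trivial, Expr.wf_prod _ _ fun c _ => by simp [Name.IsVal],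
        fun h => absurd h (Expr.isValLoad_prod _ _)⟩
    · simp [Cmd.Wf, Stmt.Wf, Stmt.setVar, Name.IsVal]

end Shape

/-! ### Decoding programs -/

namespace Expr

/-- Whether the evaluation of the expression reads array `A`. -/
def Reads (A : Name) : Expr → Prop
  | const _ => False
  | load A' e => A = A' ∨ e.Reads A
  | op _ e f => e.Reads A ∨ f.Reads A

theorem eval_congr {M M' : Mem} (e : Expr) (h : ∀ A, e.Reads A → M' A = M A) :
    e.eval M' = e.eval M := by
  induction e with
  | const n => rfl
  | load A e ih =>
    rw [eval_load, eval_load, h A (.inl rfl), ih fun A hA => h A (.inr hA)]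
  | op o e f ihe ihf =>
    simp only [eval, ihe fun A hA => h A (.inl hA), ihf fun A hA => h A (.inr hA)]

section simp_lemmas

variable (A A' : Name) (e f : Expr) (n : ℕ) (F : ℕ → Expr)

@[simp] theorem reads_const : ¬ (const n).Reads A := id
@[simp] theorem reads_load : (load A' e).Reads A ↔ A = A' ∨ e.Reads A := Iff.rfl
@[simp] theorem reads_add : (e + f).Reads A ↔ e.Reads A ∨ f.Reads A := Iff.rfl
@[simp] theorem reads_sub : (e - f).Reads A ↔ e.Reads A ∨ f.Reads A := Iff.rfl
@[simp] theorem reads_mul : (e * f).Reads A ↔ e.Reads A ∨ f.Reads A := Iff.rfl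
@[simp] theorem reads_div : (e / f).Reads A ↔ e.Reads A ∨ f.Reads A := Iff.rfl
@[simp] theorem reads_mod : (e % f).Reads A ↔ e.Reads A ∨ f.Reads A := Iff.rfl
@[simp] theorem reads_var : (var A').Reads A ↔ A = A' := by simp [var]
@[simp] theorem reads_lt : (lt e f).Reads A ↔ e.Reads A ∨ f.Reads A := by simp [lt, or_comm]
@[simp] theorem reads_le : (le e f).Reads A ↔ e.Reads A ∨ f.Reads A := by simp [le]
@[simp] theorem reads_sum : (sum n F).Reads A ↔ ∃ i < n, (F i).Reads A := by
  induction n with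
  | zero => simp [sum]
  | succ n ih =>
    change (sum n F).Reads A ∨ (F n).Reads A ↔ _
    simp only [ih, Nat.lt_succ_iff_lt_or_eq, or_and_right, exists_or, exists_eq_left]

@[simp] theorem reads_prod : (prod n F).Reads A ↔ ∃ i < n, (F i).Reads A := by
  induction n with
  | zero => simp [prod]
  | succ n ih =>
    change (prod n F).Reads A ∨ (F n).Reads A ↔ _
    simp only [ih, Nat.lt_succ_iff_lt_or_eq, or_and_right, exists_or, exists_eq_left]

end simp_lemmas

end Expr

/-- An array with definitions of its first `count` entries. -/
structure Def where
  name : Name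
  count : ℕ
  value : ℕ → Expr

namespace Def

/-- Evaluate definitions one after the other. -/
def stmt : List Def → Stmt
  | [] => .skip
  | d :: l => .seq (.each d.count fun c => .asg d.name (.const c) (d.value c)) (stmt l)

/-- No definition depends on its own array or that of a later definition, and no array is defined
twice. -/
def Ordered : List Def → Prop
  | [] => True
  | d :: l => (∀ c < d.count, ¬ (d.value c).Reads d.name) ∧ (∀ d' ∈ l, d.name ≠ d'.name ∧
      ∀ c < d.count, ¬ (d.value c).Reads d'.name) ∧ Ordered l

/-- The values do not exceed the bound `B`. -/
def Bounded (B : ℕ) (d : Def) : Prop :=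
  d.name.IsVal = true ∨ ∀ M : Mem, M.Small B → ∀ c < d.count, (d.value c).eval M ≤ B

/-- After the evaluation of the definitions all defining equations hold. -/
theorem run_stmt {B : ℕ} {l : List Def} (hl : Ordered l) (hB : ∀ d ∈ l, d.Bounded B) {M : Mem}
    (hM : M.Small B) : (stmt l).Keeps B M ∧
      (∀ A, (∀ d ∈ l, A ≠ d.name) → (stmt l).run M A = M A) ∧
      ∀ d ∈ l, ∀ c < d.count, (stmt l).run M d.name c = (d.value c).eval ((stmt l).run M) := by
  induction l generalizing M with
  | nil => exact ⟨trivial, fun _ _ => rfl, by simp⟩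
  | cons d l ih =>
    obtain ⟨h1, h2, h3⟩ := hl
    have hself : ∀ c < d.count, ∀ f, (d.value c).eval (Function.update M d.name f) =
        (d.value c).eval M := fun c hc f => Expr.eval_congr _ fun A hA =>
      Function.update_of_ne (fun h : A = d.name => h1 c hc (h ▸ hA)) _ _
    obtain ⟨h4, h5⟩ := Stmt.run_each_asg (M := M) (B := B) hself
      ((hB d List.mem_cons_self).imp_right fun h => h M hM)
    obtain ⟨h6, h7, h8⟩ := ih h3 (fun d' hd' => hB d' (List.mem_cons_of_mem _ hd'))
      (Stmt.small_run hM h4)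
    refine ⟨⟨h4, h6⟩, fun A hA => ?_, fun d' hd' c hc => ?_⟩
    · refine (h7 A fun d' hd' => hA d' (List.mem_cons_of_mem _ hd')).trans ?_
      rw [h5, Function.update_of_ne (hA d List.mem_cons_self)]
    · rcases List.mem_cons.1 hd' with rfl | hd'
      · refine (congrFun (h7 d'.name fun d hd => (h2 d hd).1) c).trans ?_
        rw [h5, Function.update_self, if_pos hc, ← hself c hc]
        refine (Expr.eval_congr _ fun A hA => ?_).symm
        rw [← h5]
        exact h7 A fun d hd h => (h2 d hd).2 c hc (h ▸ hA)
      · exact h8 d' hd' c hc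

theorem wf_stmt {l : List Def} (h : ∀ d ∈ l, ∀ c < d.count, (d.value c).Wf ∧
    ((d.value c).IsValLoad → d.name.IsVal = true)) : (stmt l).Wf := by
  induction l with
  | nil => trivial
  | cons d l ih =>
    exact ⟨Stmt.wf_each fun c hc => ⟨trivial, h d List.mem_cons_self c hc⟩,
      ih fun d' hd' => h d' (List.mem_cons_of_mem _ hd')⟩

end Def

namespace Shape

open JoinSampling.Expr

variable (S : Shape) (i c : ℕ)

/-- The constraint selected by the code. -/
def selE : Expr := var (.rem i) % const S.n

/-- The quotient of the code. -/
def quoE : Expr := var (.rem i) / const S.n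

/-- The level `i` node of trie `c` that the tuple being decoded reaches. -/
def nodeE : Expr := load (.node i) (const c)

/-- The number of codes per constraint. -/
def shareE : Expr := const (2 * (2 * S.n) ^ (S.k - (i + 1))) * var (.pot i)

/-- The number of codes. -/
def weightE : Expr := const ((2 * S.n) ^ (S.k - i)) * var (.pot i)

/-- The position of the first leaf below that node. -/
def baseE : Expr := load (.base c i) (nodeE i c)

/-- The number of leaves below that node. -/
def cntE : Expr := load (.cnt c i) (nodeE i c)

/-- The value of attribute `i` that constraint `c` proposes. -/
def candE : Expr := if S.act c i then
  load (.inp (S.src c i)) (load (.leaf c) (baseE i c + S.quoE i * cntE i c / S.shareE i))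
  else const 0

/-- The part of the value of attribute `i` that constraint `c` sees. -/
def viewE : Expr := if S.mem c i then var (.out i) else const 0

/-- The code that constraint `c` leaves for the next level. -/
def offE : Expr := S.quoE i -
  ((baseE (i + 1) c - baseE i c) * S.shareE i + cntE i c - const 1) / cntE i c

/-- Whether constraint `c` passes the test. -/
def testE : Expr := if S.act c i then
  le (S.weightE (i + 1) * load (.deg i) (const c)) (S.shareE i * load (.deg (i + 1)) (const c))
  else const 0

/-- Whether decoding has been successful up to level `i + 1`. -/
def okE : Expr := var (.ok i) * (prod S.n (fun c => lt (const 0) (nodeE (i + 1) c)) *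
  lt (const 0) (load (.test i) (S.selE i)) *
  prod S.n (fun c => le (load (.test i) (const c) * lt (const c) (S.selE i)) (const 0)) *
  lt (var (.rem (i + 1))) (S.weightE (i + 1)))

/-- Decode the value of attribute `i`. -/
def levelDefs : List Def := [
  ⟨.cand i, S.n, S.candE i⟩,
  ⟨.out i, 1, fun _ => load (.cand i) (S.selE i)⟩,
  ⟨.node (i + 1), S.n, fun c => load (.child c i) (S.keyE c i (nodeE i c) (S.viewE i c))⟩,
  ⟨.deg (i + 1), S.n, S.degE (i + 1)⟩,
  ⟨.pot (i + 1), 1, fun _ => S.potE (i + 1)⟩,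
  ⟨.off i, S.n, S.offE i⟩,
  ⟨.test i, S.n, S.testE i⟩,
  ⟨.rem (i + 1), 1, fun _ => load (.off i) (S.selE i)⟩,
  ⟨.ok (i + 1), 1, fun _ => S.okE i⟩]

/-- Decode the code in `rem 0`. -/
def decodeStmt : Stmt := .each S.k fun i => Def.stmt (S.levelDefs i)

theorem ordered_levelDefs : Def.Ordered (S.levelDefs i) := by
  simp [Def.Ordered, levelDefs, candE, degE, potE, testE, viewE, baseE, cntE, quoE, selE, shareE,
    weightE, okE, offE, keyE, nodeE, rowsE, limPow, apply_ite (Expr.Reads _)]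

theorem okE_le (M : Mem) : (S.okE i).eval M ≤ M (.ok i) 0 := by
  have hle : ∀ (M : Mem) (e f : Expr), (lt e f).eval M ≤ 1 := fun M e f => by
    rw [eval_lt]; split_ifs <;> omega
  have hle' : ∀ (M : Mem) (e f : Expr), (le e f).eval M ≤ 1 := fun M e f => by
    rw [eval_le]; split_ifs <;> omega
  have hprod : ∀ (M : Mem) (n : ℕ) (F : ℕ → Expr), (∀ i, (F i).eval M ≤ 1) →
      (prod n F).eval M ≤ 1 := fun M n F h => by
    rw [eval_prod]
    exact Finset.prod_le_one' fun i _ => h i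
  refine (Nat.mul_le_mul_left _ ?_).trans (Nat.mul_one _).le
  have h := Nat.mul_le_mul (Nat.mul_le_mul (Nat.mul_le_mul
    (hprod M S.n (fun c => lt (const 0) (nodeE (i + 1) c)) fun c => hle _ _ _)
    (hle M (const 0) (load (.test i) (S.selE i))))
    (hprod M S.n (fun c => le (load (.test i) (const c) * lt (const c) (S.selE i)) (const 0))
      fun c => hle' _ _ _)) (hle M (var (.rem (i + 1))) (S.weightE (i + 1)))
  exact h

theorem bounded_levelDefs {B : ℕ} (hB : 1 ≤ B) : ∀ d ∈ S.levelDefs i, d.Bounded B := by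
  simp only [levelDefs, List.mem_cons, List.not_mem_nil, or_false, forall_eq_or_imp, forall_eq]
  refine ⟨.inl rfl, .inl rfl, .inr fun M hM c _ => hM _ rfl _, .inr fun M hM c _ => ?_,
    .inr fun M hM c _ => hM _ rfl _, .inr fun M hM c _ => ?_, .inr fun M hM c _ => ?_,
    .inr fun M hM c _ => hM _ rfl _, .inr fun M hM c _ => ?_⟩
  · simp only [degE]
    split_ifs
    exacts [hM _ rfl _, hM _ rfl _]
  · exact (Nat.sub_le _ _).trans ((Nat.div_le_self _ _).trans (hM _ rfl _))
  · simp only [testE]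
    split_ifs
    · rw [eval_le]
      split_ifs <;> omega
    · exact Nat.zero_le _
  · exact (S.okE_le i M).trans (hM (.ok i) rfl 0)

theorem wf_levelDefs : ∀ d ∈ S.levelDefs i, ∀ c < d.count, (d.value c).Wf ∧
    ((d.value c).IsValLoad → d.name.IsVal = true) := by
  have h1 := S.wf_degE (i + 1)
  have h2 := S.wf_potE (i + 1)
  simp only [levelDefs, List.mem_cons, List.not_mem_nil, or_false, forall_eq_or_imp, forall_eq]
  have h3 : (prod S.n fun c => lt (const 0) (nodeE (i + 1) c)).Wf :=
    Expr.wf_prod _ _ fun c _ => by simp [nodeE, Name.IsVal]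
  have h4 : (prod S.n fun c => le (load (.test i) (const c) * lt (const c) (S.selE i))
      (const 0)).Wf := Expr.wf_prod _ _ fun c _ => by simp [selE, Name.IsVal]
  refine ⟨fun c _ => ?_, fun c _ => ?_, fun c _ => ?_,
    fun c _ => ⟨(h1 c).1, fun h => absurd h (h1 c).2⟩,
    fun c _ => ⟨h2.1, fun h => absurd h h2.2⟩, fun c _ => ?_, fun c _ => ?_, fun c _ => ?_,
    fun c _ => ?_⟩
  · unfold candE
    split_ifs <;> simp [quoE, baseE, nodeE, cntE, shareE, Name.IsVal]
  · simp [selE, Name.IsVal]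
  · unfold viewE
    split_ifs <;> simp [keyE, nodeE, rowsE, Name.IsVal]
  · simp [offE, quoE, baseE, nodeE, cntE, shareE, Name.IsVal]
  · unfold testE
    split_ifs <;> simp [weightE, shareE, Name.IsVal]
  · simp [selE, Name.IsVal]
  · have h5 : (S.selE i).Wf ∧ ¬ (S.selE i).IsValLoad := by simp [selE, Name.IsVal]
    simp [okE, h3, h4, h5, weightE, Name.IsVal]

end Shape

/-- The arrays that the sampler modifies. -/
def Name.IsWork : Name → Bool
  | .rem _ | .cand _ | .out _ | .off _ | .test _ | .go | .rnd | .flag | .res => true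
  | .node i | .deg i | .pot i | .ok i => i != 0
  | _ => false

theorem Shape.isWork_of_mem_levelDefs {S : Shape} {i : ℕ} :
    ∀ d ∈ S.levelDefs i, d.name.IsWork = true := by
  simp [levelDefs, Name.IsWork]

namespace Inst

variable {I : Inst} {M M' : Mem} {B : ℕ}

theorem isWork_of_mem_tables {A : Name} (h : A ∈ I.tables) : A.IsWork = false := by
  rcases h with (rfl | rfl | rfl | rfl | rfl | rfl | rfl | rfl) | ⟨c, -, h⟩
  all_goals try rfl
  have := owner_of_mem_trieNames h
  cases A <;> first | rfl | simp [Name.owner] at this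

theorem Ready.congr (h : I.Ready M) (hM : ∀ A : Name, A.IsWork = false → M' A = M A) :
    I.Ready M' where
  rows c hc := by rw [hM _ rfl, h.rows c hc]
  val c hc i hi j hj := by rw [hM _ rfl, h.val c hc i hi j hj]
  spec A hA := by
    rw [hM _ (isWork_of_mem_tables hA)]
    exact h.spec A hA

variable (I) in
/-- The state of the decoding of code `x₀` at level `i`: if no tuple has this code, this may have
been noticed, and otherwise the first `i` entries of a tuple with this code have been found. -/
def Decoded (i x₀ : ℕ) (M : Mem) : Prop :=
  (M (.ok i) 0 = 0 ∧ ∀ u x, I.Alive i u → x < I.weight i u → I.encode i u x ≠ x₀) ∨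
  (M (.ok i) 0 = 1 ∧ ∃ u, I.Alive i u ∧ M (.rem i) 0 < I.weight i u ∧
    I.encode i u (M (.rem i) 0) = x₀ ∧ (∀ l < i, M (.out l) 0 = u l) ∧
    (∀ c < I.n, M (.node i) c = I.node c i u) ∧ (∀ c < I.n, M (.deg i) c = I.deg c i u) ∧
    M (.pot i) 0 = I.pot i u)

theorem Decoded.zero (h : I.Ready M) {x : ℕ} (hrem : M (.rem 0) 0 = x)
    (hx : x < M .codes 0) : I.Decoded 0 x M := by
  have htop : ∀ A ∈ ({.log, .lim, .tab, .node 0, .deg 0, .pot 0, .ok 0, .codes} : Set Name),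
    I.Spec A (M A) := fun A hA => h.spec A (.inl hA)
  have hok : ∀ u, M (.ok 0) 0 ≤ 1 ∧ (M (.ok 0) 0 = 1 ↔ I.Alive 0 u) := htop (.ok 0) (by simp) rfl
  have hcodes : ∀ u, M .codes 0 = I.weight 0 u := htop .codes (by simp)
  have h1 := hok 0
  rcases Nat.le_one_iff_eq_zero_or_eq_one.1 h1.1 with h0 | h0
  · refine .inl ⟨h0, fun u x hu => ?_⟩
    have := (hok u).2.2 hu
    omega
  · refine .inr ⟨h0, 0, h1.2.1 h0, ?_, hrem, fun l hl => by omega, ?_, ?_, ?_⟩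
    · rw [← hcodes 0, hrem]
      exact hx
    · exact fun c hc => htop (.node 0) (by simp) rfl c hc 0
    · exact fun c hc => htop (.deg 0) (by simp) rfl c hc 0
    · exact htop (.pot 0) (by simp) rfl 0

theorem child_eq (h : I.Ready M) {c i : ℕ} (hc : c < I.n) (hi : i < I.k) {a v : Expr}
    {u : ℕ → ℕ} (ha : a.eval M = I.node c i u) (hv : v.eval M = I.view c u i) :
    M (.child c i) ((I.keyE c i a v).eval M) = I.node c (i + 1) u := by
  have hchild : I.Spec (.child c i) (M (.child c i)) :=
    h.spec _ (.inr ⟨c, hc, by simp [trieNames, upTo, hi]⟩)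
  have hval : I.Spec (.val c i) (M (.val c i)) :=
    h.spec _ (.inr ⟨c, hc, by simp [trieNames, upTo, hi]⟩)
  have hkey : (I.keyE c i a v).eval M = (I.table c).key i (I.node c i u) (I.view c u i) := by
    simp only [Shape.keyE, Shape.rowsE, Expr.eval_add, Expr.eval_mul, Expr.eval_load,
      Expr.eval_var, Expr.eval_const, ha, hv, h.rows c hc]
    rw [hval]
    rfl
  rw [hkey, hchild]
  exact Table.firstIdx_key

theorem base_eq (h : I.Ready M) {c i : ℕ} (hc : c < I.n) (hi : i ≤ I.k) {u : ℕ → ℕ}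
    (hnode : M (.node i) c = I.node c i u) (h0 : I.node c i u ≠ 0) :
    (Shape.baseE i c).eval M = (I.table c).base i (I.node c i u) := by
  have hbase : I.Spec (.base c i) (M (.base c i)) := by
    refine h.spec _ (.inr ⟨c, hc, ?_⟩)
    rcases i with - | i
    · simp [trieNames]
    · simp only [trieNames, upTo, Set.mem_union, Set.mem_ofPred_eq]
      exact .inl (.inr ⟨i, by omega, by simp⟩)
  obtain ⟨j, hj, h1⟩ := exists_of_firstIdx_ne_zero (p := (I.table c).Agree i (I.view c u)) h0
  change I.node c i u = j + 1 ∧ _ at h1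
  change M (.base c i) (M (.node i) c) = _
  rw [hnode, h1.1]
  exact hbase j hj

theorem cntE_eq (h : I.Ready M) {c i : ℕ} (hc : c < I.n) (hi : i ≤ I.k) {u : ℕ → ℕ}
    (hnode : M (.node i) c = I.node c i u) : (Shape.cntE i c).eval M = I.cnt c i u := by
  have hcnt : I.Spec (.cnt c i) (M (.cnt c i)) := by
    refine h.spec _ (.inr ⟨c, hc, ?_⟩)
    simp only [trieNames, upTo, Set.mem_union, Set.mem_ofPred_eq]
    exact .inl (.inl (.inl (.inr ⟨i, by omega, rfl⟩)))
  change M (.cnt c i) (M (.node i) c) = _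
  rw [hnode, hcnt]
  rfl

variable (I) in
/-- The contents of the leaf arrays. -/
def leaves (M : Mem) (c : ℕ) : ℕ → ℕ := M (.leaf c)

theorem Ready.leafArrays (h : I.Ready M) : I.LeafArrays (leaves M) :=
  fun c hc => h.spec (.leaf c) (.inr ⟨c, hc, by simp [trieNames]⟩)

theorem cand_eq (hI : I.Valid) (h : I.Ready M) {c i : ℕ} (hc : c < I.n) (hi : i < I.k)
    {u : ℕ → ℕ} (hu : I.Alive i u) (hnode : M (.node i) c = I.node c i u)
    (hpot : M (.pot i) 0 = I.pot i u) (hact : I.act c i = true)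
    (hq : M (.rem i) 0 / I.n < I.share i u) :
    (I.candE i c).eval M = I.proposal (leaves M) c i u (M (.rem i) 0 / I.n) := by
  have hshare : (I.shareE i).eval M = I.share i u := by
    simp [Shape.shareE, share, hpot]
  have hmem := (hI.lvl_le c hc i hact).2
  have hD := cnt_pos hI hc hi.le hu
  have hM := share_pos (u := u) hI hi
  have hlt : M (.rem i) 0 / I.n * I.cnt c i u / I.share i u < I.cnt c i u := by
    rw [Nat.div_lt_iff_lt_mul hM, mul_comm (I.cnt c i u)]
    exact Nat.mul_lt_mul_of_pos_right hq hD
  obtain ⟨h1, -, -⟩ := (h.leafArrays c hc).agree (u := I.view c u)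
    (p := (I.table c).base i (I.node c i u) + M (.rem i) 0 / I.n * I.cnt c i u / I.share i u)
    (by rw [hI.cols c hc]; exact hi.le) (hu c hc) (Nat.le_add_right _ _)
    (Nat.add_lt_add_left hlt _)
  have h2 := h.val c hc i hi _ h1
  rw [if_pos hmem] at h2
  rw [proposal, h2]
  simp only [Shape.candE, if_pos hact, Shape.quoE, Expr.eval_load, Expr.eval_add, Expr.eval_mul,
    Expr.eval_div, Expr.eval_var, Expr.eval_const, base_eq h hc hi.le hnode (hu c hc),
    cntE_eq h hc hi.le hnode, hshare]
  rfl

theorem test_eq {c i : ℕ} {u : ℕ → ℕ} (hdeg : M (.deg i) c = I.deg c i u)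
    (hdeg' : M (.deg (i + 1)) c = I.deg c (i + 1) u) (hpot : M (.pot i) 0 = I.pot i u)
    (hpot' : M (.pot (i + 1)) 0 = I.pot (i + 1) u) :
    (I.testE i c).eval M ≤ 1 ∧ ((I.testE i c).eval M = 1 ↔ I.Test c i u) := by
  unfold Shape.testE Test
  split_ifs with hact
  · have h1 : (I.weightE (i + 1)).eval M = I.weight (i + 1) u := by
      simp [Shape.weightE, weight, hpot']
    have h2 : (I.shareE i).eval M = I.share i u := by simp [Shape.shareE, share, hpot]
    simp only [Expr.eval_le, Expr.eval_mul, Expr.eval_load, Expr.eval_const, h1, h2, hdeg, hdeg',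
      hact, true_and]
    split_ifs with h3
    · simp [h3]
    · simp [h3]
  · simp [hact]

theorem prod_eq_one_iff {n : ℕ} {f : ℕ → ℕ} :
    ∏ i ∈ Finset.range n, f i = 1 ↔ ∀ i < n, f i = 1 := by
  simp [Finset.prod_eq_one_iff]

theorem lt_eq_one {e f : Expr} : (Expr.lt e f).eval M = 1 ↔ e.eval M < f.eval M := by
  rw [Expr.eval_lt]; split_ifs with h <;> simp [h]

theorem le_eq_one {e f : Expr} : (Expr.le e f).eval M = 1 ↔ e.eval M ≤ f.eval M := by
  rw [Expr.eval_le]; split_ifs with h <;> simp [h]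

theorem ok_eq {i : ℕ} {u : ℕ → ℕ} (hn : 0 < I.n)
    (hnode : ∀ c < I.n, M (.node (i + 1)) c = I.node c (i + 1) u)
    (htest : ∀ c < I.n, M (.test i) c ≤ 1 ∧ (M (.test i) c = 1 ↔ I.Test c i u))
    (hpot : M (.pot (i + 1)) 0 = I.pot (i + 1) u) :
    (I.okE i).eval M = 1 ↔ M (.ok i) 0 = 1 ∧ I.Alive (i + 1) u ∧
      I.IsFirst (M (.rem i) 0 % I.n) i u ∧ M (.rem (i + 1)) 0 < I.weight (i + 1) u := by
  have h1 : (I.weightE (i + 1)).eval M = I.weight (i + 1) u := by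
    simp [Shape.weightE, weight, hpot]
  have hsel : (I.selE i).eval M = M (.rem i) 0 % I.n := rfl
  have hlt := Nat.mod_lt (M (.rem i) 0) hn
  set C := M (.rem i) 0 % I.n
  simp only [Shape.okE, Expr.eval_mul, Expr.eval_prod, mul_eq_one, prod_eq_one_iff, lt_eq_one,
    le_eq_one, Expr.eval_load, Expr.eval_const, Expr.eval_var, h1, hsel, Shape.nodeE, and_assoc]
  refine and_congr_right fun _ => and_congr (forall₂_congr fun c hc => ?_) ?_
  · rw [hnode c hc, Nat.pos_iff_ne_zero]
  · rw [IsFirst, and_assoc]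
    refine and_congr ?_ (and_congr ⟨fun h c hc ht => ?_, fun h c hc => ?_⟩ Iff.rfl)
    · rw [← (htest C hlt).2]
      have := (htest C hlt).1
      omega
    · have h2 := h c (hc.trans hlt)
      have h3 := (htest c (hc.trans hlt)).2.2 ht
      simp [h3, hsel, hc] at h2
    · rw [Expr.eval_lt, Expr.eval_const, hsel]
      split_ifs with hcC
      · have h2 := (htest c hc).1
        have h3 := mt (htest c hc).2.1 (h c hcC)
        omega
      · omega

theorem level_decode (hI : I.Valid) {B : ℕ} (hB : 1 ≤ B) {i x₀ : ℕ} (hi : i < I.k)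
    (hM : M.Small B) (h : I.Ready M) (hdec : I.Decoded i x₀ M) :
    (Def.stmt (I.levelDefs i)).Keeps B M ∧
      (∀ A, (∀ d ∈ I.levelDefs i, A ≠ d.name) → (Def.stmt (I.levelDefs i)).run M A = M A) ∧
      I.Decoded (i + 1) x₀ ((Def.stmt (I.levelDefs i)).run M) := by
  obtain ⟨hk, hframe, heq⟩ := Def.run_stmt (I.ordered_levelDefs i) (I.bounded_levelDefs i hB) hM
  refine ⟨hk, hframe, ?_⟩
  set M' := (Def.stmt (I.levelDefs i)).run M with hM'
  clear_value M'
  have hn : 0 < I.n := by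
    obtain ⟨c, hc, -⟩ := hI.cover i hi
    omega
  replace h : I.Ready M' := h.congr fun A hA => hframe A fun d hd hAd => by
    rw [hAd, Shape.isWork_of_mem_levelDefs d hd] at hA
    exact absurd hA (by simp)
  simp only [Shape.levelDefs, List.mem_cons, List.not_mem_nil, or_false, forall_eq_or_imp,
    forall_eq] at heq hframe
  obtain ⟨hcand, hout, hnode', hdeg', hpot', hoff, htest, hrem', hok'⟩ := heq
  replace hpot' := hpot' 0 (by omega)
  replace hout := hout 0 (by omega)
  replace hrem' := hrem' 0 (by omega)
  replace hok' := hok' 0 (by omega)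
  have hrem : M' (.rem i) = M (.rem i) := hframe _ (by simp)
  have hok : M' (.ok i) = M (.ok i) := hframe _ (by simp)
  rcases hdec with ⟨h0, hno⟩ | ⟨h0, u, hu, hx, henc, houtu, hnode, hdeg, hpot⟩
  · refine .inl ⟨?_, fun u x hu hx => ?_⟩
    · rw [hok', Shape.okE, Expr.eval_mul, Expr.eval_var, hok, h0, zero_mul]
    · exact hno u _ hu.of_succ (back_lt hI hi hu hx)
  rw [← hok] at h0
  rw [← hrem] at hx henc
  set x := M' (.rem i) 0 with hxdef
  set C := x % I.n with hC
  set q := x / I.n with hq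
  have hlt : C < I.n := Nat.mod_lt _ hn
  replace hnode : ∀ c < I.n, M' (.node i) c = I.node c i u := fun c hc => by
    rw [← hnode c hc, hframe _ (by simp)]
  replace hdeg : ∀ c < I.n, M' (.deg i) c = I.deg c i u := fun c hc => by
    rw [← hdeg c hc, hframe _ (by simp)]
  replace hpot : M' (.pot i) 0 = I.pot i u := by
    rw [← hpot, hframe _ (by simp)]
  replace houtu : ∀ l < i, M' (.out l) 0 = u l := fun l hl => by
    rw [← houtu l hl, hframe _ (by simp [hl.ne])]
  have hqM : q < I.share i u := by
    rw [hq, Nat.div_lt_iff_lt_mul hn, ← weight_eq hi]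
    exact hx
  have hsel : (I.selE i).eval M' = C := rfl
  rw [Expr.eval_load, hsel, hcand C hlt] at hout
  rw [Expr.eval_load, hsel, hoff C hlt] at hrem'
  -- The candidate for the first `i + 1` entries of the tuple.
  set v := Function.update u i (M' (.out i) 0) with hv
  have huv : ∀ l < i, u l = v l := fun l hl => by rw [hv, Function.update_of_ne hl.ne]
  have hvi : v i = M' (.out i) 0 := by rw [hv, Function.update_self]
  replace hnode' : ∀ c < I.n, M' (.node (i + 1)) c = I.node c (i + 1) v := fun c hc => by
    refine (hnode' c hc).trans (child_eq h hc hi ?_ ?_)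
    · exact (hnode c hc).trans (node_congr huv)
    · unfold Shape.viewE view
      rw [hvi]
      split_ifs <;> rfl
  replace hdeg' : ∀ c < I.n, M' (.deg (i + 1)) c = I.deg c (i + 1) v := fun c hc => by
    refine (hdeg' c hc).trans (eval_degE (hnode' c hc) (h.spec _ ?_) (h.spec _ ?_))
    · exact .inr ⟨c, hc, by simp [trieNames, upTo, hi]⟩
    · exact .inr ⟨c, hc, by simp [trieNames]⟩
  replace hpot' : M' (.pot (i + 1)) 0 = I.pot (i + 1) v :=
    hpot'.trans (eval_potE hI hdeg' (h.spec _ (.inl (by simp))) (h.spec .lim (.inl (by simp)))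
      (h.spec _ (.inl (by simp))))
  have htest' : ∀ c < I.n, M' (.test i) c ≤ 1 ∧ (M' (.test i) c = 1 ↔ I.Test c i v) :=
    fun c hc => by
      rw [htest c hc]
      exact test_eq ((hdeg c hc).trans (deg_congr huv)) (hdeg' c hc) (hpot.trans (pot_congr huv))
        hpot'
  have hiff := ok_eq hn hnode' htest' hpot'
  rw [← hok'] at hiff
  have hfirst : I.Alive (i + 1) v → M' (.rem (i + 1)) 0 = q - I.first C i v := fun hvA => by
    have hshare : (I.shareE i).eval M' = I.share i v := by
      rw [← share_congr huv]
      simp [Shape.shareE, share, hpot]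
    have hnodev := (hnode C hlt).trans (node_congr huv)
    rw [hrem']
    simp only [Shape.offE, Expr.eval_sub, Expr.eval_div, Expr.eval_add, Expr.eval_mul,
      Expr.eval_const, hshare, base_eq h hlt hi (hnode' C hlt) (hvA C hlt),
      base_eq h hlt hi.le hnodev (hvA.of_succ C hlt), cntE_eq h hlt hi.le hnodev]
    rfl
  have hprop : I.act C i = true → I.proposal (leaves M') C i u q = v i := fun hact => by
    rw [hvi, hout, cand_eq hI h hlt hi hu (hnode C hlt) hpot hact hqM]
  by_cases hgood : M' (.ok (i + 1)) 0 = 1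
  · obtain ⟨-, hvA, hf, hw⟩ := hiff.1 hgood
    refine .inr ⟨hgood, v, hvA, hw, ?_, fun l hl => ?_, hnode', hdeg', hpot'⟩
    · rw [encode, hfirst hvA, back_decode hI h.leafArrays hi hvA (by rwa [← weight_congr huv]) hf
        ((proposal_congr huv).symm.trans (hprop hf.1.1)), ← encode_congr huv]
      exact henc
    · rcases Nat.lt_succ_iff_lt_or_eq.1 hl with hl | rfl
      exacts [(houtu l hl).trans (huv l hl), hvi.symm]
  · refine .inl ⟨?_, fun u₂ x₂ hu₂ hx₂ henc₂ => hgood (hiff.2 ?_)⟩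
    · have hle : M' (.ok (i + 1)) 0 ≤ 1 := by
        have := I.okE_le i M'
        omega
      omega
    · have hlt₂ := back_lt hI hi hu₂ hx₂
      obtain ⟨h1, h2⟩ := encode_injective hI h.leafArrays hi.le hu hu₂.of_succ hx hlt₂
        (henc.trans henc₂.symm)
      obtain ⟨c, hc, hf, h3, h4, h5⟩ := decode_back hI h.leafArrays hi hu₂ hx₂
      rw [← h2] at h3 h4 h5
      obtain rfl : C = c := h3
      have h6 : ∀ l < i + 1, u₂ l = v l := fun l hl => by
        rcases Nat.lt_succ_iff_lt_or_eq.1 hl with hl | rfl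
        · rw [← h1 l hl, huv l hl]
        · rw [← h5, ← hprop hf.1.1]
          exact (proposal_congr h1).symm
      have hvA := (alive_congr h6).1 hu₂
      refine ⟨h0, hvA, (isFirst_congr h6).1 hf, ?_⟩
      rw [hfirst hvA, ← first_congr h6, ← weight_congr h6]
      change q = _ at h4
      rw [h4, Nat.add_sub_cancel]
      exact hx₂

/-- Decoding a code succeeds exactly if it is the code of a tuple, and it keeps the tables. -/
theorem decode_ensures (hI : I.Valid) {B x : ℕ} (hB : 1 ≤ B) (hM : M.Small B) (h : I.Ready M)
    (hrem : M (.rem 0) 0 = x) (hx : x < M .codes 0) :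
    I.decodeStmt.Keeps B M ∧ I.Ready (I.decodeStmt.run M) ∧
      (∀ A, (∀ i, ∀ d ∈ I.levelDefs i, A ≠ d.name) → I.decodeStmt.run M A = M A) ∧
      I.Decoded I.k x (I.decodeStmt.run M) := by
  have key : ∀ i ≤ I.k,
      (Stmt.each i fun i => Def.stmt (I.levelDefs i)).Keeps B M ∧
      (∀ A, (∀ i, ∀ d ∈ I.levelDefs i, A ≠ d.name) →
        (Stmt.each i fun i => Def.stmt (I.levelDefs i)).run M A = M A) ∧
      I.Decoded i x ((Stmt.each i fun i => Def.stmt (I.levelDefs i)).run M) := by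
    intro i
    induction i with
    | zero => exact fun _ => ⟨trivial, fun _ _ => rfl, Decoded.zero h hrem hx⟩
    | succ i ih =>
      intro hi
      obtain ⟨h1, h2, h3⟩ := ih (by omega)
      obtain ⟨h4, h5, h6⟩ := level_decode hI hB hi (Stmt.small_run hM h1) (h.congr fun A hA =>
        h2 A fun i d hd hAd => by
          rw [hAd, Shape.isWork_of_mem_levelDefs d hd] at hA
          exact absurd hA (by simp)) h3
      exact ⟨⟨h1, h4⟩, fun A hA => (h5 A (hA i)).trans (h2 A hA), h6⟩
  obtain ⟨h1, h2, h3⟩ := key I.k le_rfl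
  refine ⟨h1, h.congr fun A hA => h2 A fun i d hd hAd => ?_, h2, h3⟩
  rw [hAd, Shape.isWork_of_mem_levelDefs d hd] at hA
  exact absurd hA (by simp)

end Inst

theorem Shape.wf_decodeStmt (S : Shape) : S.decodeStmt.Wf :=
  Stmt.wf_each fun i _ => Def.wf_stmt (S.wf_levelDefs i)

/-! ### The sampling program -/

namespace Shape

open JoinSampling.Expr

variable (S : Shape)

/-- Initialize the variables of the sampler. -/
def startStmt : Stmt := .seq (.setVar .go (const 1)) <| .seq (.setVar .rnd (const 0)) <|
  .seq (.setVar .flag (const 0)) (.setVar .res (const 0))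

/-- Stop with success. -/
def foundStmt : Stmt := .seq (.setVar .go (const 0)) (.setVar .res (const 1))

/-- Examine one more code deterministically. -/
def examineStmt : Stmt := .seq (.setVar (.rem 0) (var .rnd)) <| .seq S.decodeStmt <|
  .seq (.setVar .flag (var .flag + var (.ok S.k))) (.setVar .rnd (var .rnd + const 1))

/-- Stop if none of the codes that have been examined is the code of a tuple. -/
def stopStmt : Stmt := .ite (var .flag) (const 1) (.setVar .go (const 0)) .skip

/-- Try the random code in `rem 0`. If it is not the code of a tuple, examine one more code
deterministically, and give up if all of them have been examined and none is the code of a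
tuple. Thus the sampler stops even if the join is empty. -/
def attemptStmt : Stmt := .seq S.decodeStmt <| .ite (const 0) (var (.ok S.k)) foundStmt <|
  .ite (var .rnd) (var .codes) S.examineStmt stopStmt

theorem wf_startStmt : startStmt.Wf := by
  simp [startStmt, Stmt.Wf, Stmt.setVar]

theorem wf_attemptStmt : S.attemptStmt.Wf := by
  simp [attemptStmt, foundStmt, examineStmt, stopStmt, Stmt.Wf, Stmt.setVar, wf_decodeStmt, Name.IsVal]

end Shape

theorem Stmt.ite_pos {a b : Expr} {p q : Stmt} {M : Mem} (h : a.eval M < b.eval M) (B : ℕ) :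
    (ite a b p q).run M = p.run M ∧ ((ite a b p q).Keeps B M ↔ p.Keeps B M) :=
  ⟨if_pos h, iff_of_eq (if_pos h)⟩

theorem Stmt.ite_neg {a b : Expr} {p q : Stmt} {M : Mem} (h : ¬ a.eval M < b.eval M) (B : ℕ) :
    (ite a b p q).run M = q.run M ∧ ((ite a b p q).Keeps B M ↔ q.Keeps B M) :=
  ⟨if_neg h, iff_of_eq (if_neg h)⟩

namespace Inst

variable {I : Inst} {M : Mem} {B : ℕ}

variable (I) in
/-- `x` is the code of a tuple. -/
def IsCode (x : ℕ) : Prop := ∃ u, I.Alive I.k u ∧ I.encode I.k u 0 = x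

variable (I) in
/-- The number of codes. -/
noncomputable def size : ℕ := I.weight 0 0

theorem Ready.codes_eq (h : I.Ready M) : M .codes 0 = I.size := h.spec .codes (.inl (by simp)) 0

theorem Decoded.result (hI : I.Valid) {x : ℕ} (h : I.Decoded I.k x M) :
    (M (.ok I.k) 0 = 0 ∧ ¬ I.IsCode x) ∨ (M (.ok I.k) 0 = 1 ∧
      ∃ u, I.Alive I.k u ∧ I.encode I.k u 0 = x ∧ ∀ l < I.k, M (.out l) 0 = u l) := by
  rcases h with ⟨h0, h⟩ | ⟨h0, u, hu, hx, he, ho, -⟩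
  · refine .inl ⟨h0, fun ⟨u, hu, he⟩ => h u 0 hu ?_ he⟩
    rw [weight_k hI hu]
    exact Nat.one_pos
  · rw [weight_k hI hu, Nat.lt_one_iff] at hx
    rw [hx] at he
    exact .inr ⟨h0, u, hu, he, ho⟩

/-- The memory holds what is needed for sampling, and the stored numbers are bounded. -/
structure Stable (I : Inst) (B : ℕ) (M : Mem) : Prop where
  ready : I.Ready M
  small : M.Small B

open Classical in
/-- The number of codes of tuples among the first `x` codes. -/
noncomputable def codesBelow (I : Inst) (x : ℕ) : ℕ := ((Finset.range x).filter I.IsCode).card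

/-- The situation before a round of the sampler. -/
structure Searching (I : Inst) (B r : ℕ) (M : Mem) : Prop extends Stable I B M where
  go : M .go 0 = 1
  res : M .res 0 = 0
  rnd : M .rnd 0 = r
  rnd_le : r ≤ I.size
  flag : M .flag 0 = I.codesBelow r

open Classical in
theorem codesBelow_succ (x : ℕ) : I.codesBelow (x + 1) = I.codesBelow x +
    if I.IsCode x then 1 else 0 := by
  unfold codesBelow
  rw [Finset.range_add_one, Finset.filter_insert]
  split_ifs
  · rw [Finset.card_insert_of_notMem (by simp)]
  · rfl

theorem codesBelow_le (x : ℕ) : I.codesBelow x ≤ x := by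
  classical
  exact (Finset.card_filter_le _ _).trans (Finset.card_range x).le

theorem stable_set (h : I.Stable B M) {A : Name} {v : ℕ} (hA : A.IsWork = true) (hv : v ≤ B) :
    I.Stable B (M.set A 0 v) :=
  ⟨h.ready.congr fun A' hA' => Mem.set_of_ne _ _ _ fun h => by simp [h, hA] at hA',
    h.small.set (.inr hv)⟩

theorem stable_decode (hI : I.Valid) (hB : 1 ≤ B) (h : I.Stable B M) {x : ℕ} (hx : x < I.size) :
    I.decodeStmt.Keeps B (M.set (.rem 0) 0 x) ∧
    I.Stable B (I.decodeStmt.run (M.set (.rem 0) 0 x)) ∧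
    (∀ A ∈ ({.codes, .go, .rnd, .flag, .res} : Set Name),
      I.decodeStmt.run (M.set (.rem 0) 0 x) A = M A) ∧
    ((I.decodeStmt.run (M.set (.rem 0) 0 x) (.ok I.k) 0 = 0 ∧ ¬ I.IsCode x) ∨
      (I.decodeStmt.run (M.set (.rem 0) 0 x) (.ok I.k) 0 = 1 ∧
      ∃ u, I.Alive I.k u ∧ I.encode I.k u 0 = x ∧
        ∀ l < I.k, I.decodeStmt.run (M.set (.rem 0) 0 x) (.out l) 0 = u l)) := by
  have hcodes := h.ready.codes_eq
  have hPB : I.size ≤ B := hcodes ▸ h.small .codes rfl 0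
  have h' := stable_set (A := .rem 0) h rfl (hx.le.trans hPB)
  obtain ⟨h1, h2, h3, h4⟩ := decode_ensures hI hB h'.small h'.ready
    (x := x) (by simp [Mem.set_apply]) (by rw [h'.ready.codes_eq]; exact hx)
  refine ⟨h1, ⟨h2, Stmt.small_run h'.small h1⟩, fun A hA => ?_, h4.result hI⟩
  rw [h3 A, Mem.set_of_ne]
  · rintro rfl; simp at hA
  · rintro i d hd rfl
    simp only [Shape.levelDefs, List.mem_cons, List.not_mem_nil, or_false] at hd
    rcases hd with rfl | rfl | rfl | rfl | rfl | rfl | rfl | rfl | rfl <;> simp at hA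

theorem start_spec (h : I.Stable B M) (hB : 1 ≤ B) :
    Shape.startStmt.Keeps B M ∧ I.Searching B 0 (Shape.startStmt.run M) := by
  refine ⟨⟨.inr hB, .inr (Nat.zero_le _), .inr (Nat.zero_le _), .inr (Nat.zero_le _)⟩, ?_⟩
  refine ⟨stable_set (stable_set (stable_set (stable_set h rfl ?_) rfl ?_) rfl ?_) rfl ?_,
    ?_, ?_, ?_, Nat.zero_le _, ?_⟩
  all_goals simp [Shape.startStmt, Stmt.setVar, Stmt.run, Mem.set_apply, hB, codesBelow]

/-- The possible outcomes of a round with random code `x` when `r` codes have been examined. -/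
inductive Outcome (I : Inst) (B r x : ℕ) (M : Mem) : Prop
  | found (u : ℕ → ℕ) (alive : I.Alive I.k u) (code : I.encode I.k u 0 = x)
      (stable : I.Stable B M) (go : M .go 0 = 0) (res : M .res 0 = 1)
      (out : ∀ l < I.k, M (.out l) 0 = u l)
  | retry (code : ¬ I.IsCode x) (more : r < I.size ∨ I.codesBelow I.size ≠ 0)
      (searching : I.Searching B (min (r + 1) I.size) M)
  | empty (code : ¬ I.IsCode x) (all : r = I.size) (none : I.codesBelow I.size = 0)
      (stable : I.Stable B M) (go : M .go 0 = 0) (res : M .res 0 = 0)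

/-- After `r` failed rounds, the codes `0, …, r - 1` have been examined deterministically. -/
theorem attempt_spec (hI : I.Valid) (hB : 1 ≤ B) {r x : ℕ} (h : I.Searching B r M)
    (hx : x < I.size) :
    I.attemptStmt.Keeps B (M.set (.rem 0) 0 x) ∧
      I.Outcome B r x (I.attemptStmt.run (M.set (.rem 0) 0 x)) := by
  obtain ⟨hk, hs, hf, hres⟩ := stable_decode hI hB h.toStable hx
  unfold Shape.attemptStmt
  simp only [Stmt.Keeps.eq_3, Stmt.run.eq_3]
  rw [and_assoc, and_iff_right hk]
  set M₁ := I.decodeStmt.run (M.set (.rem 0) 0 x)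
  have hcodes := hs.ready.codes_eq
  have hPB : I.size ≤ B := hcodes ▸ hs.small .codes rfl 0
  have hrnd : M₁ .rnd 0 = r := by rw [hf _ (by simp), h.rnd]
  have hflag : M₁ .flag 0 = I.codesBelow r := by rw [hf _ (by simp), h.flag]
  have hgo : M₁ .go 0 = 1 := by rw [hf _ (by simp), h.go]
  have hres0 : M₁ .res 0 = 0 := by rw [hf _ (by simp), h.res]
  rcases hres with ⟨h0, hno⟩ | ⟨h0, u, hu, he, ho⟩
  · have h1 : ¬ (Expr.const 0).eval M₁ < (Expr.var (.ok I.k)).eval M₁ := by simp [h0]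
    rw [(Stmt.ite_neg h1 B).1, (Stmt.ite_neg h1 B).2]
    by_cases hr : r < I.size
    · have h2 : (Expr.var .rnd).eval M₁ < (Expr.var .codes).eval M₁ := by
        simpa [hrnd, hcodes] using hr
      rw [(Stmt.ite_pos h2 B).1, (Stmt.ite_pos h2 B).2]
      obtain ⟨hk₂, hs₂, hf₂, hres₂⟩ := stable_decode hI hB hs hr
      simp only [Shape.examineStmt, Stmt.setVar, Stmt.Keeps, Stmt.run, Expr.eval_const,
        Expr.eval_var, Expr.eval_add, hrnd]
      set M₂ := I.decodeStmt.run (M₁.set (.rem 0) 0 r)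
      have hflag₂ : M₂ .flag 0 + M₂ (.ok I.k) 0 = I.codesBelow (r + 1) := by
        rw [codesBelow_succ, hf₂ _ (by simp), hflag]
        rcases hres₂ with ⟨h1, h2⟩ | ⟨h1, u, hu, he, -⟩
        · rw [h1, if_neg h2]
        · rw [h1, if_pos ⟨u, hu, he⟩]
      have hrnd₂ : M₂ .rnd 0 = r := by rw [hf₂ _ (by simp), hrnd]
      have hle := codesBelow_le (I := I) (r + 1)
      rw [hflag₂]
      have hset : (M₂.set .flag 0 (I.codesBelow (r + 1))) .rnd 0 = r := by
        simp [Mem.set_apply, hrnd₂]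
      rw [hset]
      refine ⟨⟨.inr (by omega), hk₂, .inr (by omega), .inr (by omega)⟩, .retry hno (.inl hr) ?_⟩
      rw [min_eq_left hr]
      refine ⟨stable_set (stable_set hs₂ rfl (by omega)) rfl (by omega), ?_, ?_, ?_, hr, ?_⟩
      · simp [Mem.set_apply, hf₂ .go, hgo]
      · simp [Mem.set_apply, hf₂ .res, hres0]
      · simp [Mem.set_apply]
      · simp [Mem.set_apply]
    · obtain rfl : r = I.size := le_antisymm h.rnd_le (not_lt.1 hr)
      have h2 : ¬ (Expr.var .rnd).eval M₁ < (Expr.var .codes).eval M₁ := by simp [hrnd, hcodes]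
      rw [(Stmt.ite_neg h2 B).1, (Stmt.ite_neg h2 B).2]
      by_cases hc : I.codesBelow I.size = 0
      · have h3 : (Expr.var .flag).eval M₁ < (Expr.const 1).eval M₁ := by simp [hflag, hc]
        rw [Shape.stopStmt, (Stmt.ite_pos h3 B).1, (Stmt.ite_pos h3 B).2]
        refine ⟨.inr (Nat.zero_le _), .empty hno rfl hc
          (stable_set hs rfl (Nat.zero_le _)) ?_ ?_⟩
        · simp [Stmt.setVar, Stmt.run, Mem.set_apply]
        · simp [Stmt.setVar, Stmt.run, Mem.set_apply, hres0]
      · have h3 : ¬ (Expr.var .flag).eval M₁ < (Expr.const 1).eval M₁ := by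
          rw [Expr.eval_var, hflag, Expr.eval_const]
          omega
        rw [Shape.stopStmt, (Stmt.ite_neg h3 B).1, (Stmt.ite_neg h3 B).2]
        refine ⟨trivial, .retry hno (.inr hc) ?_⟩
        rw [min_eq_right (Nat.le_succ _)]
        exact ⟨hs, hgo, hres0, hrnd, le_rfl, hflag⟩
  · have h1 : (Expr.const 0).eval M₁ < (Expr.var (.ok I.k)).eval M₁ := by simp [h0]
    rw [(Stmt.ite_pos h1 B).1, (Stmt.ite_pos h1 B).2]
    refine ⟨⟨.inr (Nat.zero_le _), .inr hB⟩, .found u hu he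
      (stable_set (stable_set hs rfl (Nat.zero_le _)) rfl hB) ?_ ?_ fun l hl => ?_⟩
    · simp [Shape.foundStmt, Stmt.setVar, Stmt.run, Mem.set_apply]
    · simp [Shape.foundStmt, Stmt.setVar, Stmt.run, Mem.set_apply]
    · simp [Shape.foundStmt, Stmt.setVar, Stmt.run, Mem.set_apply, ho l hl]

end Inst

/-! ### The sampler on the machine -/

namespace Shape

open JoinSampling.Expr

variable (S : Shape) (K : ℕ)

/-- One round of the sampler. -/
def roundProg : Prog := .seq ((var .codes).compile K 2) <| .seq (.rand 2 2) <|
  .seq (.const 3 0) <| .seq (.store ((Name.rem 0).code K) 3 2) <|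
  .seq (S.attemptStmt.compile K) ((var .go).compile K 1)

/-- The loop of the sampler. Register `0` is `0`, and register `1` holds the variable `go`. -/
def loopProg : Prog := .whileLt 0 1 (S.roundProg K)

/-- Put attributes `0, …, n - 1` into the registers that hold the answer. -/
def outProg (pos : ℕ → ℕ) (n : ℕ) : Prog :=
  Nat.rec .skip (fun a p => .seq p ((var (.out (pos a))).compile K (a + 1))) n

/-- Put the answer into the registers. -/
def finishProg (pos : ℕ → ℕ) : Prog := .seq ((var .res).compile K 0) (outProg K pos S.k)

/-- The sampler. -/
def sampProg (pos : ℕ → ℕ) : Prog := .seq (startStmt.compile K) <| .seq (.const 0 0) <|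
  .seq ((var .go).compile K 1) <| .seq (S.loopProg K) (S.finishProg K pos)

end Shape

theorem Expr.compile_var {w K : ℕ} {M : Mem} (A : Name) (d : ℕ) (s : State) (hs : s.Holds K M)
    (R : List Prog) : ∃ s' : State, Det w ((Expr.var A).compile K d :: R, s) 3 (R, s') ∧
      s'.Holds K M ∧ s'.reg d = M A 0 ∧ ∀ r < d, s'.reg r = s.reg r := by
  obtain ⟨s', h1, h2, h3, h4⟩ := (Expr.var A).compile_spec (w := w) d s hs R
  exact ⟨s', h1, hs.congr h2, by simpa [Expr.var, Expr.wordEval] using h3, h4⟩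

theorem Shape.outProg_spec {w K : ℕ} {M : Mem} (pos : ℕ → ℕ) (n : ℕ) (s : State)
    (hs : s.Holds K M) (R : List Prog) : ∃ s' : State,
      Det w (outProg K pos n :: R, s) (4 * n + 1) (R, s') ∧ s'.Holds K M ∧
      s'.reg 0 = s.reg 0 ∧ ∀ a < n, s'.reg (a + 1) = M (.out (pos a)) 0 := by
  induction n generalizing R with
  | zero => exact ⟨s, Det.one rfl, hs, rfl, fun a ha => by omega⟩
  | succ n ih =>
    obtain ⟨s1, h1, h2, h3, h4⟩ := ih ((Expr.var (.out (pos n))).compile K (n + 1) :: R)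
    obtain ⟨s2, h5, h6, h7, h8⟩ := Expr.compile_var (w := w) (.out (pos n)) (n + 1) s1 h2 R
    refine ⟨s2, ?_, h6, (h8 0 (by omega)).trans h3, fun a ha => ?_⟩
    · have := ((Det.seq w (outProg K pos n) ((Expr.var (.out (pos n))).compile K (n + 1)) R s).trans
        h1).trans h5
      rw [show 4 * (n + 1) + 1 = 1 + (4 * n + 1) + 3 by ring]
      exact this
    · rcases Nat.lt_succ_iff_lt_or_eq.1 ha with ha | rfl
      exacts [(h8 _ (by omega)).trans (h4 a ha), h7]

theorem Shape.finishProg_spec {w K : ℕ} {M : Mem} (S : Shape) (pos : ℕ → ℕ) (s : State)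
    (hs : s.Holds K M) : ∃ s' : State,
      Det w ([S.finishProg K pos], s) (4 * S.k + 5) ([], s') ∧ s'.Holds K M ∧
      answer S.k s' = if M .res 0 = 0 then none else some fun a : Fin S.k => M (.out (pos a)) 0 := by
  obtain ⟨s1, h1, h2, h3, -⟩ := Expr.compile_var (w := w) .res 0 s hs [outProg K pos S.k]
  obtain ⟨s2, h4, h5, h6, h7⟩ := outProg_spec (w := w) pos S.k s1 h2 []
  refine ⟨s2, ?_, h5, ?_⟩
  · have := ((Det.seq w _ _ [] s).trans h1).trans h4
    rw [show 4 * S.k + 5 = 1 + 3 + (4 * S.k + 1) by ring]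
    exact this
  · rw [answer, h6, h3]
    split_ifs
    · rfl
    · congr 1
      funext a
      exact h7 a a.2

namespace Inst

variable (I : Inst) (B K : ℕ)

/-- The machine is ready for sampling. -/
def Good (s : State) : Prop := ∃ M : Mem, s.Holds K M ∧ I.Stable B M

/-- The machine is about to start a round of the sampler. If there are no tuples, it will be one
of the last `l` rounds. -/
def AtRound (l : ℕ) (s : State) : Prop :=
  ∃ M r, s.Holds K M ∧ s.reg 0 = 0 ∧ s.reg 1 = 1 ∧ I.Searching B r M ∧ r + l = I.size + 1

/-- An upper bound for the time of a round, including the initialization before the first round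
and the output after the last one. -/
def roundCost (I : Inst) : ℕ :=
  Shape.startStmt.cost + I.attemptStmt.cost + 4 * I.k + 40

variable {I B K} {w : ℕ}

theorem start_machine (hB : 2 ≤ B) (hd : B ^ Shape.startStmt.degree < 2 ^ w) (pos : ℕ → ℕ)
    {s : State} (hs : I.Good B K s) : ∃ n ≤ I.roundCost, ∃ s',
      Det w ([I.sampProg K pos], s) n ([I.loopProg K, I.finishProg K pos], s') ∧
      I.AtRound B K (I.size + 1) s' := by
  obtain ⟨M, hM, hst⟩ := hs
  obtain ⟨h1, h2⟩ := start_spec hst (by omega)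
  obtain ⟨n, hn, s1, h3, h4, -, -⟩ := Shape.startStmt.compile_spec hB M hst.small h1
    Shape.wf_startStmt hd s hM [.seq (.const 0 0) (.seq ((Expr.var .go).compile K 1)
      (.seq (I.loopProg K) (I.finishProg K pos)))]
  obtain ⟨s2, h5, h6, h7, h8⟩ := Expr.compile_var (w := w) .go 1 (s1.setReg 0 (0 % 2 ^ w)) h4
    [.seq (I.loopProg K) (I.finishProg K pos)]
  refine ⟨_, ?_, s2, (((((Det.seq w _ _ [] s).trans h3).trans (Det.seq w _ _ _ _)).trans
    (Det.one rfl)).trans ((Det.seq w _ _ _ _).trans h5)).trans (Det.seq w _ _ _ _), ?_⟩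
  · unfold roundCost
    omega
  · refine ⟨_, 0, h6, ?_, h7.trans h2.go, h2, by omega⟩
    rw [h8 0 (by omega)]
    simp [State.setReg]

/-- The possible results of a round that draws the code `v`, started when `l` more rounds are
allowed. -/
inductive RoundResult (I : Inst) (B K w : ℕ) (pos : ℕ → ℕ) (l v : ℕ) (c : Config) : Prop
  | found (u : ℕ → ℕ) (alive : I.Alive I.k u) (code : I.encode I.k u 0 = v) (n : ℕ)
      (time : n ≤ I.roundCost) (s : State) (det : Det w c n ([], s)) (good : I.Good B K s)
      (ans : answer I.k s = some fun a : Fin I.k => u (pos a))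
  | retry (code : ¬ I.IsCode v) (n : ℕ) (time : n ≤ I.roundCost) (s : State)
      (det : Det w c n ([I.loopProg K, I.finishProg K pos], s))
      (l' : ℕ) (round : I.AtRound B K l' s) (left : I.codesBelow I.size = 0 → l = l' + 1)
  | empty (none : I.codesBelow I.size = 0) (n : ℕ)
      (time : n ≤ I.roundCost) (s : State) (det : Det w c n ([], s)) (good : I.Good B K s)
      (ans : answer I.k s = Option.none)

theorem round_machine (hI : I.Valid) (hB : 2 ≤ B) (hd : B ^ I.attemptStmt.degree < 2 ^ w)
    {pos : ℕ → ℕ} (hpos : ∀ a < I.k, pos a < I.k) {s : State} {l : ℕ}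
    (hs : I.AtRound B K l s) : ∃ n ≤ I.roundCost, ∃ R s₁,
      Det w ([I.loopProg K, I.finishProg K pos], s) n (.rand 2 2 :: R, s₁) ∧
      s₁.reg 2 = I.size ∧
      ∀ v < I.size, I.RoundResult B K w pos l v (R, s₁.setReg 2 v) := by
  obtain ⟨M, r, hM, h0, h1, hsearch, hr⟩ := hs
  obtain ⟨s₁, h2, h3, h4, h5⟩ := Expr.compile_var (w := w) .codes 2 s hM
    (.seq (.rand 2 2) (.seq (.const 3 0) (.seq (.store ((Name.rem 0).code K) 3 2)
      (.seq (I.attemptStmt.compile K) ((Expr.var .go).compile K 1)))) ::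
      [I.loopProg K, I.finishProg K pos])
  have hwhile : Det w ([I.loopProg K, I.finishProg K pos], s) 1
      (I.roundProg K :: [I.loopProg K, I.finishProg K pos], s) := by
    refine Det.one ?_
    rw [Shape.loopProg, step, if_pos (by omega)]
  refine ⟨_, ?_, _, s₁, ((hwhile.trans (Det.seq w _ _ _ _)).trans h2).trans (Det.seq w _ _ _ _),
    h4.trans hsearch.ready.codes_eq, fun v hv => ?_⟩
  · unfold roundCost
    omega
  obtain ⟨hk, hout⟩ := attempt_spec hI (by omega) hsearch hv
  have hcodes := hsearch.ready.codes_eq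
  have hPB : I.size ≤ B := hcodes ▸ hsearch.small .codes rfl 0
  have hst := stable_set (A := .rem 0) hsearch.toStable rfl (hv.le.trans hPB)
  set s₂ := (s₁.setReg 2 v).setReg 3 (0 % 2 ^ w)
  set s₃ := s₂.setArr ((Name.rem 0).code K) (s₂.reg 3) (s₂.reg 2)
  have hs₃ : s₃.Holds K (M.set (.rem 0) 0 v) := by
    have e1 : s₂.reg 3 = 0 := by simp [s₂, State.setReg]
    have e2 : s₂.reg 2 = v := by simp [s₂, State.setReg]
    have := State.Holds.setArr (s := s₂) (State.holds_setReg (State.holds_setReg h3 2 v) 3 _)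
      (.rem 0) 0 v
    simp only [s₃, e1, e2]
    exact this
  obtain ⟨n, hn, s₄, h6, h7, -, h8⟩ := I.attemptStmt.compile_spec hB _ hst.small hk
    I.wf_attemptStmt hd s₃ hs₃
    ((Expr.var .go).compile K 1 :: [I.loopProg K, I.finishProg K pos])
  set M' := I.attemptStmt.run (M.set (.rem 0) 0 v)
  obtain ⟨s₅, h9, h10, h11, h12⟩ := Expr.compile_var (w := w) .go 1 s₄ h7
    [I.loopProg K, I.finishProg K pos]
  have h13 : s₅.reg 0 = 0 := by
    rw [h12 0 (by omega), h8 0 (by omega)]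
    simp only [s₃, s₂, State.setArr, State.setReg]
    rw [Function.update_of_ne (by omega), Function.update_of_ne (by omega), h5 0 (by omega), h0]
  have hdet : Det w (.seq (.const 3 0) (.seq (.store ((Name.rem 0).code K) 3 2)
      (.seq (I.attemptStmt.compile K) ((Expr.var .go).compile K 1))) ::
      [I.loopProg K, I.finishProg K pos], s₁.setReg 2 v) (5 + n + 3)
      ([I.loopProg K, I.finishProg K pos], s₅) :=
    ((((((Det.seq w _ _ _ _).trans (Det.one rfl)).trans (Det.seq w _ _ _ _)).trans
      (Det.one rfl)).trans (Det.seq w _ _ _ _)).trans h6).trans h9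
  have hexit : M' .go 0 = 0 → Det w ([I.loopProg K, I.finishProg K pos], s₅) 1
      ([I.finishProg K pos], s₅) := by
    intro hgo
    refine Det.one ?_
    rw [Shape.loopProg, step, if_neg (by omega)]
  obtain ⟨s₆, h14, h15, h16⟩ := I.finishProg_spec (w := w) pos s₅ h10
  have htime : 5 + n + 3 + 1 + (4 * I.k + 5) ≤ I.roundCost := by
    unfold roundCost
    omega
  rcases hout with ⟨u, hu, he, hstab, hgo, hres, ho⟩ | ⟨hno, hmore, hse⟩ |
    ⟨hno, hall, hnone, hstab, hgo, hres⟩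
  · refine .found u hu he _ htime s₆ ((hdet.trans (hexit hgo)).trans h14) ⟨M', h15, hstab⟩ ?_
    rw [h16, hres, if_neg one_ne_zero]
    congr 1
    funext a
    exact ho _ (hpos a a.2)
  · refine .retry hno _ (by omega) s₅ hdet (I.size + 1 - min (r + 1) I.size)
      ⟨M', _, h10, h13, h11.trans hse.go, hse, by omega⟩ fun h => ?_
    have hlt : r < I.size := hmore.resolve_right fun h' => h' h
    omega
  · refine .empty hnone _ htime s₆ ((hdet.trans (hexit hgo)).trans h14) ⟨M', h15, hstab⟩ ?_
    rw [h16, hres, if_pos rfl]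

end Inst

/-! ### The distribution of the answers and the running time of the sampler -/

theorem natCast_mul_eq_add {P f : ℕ} (hfP : f ≤ P) (S : ℝ≥0∞) :
    (P : ℝ≥0∞) * S = f * S + (P - f : ℕ) * S := by
  rw [← add_mul, ← Nat.cast_add, Nat.add_sub_cancel' hfP]

theorem mul_add_inv_mul {P d : ℕ} (hP : 0 < P) (a S : ℝ≥0∞) :
    (P : ℝ≥0∞) * (a + (P : ℝ≥0∞)⁻¹ * (d * S)) = P * a + d * S := by
  rw [mul_add, ← mul_assoc (P : ℝ≥0∞), ENNReal.mul_inv_cancel (by simp; omega)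
    (ENNReal.natCast_ne_top P), one_mul]

/-- An upper bound for the value of a process that stops with value at most `a` in a step, and
goes on with probability `(P - f) / P`. -/
theorem le_of_restart {α : Type*} {p : α → Prop} {H : α → ℝ≥0∞} {b : ℝ≥0∞} (hb : b ≠ ∞)
    (hH : ∀ s, p s → H s ≤ b) {P f : ℕ} (hf : 0 < f) (hfP : f ≤ P) {a : ℝ≥0∞}
    (hstep : ∀ s, p s → ∀ S, (∀ s', p s' → H s' ≤ S) →
      H s ≤ a + (P : ℝ≥0∞)⁻¹ * ((P - f : ℕ) * S)) (s : α) (hs : p s) : H s ≤ a * P / f := by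
  set S := ⨆ s, ⨆ _ : p s, H s
  have hle : ∀ s', p s' → H s' ≤ S := fun s' hs' => le_iSup₂ (f := fun s (_ : p s) => H s) s' hs'
  have hS : S ≤ a + (P : ℝ≥0∞)⁻¹ * ((P - f : ℕ) * S) := iSup₂_le fun s hs => hstep s hs S hle
  have hfin : S ≠ ∞ := ne_top_of_le_ne_top hb (iSup₂_le hH)
  have h1 := mul_le_mul_right hS (P : ℝ≥0∞)
  rw [mul_add_inv_mul (by omega), natCast_mul_eq_add hfP S, ENNReal.add_le_add_iff_right
    (ENNReal.mul_ne_top (ENNReal.natCast_ne_top _) hfin)] at h1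
  refine (hle s hs).trans ?_
  rw [ENNReal.le_div_iff_mul_le (.inl (by simp; omega)) (.inl (ENNReal.natCast_ne_top f)),
    mul_comm, mul_comm a]
  exact h1

/-- A lower bound for the value of a process that stops with value at least `a` in a step, and
goes on with probability `(P - f) / P`. -/
theorem ge_of_restart {α : Type*} {p : α → Prop} {H : α → ℝ≥0∞} {b : ℝ≥0∞} (hb : b ≠ ∞)
    (hH : ∀ s, p s → H s ≤ b) {P f : ℕ} (hf : 0 < f) (hfP : f ≤ P) {a : ℝ≥0∞}
    (hstep : ∀ s, p s → ∀ S, (∀ s', p s' → S ≤ H s') →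
      a + (P : ℝ≥0∞)⁻¹ * ((P - f : ℕ) * S) ≤ H s) (s : α) (hs : p s) : a * P / f ≤ H s := by
  set S := ⨅ s, ⨅ _ : p s, H s
  have hle : ∀ s', p s' → S ≤ H s' := fun s' hs' => iInf₂_le (f := fun s (_ : p s) => H s) s' hs'
  have hS : a + (P : ℝ≥0∞)⁻¹ * ((P - f : ℕ) * S) ≤ S := le_iInf₂ fun s hs => hstep s hs S hle
  have hfin : S ≠ ∞ := ne_top_of_le_ne_top hb ((hle s hs).trans (hH s hs))
  have h1 := mul_le_mul_right hS (P : ℝ≥0∞)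
  rw [mul_add_inv_mul (by omega), natCast_mul_eq_add hfP S, ENNReal.add_le_add_iff_right
    (ENNReal.mul_ne_top (ENNReal.natCast_ne_top _) hfin)] at h1
  refine le_trans ?_ (hle s hs)
  rw [ENNReal.div_le_iff_le_mul (.inl (by simp; omega)) (.inl (ENNReal.natCast_ne_top f)),
    mul_comm, mul_comm S]
  exact h1

namespace Inst

variable (I : Inst) {B K w : ℕ} {pos : ℕ → ℕ}

open Classical in
/-- The codes of tuples. -/
noncomputable def codeSet : Finset ℕ := (Finset.range I.size).filter I.IsCode

open Classical in
/-- The tuple with code `v`. -/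
noncomputable def codeTuple (v : ℕ) : ℕ → ℕ := if h : I.IsCode v then h.choose else 0

/-- The expectation of a function of the answer if the tuple of a uniformly random code is
returned. -/
noncomputable def law (pos : ℕ → ℕ) (G : Option (Fin I.k → ℕ) → ℝ≥0∞) : ℝ≥0∞ :=
  if I.codeSet = ∅ then G none else
    (I.codeSet.card : ℝ≥0∞)⁻¹ * ∑ v ∈ I.codeSet, G (some fun a => I.codeTuple v (pos a))

variable {I}

theorem codesBelow_size : I.codesBelow I.size = I.codeSet.card := rfl

theorem codeSet_card_le : I.codeSet.card ≤ I.size := codesBelow_le _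

theorem mem_codeSet {v : ℕ} : v ∈ I.codeSet ↔ v < I.size ∧ I.IsCode v := by
  simp [codeSet]

theorem size_pos (hI : I.Valid) : 0 < I.size := weight_pos hI

theorem codeTuple_eq (hI : I.Valid) {leaf : ℕ → ℕ → ℕ} (hleaf : I.LeafArrays leaf)
    {u : ℕ → ℕ} (hu : I.Alive I.k u) {l : ℕ} (hl : l < I.k) :
    I.codeTuple (I.encode I.k u 0) l = u l := by
  have h : I.IsCode (I.encode I.k u 0) := ⟨u, hu, rfl⟩
  obtain ⟨h1, h2⟩ := h.choose_spec
  rw [codeTuple, dif_pos h]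
  refine (encode_injective hI hleaf le_rfl h1 hu ?_ ?_ h2).1 l hl
  · rw [weight_k hI h1]; exact Nat.one_pos
  · rw [weight_k hI hu]; exact Nat.one_pos

theorem AtRound.leafArrays {l : ℕ} {s : State} (h : I.AtRound B K l s) :
    ∃ leaf, I.LeafArrays leaf := by
  obtain ⟨M, r, -, -, -, h, -⟩ := h
  exact ⟨_, h.ready.leafArrays⟩

/-- What is known about the sampler once the word length is large enough. -/
structure Setting (I : Inst) (B w : ℕ) (pos : ℕ → ℕ) : Prop where
  valid : I.Valid
  two_le : 2 ≤ B
  start : B ^ Shape.startStmt.degree < 2 ^ w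
  attempt : B ^ I.attemptStmt.degree < 2 ^ w
  pos_lt : ∀ a < I.k, pos a < I.k

theorem codeSet_subset : I.codeSet ⊆ Finset.range I.size :=
  fun _ hv => Finset.mem_range.2 (mem_codeSet.1 hv).1

theorem sum_split (F : ℕ → ℝ≥0∞) : ∑ v ∈ Finset.range I.size, F v =
    ∑ v ∈ I.codeSet, F v + ∑ v ∈ Finset.range I.size \ I.codeSet, F v := by
  rw [add_comm, Finset.sum_sdiff codeSet_subset]

theorem card_sdiff : (Finset.range I.size \ I.codeSet).card = I.size - I.codeSet.card := by
  rw [Finset.card_sdiff_of_subset codeSet_subset, Finset.card_range]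

theorem inv_mul_const {P : ℕ} (hP : 0 < P) (S : ℝ≥0∞) : (P : ℝ≥0∞)⁻¹ * (P * S) = S := by
  rw [← mul_assoc, ENNReal.inv_mul_cancel (by simp; omega) (ENNReal.natCast_ne_top P), one_mul]

/-- The expectation of a function of the answer at the beginning of a round. -/
theorem round_law (h : I.Setting B w pos) {g : State → ℝ≥0∞}
    {G : Option (Fin I.k → ℕ) → ℝ≥0∞} (hg : ∀ s, I.Good B K s → g s = G (answer I.k s))
    (hg1 : ∀ s, g s ≤ 1) {l : ℕ} {s : State} (hs : I.AtRound B K l s) :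
    haltExpect w g ([I.loopProg K, I.finishProg K pos], s) = I.law pos G := by
  have hP := size_pos h.valid
  by_cases hF : I.codeSet = ∅
  · rw [law, if_pos hF]
    have hnone : I.codesBelow I.size = 0 := by rw [codesBelow_size, hF, Finset.card_empty]
    induction l generalizing s with
    | zero =>
      obtain ⟨M, r, -, -, -, h1, h2⟩ := hs
      have := h1.rnd_le
      omega
    | succ l ih =>
      obtain ⟨n, -, R, s₁, hdet, hreg, hres⟩ :=
        round_machine h.valid h.two_le h.attempt h.pos_lt hs
      rw [hdet.haltExpect, haltExpect_rand (by omega), hreg]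
      rw [Finset.sum_congr rfl (g := fun _ => G none), Finset.sum_const, Finset.card_range,
        nsmul_eq_mul, inv_mul_const hP]
      intro v hv
      rw [Finset.mem_range] at hv
      rcases hres v hv with ⟨u, hu, he, -⟩ | ⟨-, n, -, s', hdet', l', hr, hl⟩ |
        ⟨-, n, -, s', hdet', hgood, hans⟩
      · have : v ∈ I.codeSet := mem_codeSet.2 ⟨hv, u, hu, he⟩
        simp [hF] at this
      · obtain rfl : l' = l := by have := hl hnone; omega
        rw [hdet'.haltExpect, ih hr]
      · rw [hdet'.haltExpect, haltExpect_halted, hg _ hgood, hans]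
  · rw [law, if_neg hF]
    have hf : 0 < I.codeSet.card := Finset.card_pos.2 (Finset.nonempty_iff_ne_empty.2 hF)
    set A := ∑ v ∈ I.codeSet, G (some fun a => I.codeTuple v (pos a))
    -- One round, in terms of the situations in which it may leave the machine.
    have hstep : ∀ s, (∃ l, I.AtRound B K l s) → ∃ t : ℕ → State,
        (∀ v ∈ Finset.range I.size \ I.codeSet, ∃ l, I.AtRound B K l (t v)) ∧
        haltExpect w g ([I.loopProg K, I.finishProg K pos], s) = (I.size : ℝ≥0∞)⁻¹ * A +
          (I.size : ℝ≥0∞)⁻¹ * ∑ v ∈ Finset.range I.size \ I.codeSet,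
            haltExpect w g ([I.loopProg K, I.finishProg K pos], t v) := by
      rintro s ⟨l, hs⟩
      obtain ⟨leaf, hleaf⟩ := hs.leafArrays
      obtain ⟨n, -, R, s₁, hdet, hreg, hres⟩ :=
        round_machine h.valid h.two_le h.attempt h.pos_lt hs
      have hcode : ∀ v ∈ I.codeSet, haltExpect w g (R, s₁.setReg 2 v) =
          G (some fun a => I.codeTuple v (pos a)) := by
        intro v hv
        obtain ⟨hv, hvc⟩ := mem_codeSet.1 hv
        rcases hres v hv with ⟨u, hu, rfl, n, -, s', hdet', hgood, hans⟩ | ⟨hno, -⟩ | ⟨hno, -⟩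
        · rw [hdet'.haltExpect, haltExpect_halted, hg _ hgood, hans]
          congr 2
          funext a
          exact (codeTuple_eq h.valid hleaf hu (h.pos_lt a a.2)).symm
        · exact absurd hvc hno
        · rw [codesBelow_size] at hno
          omega
      have hrest : ∀ v, ∃ s', v ∈ Finset.range I.size \ I.codeSet → (∃ l, I.AtRound B K l s') ∧
          haltExpect w g (R, s₁.setReg 2 v) =
            haltExpect w g ([I.loopProg K, I.finishProg K pos], s') := by
        intro v
        by_cases hv : v ∈ Finset.range I.size \ I.codeSet
        · obtain ⟨hv1, hv2⟩ := Finset.mem_sdiff.1 hv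
          rw [Finset.mem_range] at hv1
          rcases hres v hv1 with ⟨u, hu, he, -⟩ | ⟨-, n, -, s', hdet', l', hr, -⟩ | ⟨hno, -⟩
          · exact absurd (mem_codeSet.2 ⟨hv1, u, hu, he⟩) hv2
          · exact ⟨s', fun _ => ⟨⟨l', hr⟩, hdet'.haltExpect g⟩⟩
          · rw [codesBelow_size] at hno
            omega
        · exact ⟨s, fun h => absurd h hv⟩
      choose t ht using hrest
      refine ⟨t, fun v hv => (ht v hv).1, ?_⟩
      rw [hdet.haltExpect, haltExpect_rand (by omega), hreg, sum_split, mul_add,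
        Finset.sum_congr rfl hcode, Finset.sum_congr rfl fun v hv => (ht v hv).2]
    have hval : (I.codeSet.card : ℝ≥0∞)⁻¹ * A =
        (I.size : ℝ≥0∞)⁻¹ * A * I.size / I.codeSet.card := by
      rw [mul_assoc, mul_comm A, inv_mul_const hP, ENNReal.div_eq_inv_mul]
    rw [hval]
    refine le_antisymm ?_ ?_
    · refine le_of_restart ENNReal.one_ne_top (p := fun s => ∃ l, I.AtRound B K l s)
        (fun s _ => haltExpect_le w hg1 _) hf codeSet_card_le ?_ s ⟨l, hs⟩
      intro s hs S hS
      obtain ⟨t, ht, he⟩ := hstep s hs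
      rw [he]
      refine add_le_add le_rfl (mul_le_mul_right ?_ _)
      refine (Finset.sum_le_card_nsmul _ _ S fun v hv => hS _ (ht v hv)).trans (le_of_eq ?_)
      rw [nsmul_eq_mul, card_sdiff]
    · refine ge_of_restart ENNReal.one_ne_top (p := fun s => ∃ l, I.AtRound B K l s)
        (fun s _ => haltExpect_le w hg1 _) hf codeSet_card_le ?_ s ⟨l, hs⟩
      intro s hs S hS
      obtain ⟨t, ht, he⟩ := hstep s hs
      rw [he]
      refine add_le_add le_rfl (mul_le_mul_right ?_ _)
      refine le_trans (le_of_eq ?_) (Finset.card_nsmul_le_sum _ _ S fun v hv => hS _ (ht v hv))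
      rw [nsmul_eq_mul, card_sdiff]

/-- Sampling draws a uniformly random code of a tuple. Since this is shown for an arbitrary function
of the final memory whose value at good memories depends on the answer only, it contains that a good
memory is left behind with probability `1`, independently of the answer. -/
theorem samp_law (h : I.Setting B w pos) {g : State → ℝ≥0∞}
    {G : Option (Fin I.k → ℕ) → ℝ≥0∞} (hg : ∀ s, I.Good B K s → g s = G (answer I.k s))
    (hg1 : ∀ s, g s ≤ 1) {s : State} (hs : I.Good B K s) :
    haltExpect w g ([I.sampProg K pos], s) = I.law pos G := by
  obtain ⟨n, -, s', hdet, hs'⟩ := start_machine h.two_le h.start pos hs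
  rw [hdet.haltExpect, round_law h hg hg1 hs']

/-- The time of the rounds in terms of the time after the first draw of a code. -/
theorem truncTime_of_draw (hP : 0 < I.size) (N : ℕ) {n : ℕ} (hn : n ≤ I.roundCost)
    {c : Config} {R : List Prog} {s₁ : State} (hdet : Det w c n (.rand 2 2 :: R, s₁))
    (hreg : s₁.reg 2 = I.size) (T : ℕ → ℝ≥0∞)
    (hT : ∀ v < I.size, truncTime w N (R, s₁.setReg 2 v) ≤ I.roundCost + T v) :
    truncTime w N c ≤ (2 * I.roundCost + 1 : ℕ) +
      (I.size : ℝ≥0∞)⁻¹ * ∑ v ∈ Finset.range I.size, T v := by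
  refine (hdet.truncTime N).trans ((add_le_add_right (truncTime_rand (by omega) N) _).trans ?_)
  rw [hreg]
  have h1 : ∑ v ∈ Finset.range I.size, truncTime w N (R, s₁.setReg 2 v) ≤
      I.size * I.roundCost + ∑ v ∈ Finset.range I.size, T v := by
    refine (Finset.sum_le_sum fun v hv => hT v (Finset.mem_range.1 hv)).trans ?_
    rw [Finset.sum_add_distrib, Finset.sum_const, Finset.card_range, nsmul_eq_mul]
  refine (add_le_add_right (add_le_add_right (mul_le_mul_right h1 _) _) _).trans ?_
  rw [mul_add, inv_mul_const hP, ← add_assoc, ← add_assoc]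
  refine add_le_add_left ?_ _
  have h2 : n + 1 + I.roundCost ≤ 2 * I.roundCost + 1 := by omega
  exact_mod_cast h2

theorem truncTime_le_add {c c' : Config} {n b : ℕ} (h : Det w c n c') (hn : n ≤ b) {N : ℕ}
    {T : ℝ≥0∞} (hT : truncTime w N c' ≤ T) : truncTime w N c ≤ b + T :=
  (h.truncTime N).trans (add_le_add (Nat.cast_le.2 hn) hT)

theorem truncTime_le_of_halt {c : Config} {s : State} {n b : ℕ} (h : Det w c n ([], s))
    (hn : n ≤ b) (N : ℕ) (T : ℝ≥0∞) : truncTime w N c ≤ b + T :=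
  truncTime_le_add h hn ((truncTime_halted w N s).le.trans zero_le)

theorem round_time_of_empty (h : I.Setting B w pos) (N : ℕ) (hF : I.codeSet = ∅) {l : ℕ}
    {s : State} (hs : I.AtRound B K l s) :
    truncTime w N ([I.loopProg K, I.finishProg K pos], s) ≤
      ((l * (2 * I.roundCost + 1) : ℕ) : ℝ≥0∞) := by
  have hP := size_pos h.valid
  have hnone : I.codesBelow I.size = 0 := by rw [codesBelow_size, hF, Finset.card_empty]
  induction l generalizing s with
  | zero =>
    obtain ⟨M, r, -, -, -, h1, h2⟩ := hs
    have := h1.rnd_le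
    omega
  | succ l ih =>
    obtain ⟨n, hn, R, s₁, hdet, hreg, hres⟩ :=
      round_machine h.valid h.two_le h.attempt h.pos_lt hs
    refine (truncTime_of_draw hP N hn hdet hreg
      (fun _ => (l * (2 * I.roundCost + 1) : ℕ)) ?_).trans ?_
    · intro v hv
      rcases hres v hv with ⟨u, hu, he, -⟩ | ⟨-, n, hn, s', hdet', l', hr, hl⟩ |
        ⟨-, n, hn, s', hdet', -, -⟩
      · have : v ∈ I.codeSet := mem_codeSet.2 ⟨hv, u, hu, he⟩
        simp [hF] at this
      · obtain rfl : l' = l := by have := hl hnone; omega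
        exact truncTime_le_add hdet' hn (ih hr)
      · exact truncTime_le_of_halt hdet' hn N _
    · rw [Finset.sum_const, Finset.card_range, nsmul_eq_mul, inv_mul_const hP, ← Nat.cast_add,
        Nat.cast_le]
      exact le_of_eq (by ring)

theorem round_time (h : I.Setting B w pos) (N : ℕ) (hF : I.codeSet ≠ ∅) {l : ℕ} {s : State}
    (hs : I.AtRound B K l s) : truncTime w N ([I.loopProg K, I.finishProg K pos], s) ≤
      (2 * I.roundCost + 1 : ℕ) * I.size / I.codeSet.card := by
  have hP := size_pos h.valid
  have hf : 0 < I.codeSet.card := Finset.card_pos.2 (Finset.nonempty_iff_ne_empty.2 hF)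
  refine le_of_restart (ENNReal.natCast_ne_top N) (p := fun s => ∃ l, I.AtRound B K l s)
      (H := fun s => truncTime w N ([I.loopProg K, I.finishProg K pos], s))
      (fun s _ => truncTime_le_nat w N _) hf codeSet_card_le ?_ s ⟨l, hs⟩
  rintro s ⟨l, hs⟩ S hS
  obtain ⟨n, hn, R, s₁, hdet, hreg, hres⟩ :=
      round_machine h.valid h.two_le h.attempt h.pos_lt hs
  classical
  refine (truncTime_of_draw hP N hn hdet hreg (fun v => if v ∈ I.codeSet then 0 else S)
    ?_).trans (le_of_eq ?_)
  · intro v hv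
    rcases hres v hv with ⟨u, hu, he, n, hn, s', hdet', -⟩ |
      ⟨hno, n, hn, s', hdet', l', hr, -⟩ | ⟨hno, -⟩
    · exact truncTime_le_of_halt hdet' hn N _
    · rw [if_neg fun hv => hno (mem_codeSet.1 hv).2]
      exact truncTime_le_add hdet' hn (hS s' ⟨l', hr⟩)
    · rw [codesBelow_size] at hno
      omega
  · rw [sum_split, Finset.sum_eq_zero (s := I.codeSet) (fun v hv => if_pos hv), zero_add,
      Finset.sum_congr rfl (g := fun _ => S) fun v hv => if_neg (Finset.mem_sdiff.1 hv).2,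
      Finset.sum_const, nsmul_eq_mul, card_sdiff]

theorem samp_time (h : I.Setting B w pos) {s : State} (hs : I.Good B K s) :
    expectedTime w (I.sampProg K pos) s ≤
      (7 * I.roundCost : ℕ) * (I.size / (max 1 I.codeSet.card : ℕ)) := by
  have hP := size_pos h.valid
  have hrc : 1 ≤ I.roundCost := by unfold roundCost; omega
  rw [expectedTime_eq_iSup]
  refine iSup_le fun N => ?_
  obtain ⟨n, hn, s', hdet, hs'⟩ := start_machine h.two_le h.start pos hs
  refine (hdet.truncTime N).trans ?_
  by_cases hF : I.codeSet = ∅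
  · refine (add_le_add_right (round_time_of_empty h N hF hs') _).trans ?_
    rw [hF, Finset.card_empty, max_eq_left (Nat.zero_le 1), Nat.cast_one, div_one]
    have h1 : n + (I.size + 1) * (2 * I.roundCost + 1) ≤ 7 * I.roundCost * I.size := by
      nlinarith [Nat.mul_le_mul hP hrc]
    exact_mod_cast h1
  · refine (add_le_add_right (round_time h N hF hs') _).trans ?_
    have hf : 1 ≤ I.codeSet.card := Finset.card_pos.2 (Finset.nonempty_iff_ne_empty.2 hF)
    rw [max_eq_right hf]
    have h1 : (1 : ℝ≥0∞) ≤ I.size / I.codeSet.card := by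
      rw [ENNReal.le_div_iff_mul_le (.inl (by simp; omega)) (.inl (ENNReal.natCast_ne_top _)),
        one_mul]
      exact Nat.cast_le.2 codeSet_card_le
    rw [mul_div_assoc]
    refine (add_le_add_left (le_mul_of_one_le_right zero_le h1) _).trans ?_
    rw [← add_mul, ← Nat.cast_add]
    refine mul_le_mul_left (Nat.cast_le.2 ?_) _
    omega

end Inst

/-! ### Sequences of sampling operations -/

theorem answersProbFrom_le_one (k w : ℕ) (samp : Prog) (os : List (Option (Fin k → ℕ)))
    (s : State) : answersProbFrom k w samp os s ≤ 1 := by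
  induction os generalizing s with
  | nil => exact le_rfl
  | cons o os ih =>
    rw [answersProbFrom, ← haltExpect_eq_tsum]
    refine haltExpect_le w (fun s' => ?_) _
    split_ifs
    exacts [ih s', zero_le]

theorem haltProb_of_det {w n : ℕ} {p : Prog} {s s₁ : State} (h : Det w ([p], s) n ([], s₁))
    (f : State → ℝ≥0∞) : ∑' s', haltProb w p s s' * f s' = f s₁ := by
  rw [← haltExpect_eq_tsum, h.haltExpect, haltExpect_halted]

theorem expectedTime_le_of_det {w n : ℕ} {p : Prog} {s s₁ : State}
    (h : Det w ([p], s) n ([], s₁)) : expectedTime w p s ≤ n := by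
  rw [expectedTime_eq_iSup]
  refine iSup_le fun N => (h.truncTime N).trans ?_
  rw [truncTime_halted, add_zero]

namespace Inst

variable {I : Inst} {B K w : ℕ} {pos : ℕ → ℕ}

theorem law_mul (G : Option (Fin I.k → ℕ) → ℝ≥0∞) (r : ℝ≥0∞) :
    I.law pos (fun o => G o * r) = I.law pos G * r := by
  unfold law
  split_ifs
  · rfl
  · rw [mul_assoc, Finset.sum_mul]

theorem law_zero : I.law pos (fun _ => 0) = 0 := by
  unfold law
  split_ifs <;> simp

/-- The probability of the answer `o` if the tuple of a uniformly random code is returned. -/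
noncomputable def answerLaw (I : Inst) (pos : ℕ → ℕ) (o : Option (Fin I.k → ℕ)) : ℝ≥0∞ :=
  I.law pos fun o' => if o' = o then 1 else 0

theorem answersProbFrom_samp (h : I.Setting B w pos) (os : List (Option (Fin I.k → ℕ)))
    {s : State} (hs : I.Good B K s) : answersProbFrom I.k w (I.sampProg K pos) os s =
      (os.map (I.answerLaw pos)).prod := by
  induction os generalizing s with
  | nil => rfl
  | cons o os ih =>
    rw [answersProbFrom, ← haltExpect_eq_tsum, samp_law h
      (G := fun o' => (if o' = o then 1 else 0) * (os.map (I.answerLaw pos)).prod) _ _ hs, law_mul]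
    · rw [List.map_cons, List.prod_cons, answerLaw]
    · intro s' hs'
      rw [ih hs', ite_mul, one_mul, zero_mul]
    · intro s'
      split_ifs
      exacts [answersProbFrom_le_one _ _ _ _ _, zero_le]

/-- The sampler does not damage the data structure. -/
theorem haltProb_samp (h : I.Setting B w pos) {s s' : State} (hs : I.Good B K s)
    (hs' : ¬ I.Good B K s') : haltProb w (I.sampProg K pos) s s' = 0 := by
  classical
  have h1 := samp_law (K := K) (g := fun s => if I.Good B K s then 0 else 1) (G := fun _ => 0) h
    (fun s hs => if_pos hs) (fun s => by split_ifs <;> simp) hs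
  rw [law_zero, haltExpect_eq_tsum, ENNReal.tsum_eq_zero] at h1
  have h2 := h1 s'
  rwa [if_neg hs', mul_one] at h2

theorem stateLaw_samp (h : I.Setting B w pos) {pre : Prog} {s₀ s₁ : State} {n : ℕ}
    (hpre : Det w ([pre], s₀) n ([], s₁)) (hs₁ : I.Good B K s₁) (i : ℕ) :
    (∀ s, ¬ I.Good B K s → stateLaw w pre (I.sampProg K pos) s₀ i s = 0) ∧
      ∑' s, stateLaw w pre (I.sampProg K pos) s₀ i s ≤ 1 := by
  classical
  induction i with
  | zero =>
    simp only [stateLaw]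
    constructor
    · intro s hs
      have h1 := haltProb_of_det hpre fun s => if I.Good B K s then 0 else 1
      rw [if_pos hs₁, ENNReal.tsum_eq_zero] at h1
      have h2 := h1 s
      rwa [if_neg hs, mul_one] at h2
    · have h1 := haltProb_of_det hpre fun _ => 1
      simp only [mul_one] at h1
      exact h1.le
  | succ i ih =>
    obtain ⟨ih1, ih2⟩ := ih
    simp only [stateLaw]
    constructor
    · intro s hs
      rw [ENNReal.tsum_eq_zero]
      intro s'
      by_cases hs' : I.Good B K s'
      · rw [haltProb_samp h hs' hs, mul_zero]
      · rw [ih1 s' hs', zero_mul]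
    · rw [ENNReal.tsum_comm]
      refine le_trans (ENNReal.tsum_le_tsum fun s' => ?_) ih2
      rw [ENNReal.tsum_mul_left]
      refine mul_le_of_le_one_right zero_le ?_
      have h1 := haltExpect_le w (g := fun _ => 1) (fun _ => le_rfl) ([I.sampProg K pos], s')
      rw [haltExpect_eq_tsum] at h1
      simpa using h1

theorem expectedOpTime_samp (h : I.Setting B w pos) {pre : Prog} {s₀ s₁ : State} {n : ℕ}
    (hpre : Det w ([pre], s₀) n ([], s₁)) (hs₁ : I.Good B K s₁) (i : ℕ) :
    expectedOpTime w pre (I.sampProg K pos) s₀ i ≤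
      (7 * I.roundCost : ℕ) * (I.size / (max 1 I.codeSet.card : ℕ)) := by
  obtain ⟨h1, h2⟩ := stateLaw_samp h hpre hs₁ i
  set T : ℝ≥0∞ := (7 * I.roundCost : ℕ) * (I.size / (max 1 I.codeSet.card : ℕ))
  calc expectedOpTime w pre (I.sampProg K pos) s₀ i
      ≤ ∑' s, stateLaw w pre (I.sampProg K pos) s₀ i s * T := by
        refine ENNReal.tsum_le_tsum fun s => ?_
        by_cases hs : I.Good B K s
        · exact mul_le_mul_right (samp_time h hs) _
        · rw [h1 s hs, zero_mul, zero_mul]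
    _ = (∑' s, stateLaw w pre (I.sampProg K pos) s₀ i s) * T := ENNReal.tsum_mul_right
    _ ≤ T := mul_le_of_le_one_left zero_le h2

end Inst

/-! ### Polynomial and linear bounds -/

theorem pow_le_mul_two_pow (y p : ℕ) : y ^ p ≤ p ^ p * 2 ^ y := by
  rcases Nat.eq_zero_or_pos p with rfl | hp
  · simpa using Nat.one_le_two_pow
  · have h1 : y ≤ p * 2 ^ (y / p) := by
      have h2 : y / p + 1 ≤ 2 ^ (y / p) := Nat.lt_two_pow_self
      have h3 : y < p * (y / p + 1) := Nat.lt_mul_div_succ y hp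
      exact h3.le.trans (Nat.mul_le_mul_left p h2)
    calc y ^ p ≤ (p * 2 ^ (y / p)) ^ p := Nat.pow_le_pow_left h1 p
      _ = p ^ p * 2 ^ (y / p * p) := by rw [mul_pow, ← pow_mul]
      _ ≤ p ^ p * 2 ^ y :=
        Nat.mul_le_mul_left _ (Nat.pow_le_pow_right (by omega) (Nat.div_mul_le_self y p))

namespace Shape

variable (S : Shape)

/-- The numbers that the programs compute are at most the input size plus `2` to this power. -/
def boundExp : ℕ := 2 * (S.n + 1) * (S.n + S.k + 2)

/-- The numbers of iterations of the loops are at most this factor times the input size. -/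
def loopFactor : ℕ := ((S.n + S.k) ^ (S.n + S.k) + S.k + 1) * (2 * (S.n + 1))

end Shape

namespace Inst

variable {I : Inst} {s : ℕ}

theorem two_pow_lim_le (hI : I.Valid) : 2 ^ I.lim ≤ 2 * (I.tot + 1) := by
  rw [hI.lim_eq, pow_succ, mul_comm]
  refine Nat.mul_le_mul_left 2 ?_
  rcases Nat.eq_zero_or_pos I.tot with h | h
  · simp [h]
  · exact (Nat.pow_log_le_self 2 h.ne').trans (Nat.le_succ _)

theorem bounds (hI : I.Valid) (htot : I.tot ≤ I.n * s) :
    I.Bounds ((s + 2) ^ I.boundExp) (I.loopFactor * max 1 s) := by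
  have hmono {x y : ℕ} (h : x ≤ y) : (s + 2) ^ x ≤ (s + 2) ^ y :=
    Nat.pow_le_pow_right (by omega) h
  have hlt (x : ℕ) : x < (s + 2) ^ x :=
    Nat.lt_two_pow_self.trans_le (Nat.pow_le_pow_left (by omega) x)
  have h1 : I.tot + 1 ≤ (s + 2) ^ I.n := by
    have h2 : 1 + I.n * s ≤ (1 + s) ^ I.n := by
      exact_mod_cast one_add_mul_le_pow (a := (s : ℤ)) (by omega) I.n
    have h3 : (1 + s) ^ I.n ≤ (s + 2) ^ I.n := Nat.pow_le_pow_left (by omega) _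
    omega
  have h2 : 2 ^ I.lim ≤ (s + 2) ^ (I.n + 1) := by
    refine (two_pow_lim_le hI).trans ?_
    rw [pow_succ, mul_comm]
    exact Nat.mul_le_mul h1 (by omega)
  have h3 : 2 ^ (I.k * I.lim) ≤ (s + 2) ^ ((I.n + 1) * I.k) := by
    rw [mul_comm, pow_mul, pow_mul]
    exact Nat.pow_le_pow_left h2 _
  have h4 : I.lim ^ (I.n + I.k) ≤ (s + 2) ^ ((I.n + 1) * (I.n + I.k)) := by
    rw [pow_mul]
    exact Nat.pow_le_pow_left (Nat.lt_two_pow_self.le.trans h2) _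
  have hP : I.tot + 1 ≤ (I.n + 1) * max 1 s := by
    have := Nat.mul_le_mul_left I.n (le_max_right 1 s)
    have := le_max_left 1 s
    rw [Nat.succ_mul]
    omega
  have h5 : 2 ^ I.lim ≤ 2 * (I.n + 1) * max 1 s := by
    refine (two_pow_lim_le hI).trans ?_
    rw [mul_assoc]
    exact Nat.mul_le_mul_left 2 hP
  have hN : I.loopFactor * max 1 s = ((I.n + I.k) ^ (I.n + I.k) + I.k + 1) *
      (2 * (I.n + 1) * max 1 s) := by
    rw [Shape.loopFactor, mul_assoc]
  refine ⟨?_, ?_, ?_, ?_, ?_, ?_, ?_⟩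
  · calc (I.k + 1) * I.tot + 2 ≤ (I.k + 2) * (I.tot + 1) := by nlinarith
      _ ≤ (s + 2) ^ (I.k + 2) * (s + 2) ^ I.n := Nat.mul_le_mul (hlt _).le h1
      _ = (s + 2) ^ (I.k + 2 + I.n) := (pow_add _ _ _).symm
      _ ≤ _ := hmono (by unfold Shape.boundExp; nlinarith)
  · calc (2 * I.n) ^ I.k * 2 ^ (I.k * I.lim)
        ≤ ((s + 2) ^ (I.n + 1)) ^ I.k * (s + 2) ^ ((I.n + 1) * I.k) := by
          refine Nat.mul_le_mul (Nat.pow_le_pow_left ?_ _) h3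
          rw [pow_succ, mul_comm]
          exact Nat.mul_le_mul (hlt _).le (by omega)
      _ = (s + 2) ^ ((I.n + 1) * I.k + (I.n + 1) * I.k) := by rw [← pow_mul, ← pow_add]
      _ ≤ _ := hmono (by unfold Shape.boundExp; nlinarith)
  · exact h3.trans (hmono (by unfold Shape.boundExp; nlinarith))
  · exact h4.trans (hmono (by unfold Shape.boundExp; nlinarith))
  · rw [hN]
    refine le_trans ?_ (Nat.le_mul_of_pos_left _ (by omega))
    rw [mul_assoc]
    omega
  · rw [hN]
    exact (pow_le_mul_two_pow _ _).trans (Nat.mul_le_mul (by omega) h5)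
  · rw [hN]
    exact Nat.mul_le_mul (by omega) (Nat.lt_two_pow_self.le.trans h5)

theorem two_le_bound : 2 ≤ (s + 2) ^ I.boundExp := by
  refine le_trans (by omega) (Nat.le_self_pow (n := I.boundExp) ?_ (s + 2))
  unfold Shape.boundExp
  positivity

end Inst

/-! ### Loading the input -/

/-- Copy registers `0, …, t - 1` to the arrays `siz`. Register `m` has to be `0`. -/
def loadProg (K m t : ℕ) : Prog :=
  Nat.rec .skip (fun r p => .seq p (.store ((Name.siz r).code K) m r)) t

/-- The memory after registers `0, …, t - 1` have been copied. -/
def Mem.load (M : Mem) (x : ℕ → ℕ) (t : ℕ) : Mem :=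
  Nat.rec M (fun r M => Mem.set M (.siz r) 0 (x r)) t

theorem Mem.load_siz (M : Mem) (x : ℕ → ℕ) {t r : ℕ} (hr : r < t) :
    M.load x t (.siz r) 0 = x r := by
  induction t with
  | zero => omega
  | succ t ih =>
    change Mem.set (M.load x t) (.siz t) 0 (x t) (.siz r) 0 = x r
    rw [Mem.set_apply]
    by_cases h : r = t
    · simp [h]
    · rw [if_neg (by simp [h])]
      exact ih (by omega)

theorem Mem.load_of_ne (M : Mem) (x : ℕ → ℕ) (t : ℕ) {A : Name} (hA : ∀ r, A ≠ .siz r) :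
    M.load x t A = M A := by
  induction t with
  | zero => rfl
  | succ t ih => exact (Mem.set_of_ne _ _ _ (hA t)).trans ih

theorem Mem.load_small {M : Mem} {B : ℕ} (hM : M.Small B) {x : ℕ → ℕ} (hx : ∀ r, x r ≤ B)
    (t : ℕ) : (M.load x t).Small B := by
  induction t with
  | zero => exact hM
  | succ t ih => exact ih.set (.inr (hx t))

theorem loadProg_spec {w K m : ℕ} {M : Mem} (t : ℕ) {s : State} (hs : s.Holds K M)
    (hm : s.reg m = 0) (R : List Prog) : ∃ s' : State,
      Det w (loadProg K m t :: R, s) (2 * t + 1) (R, s') ∧ s'.reg = s.reg ∧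
      s'.Holds K (M.load s.reg t) := by
  induction t generalizing R with
  | zero => exact ⟨s, Det.one rfl, rfl, hs⟩
  | succ t ih =>
    obtain ⟨s', h1, h2, h3⟩ := ih (.store ((Name.siz t).code K) m t :: R)
    refine ⟨s'.setArr ((Name.siz t).code K) (s'.reg m) (s'.reg t), ?_, h2, ?_⟩
    · rw [show 2 * (t + 1) + 1 = 1 + (2 * t + 1 + 1) by ring]
      exact (Det.seq w _ _ R s).trans (h1.trans (Det.one rfl))
    · rw [h2, hm]
      exact h3.setArr (.siz t) 0 (s.reg t)

namespace Inst

variable {I : Inst} {B N K w m : ℕ} {s₀ : State} {M : Mem}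

/-- The preprocessing program. -/
def _root_.JoinSampling.Shape.preProg (S : Shape) (K m : ℕ) : Prog :=
  .seq (loadProg K m m) (S.preCmd.compile K)

theorem pre_machine (hI : I.Valid) (hB : I.Bounds B N) (hB2 : 2 ≤ B)
    (hd : B ^ I.preCmd.degree < 2 ^ w) (hs : s₀.Holds K M) (hm : s₀.reg m = 0)
    (hI₀ : I.Initial (M.load s₀.reg m)) (hM : (M.load s₀.reg m).Small B) :
    ∃ n ≤ 2 * m + 2 + I.preCmd.cost N, ∃ s₁, Det w ([I.preProg K m], s₀) n ([], s₁) ∧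
      I.Good B K s₁ := by
  obtain ⟨s', h1, -, h3⟩ := loadProg_spec (w := w) m hs hm [I.preCmd.compile K]
  obtain ⟨hk, -, hready⟩ := pre_ensures hI hI₀ hB hM
  obtain ⟨n, hn, s₁, h4, h5, h6⟩ := Cmd.compile_spec hB2 I.preCmd _ hM hk I.wf_preCmd hd s' h3 []
  exact ⟨_, by omega, s₁, ((Det.seq w _ _ [] s₀).trans h1).trans h4, _, h5, hready, h6⟩

end Inst

/-! ### The sampling problem of a join -/

/-- A pair `(X, Y)` together with the number of a relation that contains it. -/
structure Rule (k : ℕ) where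
  lhs : Finset (Fin k)
  rhs : Finset (Fin k)
  rel : ℕ

section

variable {k m : ℕ}

open Classical in
/-- The rules of a family of schemas and a set `D` of pairs: the cardinality constraints, and each
pair in `D` for all relations that contain it. -/
noncomputable def rules (schema : Fin m → Finset (Fin k))
    (D : Finset (Finset (Fin k) × Finset (Fin k))) : List (Rule k) :=
  (Finset.univ.toList.map fun r => ⟨∅, schema r, r⟩) ++
    ((D ×ˢ Finset.univ).filter fun p => p.1.1 ⊆ p.1.2 ∧ p.1.2 ⊆ schema p.2).toList.map
      fun p => ⟨p.1.1, p.1.2, p.2⟩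

variable {schema : Fin m → Finset (Fin k)} {D : Finset (Finset (Fin k) × Finset (Fin k))}

theorem mem_rules {c : Rule k} : c ∈ rules schema D ↔
    (∃ r : Fin m, c = ⟨∅, schema r, r⟩) ∨ ∃ r : Fin m, (c.lhs, c.rhs) ∈ D ∧ c.lhs ⊆ c.rhs ∧
      c.rhs ⊆ schema r ∧ c.rel = r := by
  unfold rules
  rw [List.mem_append, List.mem_map, List.mem_map]
  refine or_congr ?_ ?_
  · simp [eq_comm]
  · constructor
    · rintro ⟨⟨⟨X, Y⟩, r⟩, h, rfl⟩
      simp only [Finset.mem_toList, Finset.mem_filter, Finset.mem_product] at h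
      exact ⟨r, h.1.1, h.2.1, h.2.2, rfl⟩
    · rintro ⟨r, h1, h2, h3, h4⟩
      refine ⟨((c.lhs, c.rhs), r), ?_, ?_⟩
      · simp [h1, h2, h3]
      · rw [← h4]

/-- The order `σ` of the attributes lists the attributes of `X` before those of `Y \ X`. -/
def Compatible (D : Finset (Finset (Fin k) × Finset (Fin k))) (σ : Equiv.Perm (Fin k)) : Prop :=
  ∀ p ∈ D, ∀ A ∈ p.1, ∀ B ∈ p.2 \ p.1, σ.symm A < σ.symm B

open Classical in
/-- An acyclic set of constraints has a compatible order: sort the attributes by the numbers of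
their ancestors. -/
theorem Acyclic.exists_compatible {DC : Finset (DegreeConstraint k)} (h : Acyclic DC) :
    ∃ σ, Compatible (DC.image DegreeConstraint.pair) σ := by
  set f : Fin k → ℕ := fun A =>
    (Finset.univ.filter fun B => Relation.TransGen (DependencyEdge DC) B A).card
  refine ⟨Tuple.sort f, fun p hp A hA B hB => ?_⟩
  obtain ⟨c, hc, rfl⟩ := Finset.mem_image.1 hp
  have hAB : DependencyEdge DC A B := ⟨c, hc, hA, hB⟩
  have hlt : f A < f B := by
    refine Finset.card_lt_card ⟨fun x hx => ?_, fun hsub => ?_⟩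
    · exact Finset.mem_filter.2 ⟨Finset.mem_univ _, (Finset.mem_filter.1 hx).2.tail hAB⟩
    · have h1 := hsub (Finset.mem_filter.2 ⟨Finset.mem_univ A, .single hAB⟩)
      exact h A (Finset.mem_filter.1 h1).2
  by_contra hle
  have h2 := Tuple.monotone_sort f (not_lt.1 hle)
  simp only [Function.comp_apply, Equiv.apply_symm_apply] at h2
  omega

/-- The rule number `c` of a list; beyond its end, a rule without attributes. -/
def ruleAt (L : List (Rule k)) (c : ℕ) : Rule k := L.getD c ⟨∅, ∅, 0⟩

theorem ruleAt_mem {L : List (Rule k)} {c : ℕ} (hc : c < L.length) : ruleAt L c ∈ L := by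
  rw [ruleAt, List.getD_eq_getElem _ _ hc]
  exact List.getElem_mem hc

theorem exists_ruleAt {L : List (Rule k)} {d : Rule k} (hd : d ∈ L) :
    ∃ c < L.length, ruleAt L c = d := by
  obtain ⟨c, hc, h⟩ := List.mem_iff_getElem.1 hd
  exact ⟨c, hc, by rw [ruleAt, List.getD_eq_getElem _ _ hc, h]⟩

open Classical in
/-- The sampling problem for a list of rules, if attribute `σ i` is handled at level `i`. -/
noncomputable def ruleShape (L : List (Rule k)) (σ : Equiv.Perm (Fin k)) : Shape where
  k := k
  n := L.length
  mem c i := decide (∃ h : i < k, σ ⟨i, h⟩ ∈ (ruleAt L c).rhs)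
  act c i := decide (∃ h : i < k, σ ⟨i, h⟩ ∈ (ruleAt L c).rhs \ (ruleAt L c).lhs)
  lvl c := (ruleAt L c).lhs.sup fun a => (σ.symm a : ℕ) + 1
  rel c := (ruleAt L c).rel
  src c i := if h : i < k then (ruleAt L c).rel * k + σ ⟨i, h⟩ else 0

/-- The sampling problem of the input in memory. -/
noncomputable def Shape.inst (S : Shape) (M : Mem) : Inst where
  toShape := S
  table c :=
    { rows := M (.siz (S.rel c)) 0
      cols := S.k
      val := fun j i => if S.mem c i then M (.inp (S.src c i)) j else 0 }
  lim := Nat.log 2 (∑ c ∈ Finset.range S.n, M (.siz (S.rel c)) 0) + 1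

theorem initialState_arr_code (L : ∀ r : Fin m, List (schema r → ℕ)) {A : Name}
    (hA : ∀ a, A ≠ .inp a) (j : ℕ) : (initialState L).arr (A.code (m * k)) j = 0 := by
  have h1 : m * k ≤ A.code (m * k) := by
    rw [Name.code, if_neg]
    · exact Nat.le_add_right _ _
    · rintro ⟨h, -⟩
      cases A <;> simp_all [Name.triple]
  simp only [initialState]
  rw [dif_neg]
  rintro ⟨hk, h2⟩
  rw [Nat.div_lt_iff_lt_mul hk] at h2
  omega

/-- The memory of the machine before the preprocessing. -/
noncomputable def inputMem (L : ∀ r : Fin m, List (schema r → ℕ)) : Mem :=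
  Mem.load (fun A => (initialState L).arr (A.code (m * k))) (initialState L).reg m

theorem inputMem_siz (L : ∀ r : Fin m, List (schema r → ℕ)) (r : Fin m) :
    inputMem L (.siz r) 0 = (L r).length := by
  rw [inputMem, Mem.load_siz _ _ r.2]
  simp [initialState]

theorem inputMem_inp (L : ∀ r : Fin m, List (schema r → ℕ)) (r : Fin m) (a : schema r) {j : ℕ}
    (hj : j < (L r).length) : inputMem L (.inp (r * k + (a : Fin k))) j = (L r)[j] a := by
  have hk : 0 < k := (Nat.zero_le _).trans_lt (a : Fin k).2
  have h1 : (r : ℕ) * k + (a : Fin k) < m * k := by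
    have := Nat.mul_le_mul_right k (Nat.succ_le_of_lt r.2)
    rw [Nat.succ_mul] at this
    have := (a : Fin k).2
    omega
  have h2 : ((r : ℕ) * k + (a : Fin k)) / k = r := by
    rw [mul_comm, Nat.mul_add_div hk, Nat.div_eq_of_lt (a : Fin k).2, add_zero]
  have h3 : ((r : ℕ) * k + (a : Fin k)) % k = (a : Fin k) := by
    rw [mul_comm, Nat.mul_add_mod, Nat.mod_eq_of_lt (a : Fin k).2]
  rw [inputMem, Mem.load_of_ne _ _ _ (by simp), Name.code_inp h1]
  have h4 : ∀ (q x : ℕ) (_ : q = r) (_ : x = (a : Fin k)) (hq' : q < m) (hx' : x < k),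
      (if h' : (⟨x, hx'⟩ : Fin k) ∈ schema ⟨q, hq'⟩ then
        if h'' : j < (L ⟨q, hq'⟩).length then (L ⟨q, hq'⟩)[j] ⟨_, h'⟩ else 0
      else 0) = (L r)[j] a := by
    rintro _ _ rfl rfl _ _
    rw [dif_pos a.2, dif_pos hj]
  simp only [initialState]
  rw [dif_pos ⟨hk, by rw [h2]; exact r.2⟩]
  exact h4 _ _ h2 h3 _ _

theorem inputMem_zero (L : ∀ r : Fin m, List (schema r → ℕ)) {A : Name} (hinp : ∀ a, A ≠ .inp a)
    (hsiz : ∀ r, A ≠ .siz r) (j : ℕ) : inputMem L A j = 0 := by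
  rw [inputMem, Mem.load_of_ne _ _ _ hsiz]
  exact initialState_arr_code L hinp j

theorem inputMem_small (L : ∀ r : Fin m, List (schema r → ℕ)) {B : ℕ}
    (hB : ∀ r, (L r).length ≤ B) : (inputMem L).Small B := by
  refine Mem.load_small (fun A hA j => ?_) (fun r => ?_) m
  · rw [initialState_arr_code L (fun a ha => by simp [ha, Name.IsVal] at hA)]
    exact Nat.zero_le B
  · simp only [initialState]
    split_ifs
    exacts [hB _, Nat.zero_le B]

/-- The sampling problem of a listed join. -/
noncomputable def joinInst (D : Finset (Finset (Fin k) × Finset (Fin k)))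
    (σ : Equiv.Perm (Fin k)) (L : ∀ r : Fin m, List (schema r → ℕ)) : Inst :=
  (ruleShape (rules schema D) σ).inst (inputMem L)

theorem exists_rel {c : ℕ} (hc : c < (rules schema D).length) : ∃ r : Fin m,
    (ruleAt (rules schema D) c).rel = r ∧ (ruleAt (rules schema D) c).rhs ⊆ schema r ∧
    (ruleAt (rules schema D) c).lhs ⊆ (ruleAt (rules schema D) c).rhs ∧
    ((ruleAt (rules schema D) c).lhs = ∅ ∨
      ((ruleAt (rules schema D) c).lhs, (ruleAt (rules schema D) c).rhs) ∈ D) := by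
  rcases mem_rules.1 (ruleAt_mem hc) with ⟨r, h⟩ | ⟨r, h1, h2, h3, h4⟩
  · exact ⟨r, by simp [h]⟩
  · exact ⟨r, h4, h3, h2, .inr h1⟩

section

variable {σ : Equiv.Perm (Fin k)} {L : ∀ r : Fin m, List (schema r → ℕ)} {c : ℕ} {r : Fin m}

theorem joinInst_rows (hr : (ruleAt (rules schema D) c).rel = r) :
    ((joinInst D σ L).table c).rows = (L r).length := by
  change inputMem L (.siz (ruleAt (rules schema D) c).rel) 0 = _
  rw [hr, inputMem_siz]

theorem joinInst_mem (a : Fin k) : (joinInst D σ L).mem c (σ.symm a) = true ↔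
    a ∈ (ruleAt (rules schema D) c).rhs := by
  simp [joinInst, Shape.inst, ruleShape]

theorem joinInst_act (a : Fin k) : (joinInst D σ L).act c (σ.symm a) = true ↔
    a ∈ (ruleAt (rules schema D) c).rhs \ (ruleAt (rules schema D) c).lhs := by
  simp [joinInst, Shape.inst, ruleShape]

theorem joinInst_val (hr : (ruleAt (rules schema D) c).rel = r) {a : Fin k}
    (ha : a ∈ (ruleAt (rules schema D) c).rhs)
    (hsub : (ruleAt (rules schema D) c).rhs ⊆ schema r) {j : ℕ} (hj : j < (L r).length) :
    ((joinInst D σ L).table c).val j (σ.symm a) = (L r)[j] ⟨a, hsub ha⟩ := by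
  have h1 := (joinInst_mem (σ := σ) (L := L) a).2 ha
  have h2 : (joinInst D σ L).src c (σ.symm a) = r * k + a := by
    simp [joinInst, Shape.inst, ruleShape, hr]
  change (if (joinInst D σ L).mem c (σ.symm a) then
    inputMem L (.inp ((joinInst D σ L).src c (σ.symm a))) j else 0) = _
  rw [if_pos h1, h2]
  exact inputMem_inp L r ⟨a, hsub ha⟩ hj

theorem joinInst_val_of_notMem {i j : ℕ} (h : ¬ (joinInst D σ L).mem c i = true) :
    ((joinInst D σ L).table c).val j i = 0 := if_neg h

theorem joinInst_agree (hr : (ruleAt (rules schema D) c).rel = r)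
    (hsub : (ruleAt (rules schema D) c).rhs ⊆ schema r) {i j : ℕ} (hi : i ≤ k)
    (hj : j < (L r).length) {u : ℕ → ℕ} :
    ((joinInst D σ L).table c).Agree i ((joinInst D σ L).view c u) j ↔
      ∀ (a : Fin k) (ha : a ∈ (ruleAt (rules schema D) c).rhs), (σ.symm a : ℕ) < i →
        (L r)[j] ⟨a, hsub ha⟩ = u (σ.symm a) := by
  constructor
  · intro h a ha hai
    rw [← joinInst_val (σ := σ) hr ha hsub hj, h _ hai, Inst.view, if_pos ((joinInst_mem a).2 ha)]
  · intro h l hl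
    obtain ⟨a, rfl⟩ : ∃ a, (σ.symm a : ℕ) = l := ⟨σ ⟨l, by omega⟩, by simp⟩
    rw [Inst.view]
    split_ifs with ha
    · have ha' := (joinInst_mem a).1 ha
      rw [joinInst_val hr ha' hsub hj]
      exact h a ha' hl
    · exact joinInst_val_of_notMem ha

theorem joinInst_path (hr : (ruleAt (rules schema D) c).rel = r)
    (hsub : (ruleAt (rules schema D) c).rhs ⊆ schema r) {i j j' : ℕ} (hi : i ≤ k)
    (hj : j < (L r).length) (hj' : j' < (L r).length) :
    ((joinInst D σ L).table c).path i j = ((joinInst D σ L).table c).path i j' ↔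
      ∀ (a : Fin k) (ha : a ∈ (ruleAt (rules schema D) c).rhs), (σ.symm a : ℕ) < i →
        (L r)[j] ⟨a, hsub ha⟩ = (L r)[j'] ⟨a, hsub ha⟩ := by
  rw [Table.path_eq_path_iff (by rwa [joinInst_rows hr])]
  constructor
  · intro h a ha hai
    rw [← joinInst_val (σ := σ) hr ha hsub hj, h _ hai, joinInst_val hr ha hsub hj']
  · intro h l hl
    obtain ⟨a, rfl⟩ : ∃ a, (σ.symm a : ℕ) = l := ⟨σ ⟨l, by omega⟩, by simp⟩
    by_cases ha : (joinInst D σ L).mem c (σ.symm a) = true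
    · have ha' := (joinInst_mem a).1 ha
      rw [joinInst_val hr ha' hsub hj, joinInst_val hr ha' hsub hj']
      exact h a ha' hl
    · rw [joinInst_val_of_notMem ha, joinInst_val_of_notMem ha]

theorem joinInst_valid (hcover : ∀ a, ∃ r, a ∈ schema r) (hσ : Compatible D σ) :
    (joinInst D σ L).Valid where
  cols _ _ := rfl
  lvl_le_k c _ := Finset.sup_le fun a _ => (σ.symm a).2
  lvl_le c hc i hi := by
    obtain ⟨hik, h⟩ := of_decide_eq_true hi
    refine ⟨Finset.sup_le fun a ha => ?_, decide_eq_true ⟨hik, (Finset.mem_sdiff.1 h).1⟩⟩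
    obtain ⟨r, -, -, -, h1 | h1⟩ := exists_rel hc
    · rw [h1] at ha
      simp at ha
    · have h2 := hσ _ h1 a ha _ h
      rw [Equiv.symm_apply_apply] at h2
      exact h2
  cover i hi := by
    obtain ⟨r, hr⟩ := hcover (σ ⟨i, hi⟩)
    obtain ⟨c, hc, h⟩ := exists_ruleAt (mem_rules (D := D).2 (.inl ⟨r, rfl⟩))
    exact ⟨c, hc, decide_eq_true ⟨hi, by simp [h, hr]⟩⟩
  lim_eq := rfl

theorem joinInst_initial : (joinInst D σ L).Initial (inputMem L) where
  rows _ _ := rfl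
  val _ _ _ _ _ _ := rfl
  zero _ h1 h2 := inputMem_zero L h1 h2

theorem joinInst_tot_le {s : ℕ} (hs : ∀ r, (L r).length ≤ s) :
    (joinInst D σ L).tot ≤ (joinInst D σ L).n * s := by
  refine (Finset.sum_le_card_nsmul _ _ s fun c hc => ?_).trans (by simp)
  obtain ⟨r, hr, -⟩ := exists_rel (Finset.mem_range.1 hc)
  rw [joinInst_rows hr]
  exact hs r

end

end

/-! ### Codes and join tuples -/

section

variable {k m : ℕ} {schema : Fin m → Finset (Fin k)}
  {D : Finset (Finset (Fin k) × Finset (Fin k))} {σ : Equiv.Perm (Fin k)}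
  {L : ∀ r : Fin m, List (schema r → ℕ)} {Q : Join schema}

/-- The level of an attribute. -/
def level (σ : Equiv.Perm (Fin k)) (a : ℕ) : ℕ := if h : a < k then σ.symm ⟨a, h⟩ else 0

theorem level_coe (a : Fin k) : level σ a = σ.symm a := dif_pos a.2

theorem IsListing.length_eq (hL : IsListing Q L) (r : Fin m) : (L r).length = (Q r).card := by
  rw [← (hL r).2, List.toFinset_card_of_nodup (hL r).1]

theorem IsListing.length_le (hL : IsListing Q L) (r : Fin m) : (L r).length ≤ inputSize Q := by
  rw [hL.length_eq]
  exact Finset.single_le_sum (f := fun r => (Q r).card) (fun _ _ => Nat.zero_le _)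
    (Finset.mem_univ r)

theorem IsListing.mem_iff (hL : IsListing Q L) {r : Fin m} {t : schema r → ℕ} :
    t ∈ Q r ↔ ∃ j, ∃ hj : j < (L r).length, (L r)[j] = t := by
  rw [← (hL r).2, List.mem_toFinset, List.mem_iff_getElem]

theorem alive_iff (hL : IsListing Q L) (u : ℕ → ℕ) :
    (joinInst D σ L).Alive k u ↔ (fun a : Fin k => u (level σ a)) ∈ joinResult Q := by
  constructor
  · intro h r
    obtain ⟨c, hc, hcr⟩ := exists_ruleAt (mem_rules (D := D).2 (.inl ⟨r, rfl⟩))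
    have hrel : (ruleAt (rules schema D) c).rel = r := by rw [hcr]
    have hsub : (ruleAt (rules schema D) c).rhs ⊆ schema r := by rw [hcr]
    obtain ⟨j, hj, -, hag, -⟩ := Table.exists_row (h c hc)
    rw [joinInst_rows hrel] at hj
    refine hL.mem_iff.2 ⟨j, hj, ?_⟩
    funext a
    rw [Finset.restrict, level_coe]
    exact (joinInst_agree hrel hsub le_rfl hj).1 hag a (by rw [hcr]; exact a.2) (σ.symm a).2
  · intro h c hc
    obtain ⟨r, hrel, hsub, -⟩ := exists_rel hc
    obtain ⟨j, hj, hjr⟩ := hL.mem_iff.1 (h r)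
    refine Table.node_ne_zero (j := j) (by rwa [joinInst_rows hrel])
      ((joinInst_agree hrel hsub le_rfl hj).2 fun a ha _ => ?_)
    rw [hjr, Finset.restrict, level_coe]

/-- The join tuple of a code. -/
noncomputable def joinTuple (D : Finset (Finset (Fin k) × Finset (Fin k)))
    (σ : Equiv.Perm (Fin k)) (L : ∀ r : Fin m, List (schema r → ℕ)) (v : ℕ) (a : Fin k) : ℕ :=
  (joinInst D σ L).codeTuple v (level σ a)

theorem image_joinTuple (hL : IsListing Q L) (hI : (joinInst D σ L).Valid) {leaf : ℕ → ℕ → ℕ}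
    (hleaf : (joinInst D σ L).LeafArrays leaf) :
    joinTuple D σ L '' (joinInst D σ L).codeSet = joinResult Q := by
  have hlev (a : Fin k) : level σ a < (joinInst D σ L).k := level_coe (σ := σ) a ▸ (σ.symm a).2
  ext t
  constructor
  · rintro ⟨v, hv, rfl⟩
    obtain ⟨-, u, hu, rfl⟩ := Inst.mem_codeSet.1 hv
    have h1 := (alive_iff hL u).1 hu
    convert h1 using 1
    funext a
    exact Inst.codeTuple_eq hI hleaf hu (hlev a)
  · intro ht
    set u : ℕ → ℕ := fun i => if h : i < k then t (σ ⟨i, h⟩) else 0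
    have hut : (fun a : Fin k => u (level σ a)) = t := by
      funext a
      simp [u, level_coe]
    have hu : (joinInst D σ L).Alive k u := (alive_iff hL u).2 (by rwa [hut])
    refine ⟨(joinInst D σ L).encode k u 0, Inst.mem_codeSet.2 ⟨?_, u, hu, rfl⟩, ?_⟩
    · refine (Inst.encode_lt hI le_rfl hu ?_).trans_eq (Inst.weight_congr fun l hl => by omega)
      exact Inst.weight_pos hI
    · rw [← hut]
      funext a
      exact Inst.codeTuple_eq hI hleaf hu (hlev a)

theorem joinTuple_injOn (hI : (joinInst D σ L).Valid) {leaf : ℕ → ℕ → ℕ}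
    (hleaf : (joinInst D σ L).LeafArrays leaf) :
    Set.InjOn (joinTuple D σ L) (joinInst D σ L).codeSet := by
  intro v hv v' hv' h
  obtain ⟨-, u, hu, rfl⟩ := Inst.mem_codeSet.1 hv
  obtain ⟨-, u', hu', rfl⟩ := Inst.mem_codeSet.1 hv'
  refine Inst.encode_congr (fun l hl => ?_) 0
  have h1 := congrFun h (σ ⟨l, hl⟩)
  have h2 : level σ (σ ⟨l, hl⟩) = l := by rw [level_coe, Equiv.symm_apply_apply]
  rw [joinTuple, joinTuple, h2, Inst.codeTuple_eq hI hleaf hu hl,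
    Inst.codeTuple_eq hI hleaf hu' hl] at h1
  exact h1

theorem card_codeSet (hL : IsListing Q L) (hI : (joinInst D σ L).Valid) {leaf : ℕ → ℕ → ℕ}
    (hleaf : (joinInst D σ L).LeafArrays leaf) :
    (joinInst D σ L).codeSet.card = outputSize Q := by
  rw [outputSize, ← image_joinTuple hL hI hleaf, (joinTuple_injOn hI hleaf).ncard_image,
    Set.ncard_coe_finset]

theorem answerLaw_eq (hL : IsListing Q L) (hI : (joinInst D σ L).Valid) {leaf : ℕ → ℕ → ℕ}
    (hleaf : (joinInst D σ L).LeafArrays leaf) (o : Option (Fin k → ℕ)) :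
    (joinInst D σ L).answerLaw (level σ) o = sampleLaw Q o := by
  classical
  have himage := image_joinTuple hL hI hleaf
  have hempty : (joinInst D σ L).codeSet = ∅ ↔ joinResult Q = ∅ := by
    rw [← himage, Set.image_eq_empty, Finset.coe_eq_empty]
  change (if (joinInst D σ L).codeSet = ∅ then (if none = o then 1 else 0) else
    ((joinInst D σ L).codeSet.card : ℝ≥0∞)⁻¹ * ∑ v ∈ (joinInst D σ L).codeSet,
      (if some (joinTuple D σ L v) = o then 1 else 0)) = _
  rw [card_codeSet hL hI hleaf]
  by_cases hF : joinResult Q = ∅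
  · rw [if_pos (hempty.2 hF)]
    cases o <;> simp [sampleLaw, hF]
  · rw [if_neg fun h => hF (hempty.1 h)]
    cases o with
    | none => simp [sampleLaw, hF]
    | some t =>
      have h1 : t ∈ (joinInst D σ L).codeSet.image (joinTuple D σ L) ↔ t ∈ joinResult Q := by
        rw [← himage, ← Finset.coe_image, Finset.mem_coe]
      rw [← Finset.sum_image (s := (joinInst D σ L).codeSet) (g := joinTuple D σ L)
        (f := fun t' => if some t' = some t then (1 : ℝ≥0∞) else 0) (joinTuple_injOn hI hleaf)]
      simp only [Option.some.injEq, Finset.sum_ite_eq', h1, sampleLaw]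
      split_ifs <;> simp

/-! ### The number of codes and the polymatroid bound -/

/-- Below a node at the level where `X` is complete, there is at most one leaf for each
`Y`-projection of the tuples with a given `X`-projection. -/
theorem cnt_lvl_le_degree {c : ℕ} {r : Fin m} (hrel : (ruleAt (rules schema D) c).rel = r)
    (hL : IsListing Q L)
    (hX : (ruleAt (rules schema D) c).lhs ⊆ (ruleAt (rules schema D) c).rhs)
    (hY : (ruleAt (rules schema D) c).rhs ⊆ schema r) {j : ℕ} (hj : j < (L r).length) :
    ((joinInst D σ L).table c).cnt ((joinInst D σ L).lvl c)
      (((joinInst D σ L).table c).path ((joinInst D σ L).lvl c) j) ≤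
      degree (hX.trans hY) hY (Q r) := by
  classical
  set T := (joinInst D σ L).table c
  have hrows : T.rows = (L r).length := joinInst_rows hrel
  have hlvl : ∀ a ∈ (ruleAt (rules schema D) c).lhs,
      (σ.symm a : ℕ) < (joinInst D σ L).lvl c := fun a ha =>
    Finset.le_sup (f := fun a => (σ.symm a : ℕ) + 1) ha
  have hlvlk : (joinInst D σ L).lvl c ≤ k := Finset.sup_le fun a _ => (σ.symm a).2
  have hQ : ∀ j (hj : j < (L r).length), (L r)[j] ∈ Q r := fun j hj => hL.mem_iff.2 ⟨j, hj, rfl⟩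
  unfold degree
  refine le_trans ?_ (Finset.le_sup (Finset.mem_image_of_mem _ (hQ j hj)))
  rw [Table.cnt, ← Finset.sum_filter, Finset.sum_const, smul_eq_mul, mul_one]
  refine Finset.card_le_card_of_injOn (fun j' => if h : j' < (L r).length then
    Finset.restrict₂ (π := fun _ => ℕ) hY (L r)[j'] else 0) ?_ ?_
  · intro j' hj'
    simp only [Finset.coe_filter, Finset.mem_range, Set.mem_ofPred_eq, hrows] at hj'
    obtain ⟨hj', -, hp⟩ := hj'
    simp only [dif_pos hj']
    refine Finset.mem_image_of_mem _ (Finset.mem_filter.2 ⟨hQ j' hj', ?_⟩)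
    funext a
    exact (joinInst_path hrel hY hlvlk hj' hj).1 hp a (hX a.2) (hlvl a a.2)
  · intro j₁ h₁ j₂ h₂ h
    simp only [Finset.coe_filter, Finset.mem_range, Set.mem_ofPred_eq, hrows] at h₁ h₂
    obtain ⟨h₁, hf₁, -⟩ := h₁
    obtain ⟨h₂, hf₂, -⟩ := h₂
    simp only [dif_pos h₁, dif_pos h₂] at h
    have h3 : T.path k j₁ = T.path k j₂ :=
      (joinInst_path hrel hY le_rfl h₁ h₂).2 fun a ha _ => congrFun h ⟨a, ha⟩
    have h4 : T.cols = k := rfl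
    rw [h4] at hf₁ hf₂
    omega

theorem deg_zero_le {c : ℕ} (u : ℕ → ℕ) : (joinInst D σ L).deg c 0 u ≤
    ((joinInst D σ L).table c).maxCnt ((joinInst D σ L).lvl c) := by
  unfold Inst.deg
  split_ifs with h
  · rw [Nat.le_zero.1 h, Inst.cnt]
    by_cases h0 : (joinInst D σ L).node c 0 u = 0
    · have hrows : ((joinInst D σ L).table c).rows = 0 := by
        by_contra hne
        have := Table.node_zero (u := (joinInst D σ L).view c u) (Nat.pos_of_ne_zero hne)
        rw [Inst.node] at h0
        omega
      exact (Table.cnt_le.trans_eq hrows).trans (Nat.zero_le _)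
    · exact Table.cnt_le_maxCnt h0
  · exact le_rfl

/-- The set function that adds up weights of the attributes. -/
def modular (h : Fin k → ℕ) (X : Finset (Fin k)) : ℝ := ∑ a ∈ X, (h a : ℝ)

theorem isPolymatroid_modular (h : Fin k → ℕ) : IsPolymatroid (modular h) where
  nonneg _ := Finset.sum_nonneg fun _ _ => Nat.cast_nonneg _
  zero_grounded := Finset.sum_empty
  monotone _ _ hXY := Finset.sum_le_sum_of_subset_of_nonneg hXY fun _ _ _ => Nat.cast_nonneg _
  submodular _ _ := (Finset.sum_union_inter).le

/-- An optimal solution of the linear program behind the potential is a modular polymatroid that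
respects the constraints. -/
theorem potential_le_polymat (hL : IsListing Q L) (hI : (joinInst D σ L).Valid)
    {DC : Finset (DegreeConstraint k)} (hwf : ∀ c ∈ DC, c.WellFormed)
    (hD : DC.image DegreeConstraint.pair = D) (hcons : Consistent Q DC) (u : ℕ → ℕ) :
    ((joinInst D σ L).pot 0 u : ℝ≥0∞) ≤ polymat (DC ∪ cardinalityConstraints Q) := by
  obtain ⟨h, hf, -, hpot⟩ :=
    Inst.exists_feasible hI fun c => Nat.log 2 ((joinInst D σ L).deg c 0 u)
  set H := modular fun a : Fin k => h (σ.symm a)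
  have hsum : ∀ f : ℕ → ℕ, ∑ i ∈ Finset.range k, f i = ∑ a : Fin k, f (σ.symm a) := fun f => by
    rw [Finset.sum_range, Equiv.sum_comp σ.symm fun i : Fin k => f i]
  -- An upper bound for the degree of a rule bounds the weight of the attributes in `Y \ X`.
  have hrule : ∀ c < (rules schema D).length, ∀ N : ℕ,
      (joinInst D σ L).deg c 0 u ≤ N → (ruleAt (rules schema D) c).lhs ⊆
        (ruleAt (rules schema D) c).rhs → 1 ≤ N →
      H (ruleAt (rules schema D) c).rhs - H (ruleAt (rules schema D) c).lhs ≤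
        Real.logb 2 N := by
    intro c hc N hN hX hN1
    have h1 := hf c hc
    have h2 : (∑ i ∈ Finset.range k, if (joinInst D σ L).act c i then h i else 0) =
        ∑ a ∈ (ruleAt (rules schema D) c).rhs \ (ruleAt (rules schema D) c).lhs,
          h (σ.symm a) := by
      rw [hsum fun i => if (joinInst D σ L).act c i then h i else 0, ← Finset.sum_filter]
      congr 1
      ext a
      rw [Finset.mem_filter, joinInst_act]
      simp
    have h3 : H (ruleAt (rules schema D) c).rhs - H (ruleAt (rules schema D) c).lhs =
        ((∑ a ∈ (ruleAt (rules schema D) c).rhs \ (ruleAt (rules schema D) c).lhs,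
          h (σ.symm a) : ℕ) : ℝ) := by
      have := Finset.sum_sdiff (f := fun a => (h (σ.symm a) : ℝ)) hX
      rw [Nat.cast_sum, sub_eq_iff_eq_add]
      exact this.symm
    rw [h3, ← h2]
    have h4 : (∑ i ∈ Finset.range k, if (joinInst D σ L).act c i then h i else 0) ≤
      Nat.log 2 N := h1.trans (Nat.log_mono_right hN)
    exact (Nat.cast_le.2 h4).trans (Real.natLog_le_logb N 2)
  have hresp : Respects H (DC ∪ cardinalityConstraints Q) := by
    intro d hd
    rcases Finset.mem_union.1 hd with hd | hd
    · obtain ⟨r, hX, hY, hdeg⟩ := hcons d hd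
      have hXY := (hwf d hd).1.subset
      obtain ⟨c, hc, hcr⟩ := exists_ruleAt (mem_rules (c := ⟨d.lhs, d.rhs, r⟩).2 (.inr
        ⟨r, hD ▸ Finset.mem_image_of_mem DegreeConstraint.pair hd, hXY, hY, rfl⟩))
      have hrel : (ruleAt (rules schema D) c).rel = r := by rw [hcr]
      have h1 := hrule c hc d.bound ?_ (by rw [hcr]; exact hXY) (hwf d hd).2
      · rwa [hcr] at h1
      · refine (deg_zero_le u).trans (Finset.sup_le fun j hj => ?_)
        rw [Finset.mem_range, joinInst_rows hrel] at hj
        refine (cnt_lvl_le_degree hrel hL (by rw [hcr]; exact hXY) (by rw [hcr]; exact hY)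
          hj).trans (le_trans (le_of_eq ?_) hdeg)
        congr 1 <;> rw [hcr]
    · obtain ⟨r, -, rfl⟩ := Finset.mem_image.1 hd
      obtain ⟨c, hc, hcr⟩ := exists_ruleAt (mem_rules (D := D).2 (.inl ⟨r, rfl⟩))
      have hrel : (ruleAt (rules schema D) c).rel = r := by rw [hcr]
      have h1 := hrule c hc (max 1 (Q r).card) ?_ (by simp [hcr]) (le_max_left _ _)
      · rwa [hcr] at h1
      · refine Inst.deg_le_rows.trans ?_
        rw [joinInst_rows hrel, hL.length_eq]
        exact le_max_right _ _
  have hval : ENNReal.ofReal ((2 : ℝ) ^ H Finset.univ) = (joinInst D σ L).pot 0 u := by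
    have h1 : H Finset.univ = ((∑ i ∈ Finset.range k, h i : ℕ) : ℝ) := by
      rw [hsum h, Nat.cast_sum]
      rfl
    rw [h1, Real.rpow_natCast, Inst.pot, hpot]
    rw [show (2 : ℝ) ^ (∑ i ∈ Finset.range k, h i) =
      ((2 ^ (∑ i ∈ Finset.range k, h i) : ℕ) : ℝ) by push_cast; rfl, ENNReal.ofReal_natCast]
    rfl
  rw [← hval]
  exact le_iSup_of_le H (le_iSup_of_le (isPolymatroid_modular _) (le_iSup_of_le hresp le_rfl))

end

end JoinSampling

theorem theorem1 {k m : ℕ} (schema : Fin m → Finset (Fin k))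
    (hcover : ∀ a, ∃ r, a ∈ schema r)
    (D : Finset (Finset (Fin k) × Finset (Fin k))) :
    ∃ (pre samp : Prog) (b C : ℕ),
      ∀ (Q : Join schema) (DC : Finset (DegreeConstraint k)),
        (∀ c ∈ DC, c.WellFormed) → DC.image DegreeConstraint.pair = D →
        Acyclic DC → Consistent Q DC →
        ∀ (L : ∀ r : Fin m, List (schema r → ℕ)), IsListing Q L →
        ∀ w : ℕ, (inputSize Q + 2) ^ b ≤ 2 ^ w →
          (∀ r, ∀ u ∈ Q r, ∀ a, u a < 2 ^ w) →
          expectedTime w pre (initialState L) ≤ C * (max 1 (inputSize Q) : ℕ) ∧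
          (∀ os : List (Option (Fin k → ℕ)),
            answersProb k w pre samp (initialState L) os = (os.map (sampleLaw Q)).prod) ∧
          ∀ i : ℕ, expectedOpTime w pre samp (initialState L) i ≤
            C * (polymat (DC ∪ cardinalityConstraints Q) / (max 1 (outputSize Q) : ℕ)) := by
  classical
  -- Without a compatible order, no set of constraints with these pairs is acyclic.
  by_cases hσ : ∃ σ, Compatible D σ
  swap
  · refine ⟨.skip, .skip, 0, 0, fun Q DC _ hD hacyc => absurd ?_ hσ⟩
    exact hD ▸ hacyc.exists_compatible
  obtain ⟨σ, hσ⟩ := hσ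
  set S := ruleShape (rules schema D) σ with hS
  refine ⟨S.preProg (m * k) m, S.sampProg (m * k) (level σ),
    S.boundExp * (S.preCmd.degree + Shape.startStmt.degree + S.attemptStmt.degree) + 1,
    2 * m + 2 + S.preCmd.cost 1 * (S.loopFactor + 1) +
      7 * (Shape.startStmt.cost + S.attemptStmt.cost + 4 * k + 40) * (2 * S.n) ^ k, ?_⟩
  intro Q DC hwf hD hacyc hcons L hL w hw _
  set I := joinInst D σ L with hIdef
  have hI : I.Valid := joinInst_valid hcover hσ
  have hbounds := Inst.bounds hI (joinInst_tot_le hL.length_le)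
  have htwo : 2 ≤ (inputSize Q + 2) ^ I.boundExp := Inst.two_le_bound
  -- The word length suffices for all programs.
  have hword : ∀ d ≤ S.preCmd.degree + Shape.startStmt.degree + S.attemptStmt.degree,
      ((inputSize Q + 2) ^ I.boundExp) ^ d < 2 ^ w := by
    intro d hd
    refine lt_of_lt_of_le ?_ hw
    rw [← pow_mul]
    exact Nat.pow_lt_pow_right (by omega) (Nat.lt_succ_of_le (Nat.mul_le_mul_left _ hd))
  have hset : I.Setting ((inputSize Q + 2) ^ I.boundExp) w (level σ) :=
    { valid := hI
      two_le := htwo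
      start := hword _ (by omega)
      attempt := hword S.attemptStmt.degree (by omega)
      pos_lt := fun a ha => level_coe (σ := σ) ⟨a, ha⟩ ▸ (σ.symm ⟨a, ha⟩).2 }
  have hlen : ∀ r, (L r).length ≤ (inputSize Q + 2) ^ I.boundExp := by
    intro r
    refine (hL.length_le r).trans (le_trans (by omega) (Nat.le_self_pow (n := I.boundExp) ?_ _))
    unfold Shape.boundExp
    positivity
  obtain ⟨n, hn, s₁, hdet, hgood⟩ := Inst.pre_machine (K := m * k) (m := m) hI hbounds htwo
    (hword S.preCmd.degree (by omega)) (s₀ := initialState L)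
    (M := fun A => (initialState L).arr (A.code (m * k))) (fun _ => rfl)
    (by simp [initialState]) joinInst_initial (inputMem_small L hlen)
  obtain ⟨leaf, hleaf⟩ : ∃ leaf, I.LeafArrays leaf := by
    obtain ⟨M, -, h⟩ := hgood
    exact ⟨_, h.ready.leafArrays⟩
  refine ⟨?_, fun os => ?_, fun i => ?_⟩
  · refine (expectedTime_le_of_det hdet).trans ?_
    rw [← Nat.cast_mul, Nat.cast_le]
    have h1 := S.preCmd.cost_le (S.loopFactor * max 1 (inputSize Q))
    have h2 : 1 ≤ max 1 (inputSize Q) := le_max_left _ _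
    have h3 : n ≤ 2 * m + 2 + S.preCmd.cost (S.loopFactor * max 1 (inputSize Q)) := hn
    generalize max 1 (inputSize Q) = x at h1 h2 h3 ⊢
    have h4 : S.preCmd.cost 1 * (S.loopFactor * x + 1) ≤
        S.preCmd.cost 1 * (S.loopFactor + 1) * x := by
      rw [mul_assoc]
      refine Nat.mul_le_mul_left _ ?_
      rw [Nat.succ_mul]
      omega
    have h5 := Nat.le_mul_of_pos_right (2 * m + 2) h2
    rw [add_mul, add_mul]
    omega
  · rw [answersProb]
    refine (haltProb_of_det hdet _).trans ((Inst.answersProbFrom_samp hset os hgood).trans ?_)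
    congr 2
    funext o
    exact answerLaw_eq hL hI hleaf o
  · refine (Inst.expectedOpTime_samp hset hdet hgood i).trans ?_
    rw [card_codeSet hL hI hleaf]
    have hsize : (I.size : ℝ≥0∞) ≤
        ((2 * S.n) ^ k : ℕ) * polymat (DC ∪ cardinalityConstraints Q) := by
      have h1 : I.size = (2 * S.n) ^ k * I.pot 0 0 := rfl
      rw [h1, Nat.cast_mul]
      exact mul_le_mul_right (potential_le_polymat hL hI hwf hD hcons 0) _
    refine (mul_le_mul_right (ENNReal.div_le_div_right hsize _) _).trans ?_
    rw [mul_div_assoc, ← mul_assoc, ← Nat.cast_mul]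
    refine mul_le_mul_left (Nat.cast_le.2 ?_) _
    exact Nat.le_add_left _ _
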